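/- Let $N\ge 0$ and $S^1=\mathbb{R}/2\pi\mathbb{Z}$. For $k\in S^1$ let the bulk Hamiltonian $H(k)$ act on $\ell^2(\mathbb{Z};\mathbb{C}^N)$ by $$(H(k)\psi)_n=A(k)\psi_{n-1}+A(k)^*\psi_{n+1}+V_n(k)\psi_n ,\qquad n\in\mathbb{Z},$$ where $A(k)\in \mathrm{GL}(N)$ and $V_n(k)=V_n(k)^*$ are complex $N\times N$ matrices with a $C^1$-dependence on $k$, uniformly in $n$ (i.e. $V_n$ and $V_n'$ are bounded uniformly in $n$ and $k$, and the $V_n'$ are uniformly equicontinuous). Let the edge Hamiltonian $H^\sharp(k)$ act on $\ell^2(\{1,2,\dots\};\mathbb{C}^N)$ by the same formula for $n\ge1$, with $\psi_0=0$ and with $V_n$ replaced by $V_n^\sharp$, where $V^\sharp$ has the same properties as $V$ and $V^\sharp_n(k)=V_n(k)$ for all $n>n_0$, for some $n_0$. No time-reversal symmetry is assumed. Let $\mu\in\mathbb{R}$ satisfy the gap condition $\mu\notin\sigma(H(k))$ for all $k\in S^1$. *Bulk index.* For $z\notin\sigma(H(k))$ let $E_{z,k}$ be the space of all sequences $\psi:\mathbb{Z}\to\mathbb{C}^N$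 with $H(k)\psi=z\psi$ that are square-summable at $n\to+\infty$. Let $\gamma:[-\pi,\pi]\to\mathbb{C}$ be a continuous loop encircling the part of the bulk spectrum below $\mu$: $\gamma(-\varphi)=\overline{\gamma(\varphi)}$, $\gamma(\pm\pi)=\mu$, $\operatorname{Im}\gamma(\varphi)>0$ for $0<\varphi<\pi$, and $\gamma(0)$ is smaller than $\mu$ and than every point of $\bigcup_k\sigma(H(k))$ below $\mu$. Let $v(\varphi,k)=(v_1,\dots,v_N)$, $(\varphi,k)\in[-\pi,\pi]\times S^1$, be a continuous family of bases of $E_{\gamma(\varphi),k}$ (a section of the frame bundle over the torus $\gamma\times S^1$ cut along $\{\mu\}\times S^1$), and define the transition matrix $T(k)\in\mathrm{GL}(N)$ by $v(\pi,k)=v(-\pi,k)T(k)$. The bulk index $\mathcal{N}$ is the winding number of $S^1\ni k\mapsto\det T(k)$ around $0$. *Edge index.* Let $I$ be a closed interval containing $\mu$ in its interior with $\sigma(H(k))\cap I=\varnothing$ for all $k$. For $\mu'\in I$, let the branches of eigenvalues of $H^\sharp(k)$ through level $\mu'$ at $k_*$ be the functions $\varepsilon_1,\dots,\varepsilon_d$,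 continuous near $k_*$ and differentiable at $k_*$, with $\varepsilon_i(k_*)=\mu'$, that give the eigenvalues of $H^\sharp(k)$ close to $\mu'$, repeated according to multiplicity, for $k$ near $k_*$. If necessary, $\mu$ is replaced by some $\mu'\in I$ such that the level $\mu'$ is met for only finitely many $k_*\in S^1$, and at each of them by branches with $\varepsilon_i'(k_*)\ne0$. The edge index is the number of signed crossings, decreasing branches being counted positively: $$\mathcal{N}^\sharp=-\sum_{k_*\in S^1}\ \sum_{i:\ \varepsilon_i(k_*)=\mu'}\operatorname{sgn}\varepsilon_i'(k_*).$$ **Theorem.** Both indices are well defined: sections $v$ exist, and $\mathcal{N}$ does not depend on the choice of $v$; intervals $I$ exist, each of them contains an admissible $\mu'$, and $\mathcal{N}^\sharp$ does not depend on $I$, on $\mu'$ or on the labelling of the branches. Moreover $$\mathcal{N}=\mathcal{N}^\sharp .$$ -/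

import Mathlib

open Real Filter Topology Set

noncomputable section

namespace BulkEdge

/-- The internal space `ℂ^N`, with its Euclidean norm. -/
abbrev Site (N : ℕ) : Type := EuclideanSpace ℂ (Fin N)

/-- A matrix acting on the internal space. -/
abbrev act {N : ℕ} (M : Matrix (Fin N) (Fin N) ℂ) : Site N →ₗ[ℂ] Site N :=
  Matrix.toEuclideanLin M

/-- `k ↦ V x k` depends on `k` in a `C¹` manner, uniformly in the index `x`: each entry is `C¹`,
entries and their derivatives are bounded uniformly in `x`, and the derivatives are uniformly
equicontinuous. -/
def UniformC1 {N : ℕ} {ι : Type} (V : ι → ℝ → Matrix (Fin N) (Fin N) ℂ) : Prop :=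
  (∀ x i j, ContDiff ℝ 1 (fun k => V x k i j)) ∧
  (∃ C : ℝ, ∀ x k i j, ‖V x k i j‖ ≤ C ∧ ‖deriv (fun κ => V x κ i j) k‖ ≤ C) ∧
  (∀ η > 0, ∃ δ > 0, ∀ x k k' i j, |k - k'| < δ →
    ‖deriv (fun κ => V x κ i j) k - deriv (fun κ => V x κ i j) k'‖ < η)

/-- The data of a bulk Hamiltonian: hopping matrices `A(k)` and potentials `V_n(k)`, `n ∈ ℤ`.
The circle `S¹ = ℝ/2πℤ` is described by `2π`-periodic functions of `k ∈ ℝ`. -/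
structure BulkHamiltonian (N : ℕ) where
  /-- hopping matrices -/
  A : ℝ → Matrix (Fin N) (Fin N) ℂ
  /-- potential -/
  V : ℤ → ℝ → Matrix (Fin N) (Fin N) ℂ
  A_periodic : ∀ k, A (k + 2 * π) = A k
  V_periodic : ∀ n k, V n (k + 2 * π) = V n k
  A_contDiff : ∀ i j, ContDiff ℝ 1 (fun k => A k i j)
  V_uniformC1 : UniformC1 V
  A_invertible : ∀ k, IsUnit (A k)
  V_hermitian : ∀ n k, (V n k).IsHermitian

/-- The data of an edge Hamiltonian belonging to a bulk Hamiltonian `H`: a potential on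
`{1, 2, …}` which agrees with that of `H` at distance more than `n₀` from the edge. -/
structure EdgeHamiltonian {N : ℕ} (H : BulkHamiltonian N) where
  /-- edge potential -/
  V : ℕ+ → ℝ → Matrix (Fin N) (Fin N) ℂ
  V_periodic : ∀ n k, V n (k + 2 * π) = V n k
  V_uniformC1 : UniformC1 V
  V_hermitian : ∀ n k, (V n k).IsHermitian
  eventually_bulk : ∃ n₀ : ℕ, ∀ n : ℕ+, n₀ < (n : ℕ) → ∀ k, V n k = H.V ((n : ℕ) : ℤ) k

/-- `ℓ²(ℤ; ℂ^N)`. -/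
abbrev BulkSpace (N : ℕ) : Type := lp (fun _ : ℤ => Site N) 2

/-- `ℓ²({1, 2, …}; ℂ^N)`. -/
abbrev EdgeSpace (N : ℕ) : Type := lp (fun _ : ℕ+ => Site N) 2

/-- The expression `A ψ_{n-1} + A* ψ_{n+1} + V_n ψ_n` for an arbitrary sequence on `ℤ`. -/
def bulkDiff {N : ℕ} (H : BulkHamiltonian N) (k : ℝ) (ψ : ℤ → Site N) (n : ℤ) : Site N :=
  act (H.A k) (ψ (n - 1)) + act (H.A k).conjTranspose (ψ (n + 1)) + act (H.V n k) (ψ n)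

/-- Extension of a sequence on `{1, 2, …}` by `ψ_0 = 0` (Dirichlet boundary condition). -/
def dirichlet {N : ℕ} (ψ : ℕ+ → Site N) (n : ℕ) : Site N :=
  if h : 0 < n then ψ (n.toPNat h) else 0

/-- The expression `A ψ_{n-1} + A* ψ_{n+1} + V♯_n ψ_n`, `n ≥ 1`, read with `ψ_0 = 0`. -/
def edgeDiff {N : ℕ} {H : BulkHamiltonian N} (Hs : EdgeHamiltonian H) (k : ℝ)
    (ψ : ℕ+ → Site N) (n : ℕ+) : Site N :=
  act (H.A k) (dirichlet ψ ((n : ℕ) - 1)) + act (H.A k).conjTranspose (ψ (n + 1))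
    + act (Hs.V n k) (ψ n)

theorem norm_act_le {N : ℕ} (M : Matrix (Fin N) (Fin N) ℂ) (C : ℝ) (hC : ∀ i j, ‖M i j‖ ≤ C)
    (v : Site N) : ‖act M v‖ ≤ (N * (N * C)) * ‖v‖ := by
  have h1 : ∀ w : Site N, ‖w‖ ≤ ∑ i, ‖w i‖ := by
    intro w
    rw [EuclideanSpace.norm_eq]
    refine Real.sqrt_le_iff.mpr ⟨Finset.sum_nonneg fun _ _ => norm_nonneg _, ?_⟩
    exact Finset.sum_sq_le_sq_sum_of_nonneg fun _ _ => norm_nonneg _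
  refine (h1 _).trans ?_
  have h2 : ∀ i, ‖act M v i‖ ≤ N * C * ‖v‖ := by
    intro i
    have : act M v i = ∑ j, M i j * v j := by
      simp [act, Matrix.toLpLin_apply, Matrix.mulVec, dotProduct]
    rw [this]
    refine (norm_sum_le _ _).trans ?_
    have h3 : ∀ j ∈ Finset.univ, ‖M i j * v j‖ ≤ C * ‖v‖ := by
      intro j _
      rw [norm_mul]
      exact mul_le_mul (hC i j) (PiLp.norm_apply_le v j) (norm_nonneg _)
        ((norm_nonneg _).trans (hC i j))
    refine (Finset.sum_le_sum h3).trans (le_of_eq ?_)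
    simp [mul_assoc]
  refine (Finset.sum_le_sum fun i _ => h2 i).trans (le_of_eq ?_)
  simp [mul_assoc]

theorem memℓp_act {N : ℕ} {ι : Type} (M : ι → Matrix (Fin N) (Fin N) ℂ)
    (hM : ∃ C : ℝ, ∀ x i j, ‖M x i j‖ ≤ C) {ψ : ι → Site N} (hψ : Memℓp ψ 2) :
    Memℓp (fun x => act (M x) (ψ x)) 2 := by
  obtain ⟨C, hC⟩ := hM
  refine memℓp_gen ?_
  have hs := (memℓp_gen_iff (by norm_num : 0 < (2 : ENNReal).toReal)).1 hψ
  refine Summable.of_nonneg_of_le (fun x => by positivity) (fun x => ?_)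
    (hs.mul_left ((N * (N * C)) ^ (2 : ENNReal).toReal))
  have h := norm_act_le (M x) C (hC x) (ψ x)
  simp only [ENNReal.toReal_ofNat, Real.rpow_ofNat]
  calc ‖act (M x) (ψ x)‖ ^ 2 ≤ ((N * (N * C)) * ‖ψ x‖) ^ 2 :=
        pow_le_pow_left₀ (norm_nonneg _) h 2
    _ = _ := by ring

theorem memℓp_comp {N : ℕ} {ι κ : Type} {ψ : κ → Site N} (hψ : Memℓp ψ 2) {f : ι → κ}
    (hf : Function.Injective f) : Memℓp (fun x => ψ (f x)) 2 := by
  refine memℓp_gen ?_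
  have hs := (memℓp_gen_iff (by norm_num : 0 < (2 : ENNReal).toReal)).1 hψ
  exact hs.comp_injective hf

theorem exists_bound_const {N : ℕ} {ι : Type} (M : Matrix (Fin N) (Fin N) ℂ) :
    ∃ C : ℝ, ∀ (_ : ι) i j, ‖M i j‖ ≤ C :=
  ⟨∑ i, ∑ j, ‖M i j‖, fun _ i j =>
    (Finset.single_le_sum (f := fun j => ‖M i j‖) (fun _ _ => norm_nonneg _)
      (Finset.mem_univ j)).trans
    (Finset.single_le_sum (f := fun i => ∑ j, ‖M i j‖)
      (fun _ _ => Finset.sum_nonneg fun _ _ => norm_nonneg _) (Finset.mem_univ i))⟩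

theorem memℓp_bulkDiff {N : ℕ} (H : BulkHamiltonian N) (k : ℝ) (ψ : BulkSpace N) :
    Memℓp (bulkDiff H k ψ) 2 := by
  have h1 := memℓp_act (fun _ : ℤ => H.A k) (exists_bound_const _)
    (memℓp_comp (f := fun n : ℤ => n - 1) ψ.2 (sub_left_injective))
  have h2 := memℓp_act (fun _ : ℤ => (H.A k).conjTranspose) (exists_bound_const _)
    (memℓp_comp (f := fun n : ℤ => n + 1) ψ.2 (add_left_injective 1))
  obtain ⟨C, hC⟩ := H.V_uniformC1.2.1
  have h3 := memℓp_act (fun n => H.V n k) ⟨C, fun n i j => (hC n k i j).1⟩ ψ.2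
  exact (h1.add h2).add h3

theorem memℓp_dirichlet {N : ℕ} {ψ : ℕ+ → Site N} (hψ : Memℓp ψ 2) :
    Memℓp (dirichlet ψ) 2 := by
  refine memℓp_gen ?_
  have hs := (memℓp_gen_iff (by norm_num : 0 < (2 : ENNReal).toReal)).1 hψ
  refine (Function.Injective.summable_iff PNat.coe_injective ?_).1 ?_
  · intro n hn
    have : ¬ 0 < n := fun h => hn ⟨⟨n, h⟩, rfl⟩
    simp [dirichlet, this]
  · refine hs.congr fun n => ?_
    have h : dirichlet ψ (n : ℕ) = ψ n := by
      unfold dirichlet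
      rw [dif_pos n.pos]
      rfl
    simp only [Function.comp_apply, h]

theorem memℓp_edgeDiff {N : ℕ} {H : BulkHamiltonian N} (Hs : EdgeHamiltonian H) (k : ℝ)
    (ψ : EdgeSpace N) : Memℓp (edgeDiff Hs k ψ) 2 := by
  have h1 := memℓp_act (fun _ : ℕ+ => H.A k) (exists_bound_const _)
    (memℓp_comp (f := fun n : ℕ+ => (n : ℕ) - 1) (memℓp_dirichlet ψ.2) (by
      intro a b h
      have ha := a.pos
      have hb := b.pos
      apply PNat.coe_injective
      simp only at h
      omega))
  have h2 := memℓp_act (fun _ : ℕ+ => (H.A k).conjTranspose) (exists_bound_const _)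
    (memℓp_comp (f := fun n : ℕ+ => n + 1) ψ.2 (add_left_injective 1))
  obtain ⟨C, hC⟩ := Hs.V_uniformC1.2.1
  have h3 := memℓp_act (fun n => Hs.V n k) ⟨C, fun n i j => (hC n k i j).1⟩ ψ.2
  exact (h1.add h2).add h3

theorem continuous_lp_coord {N : ℕ} {ι : Type} (x : ι) :
    Continuous (fun ψ : lp (fun _ : ι => Site N) 2 => ψ x) :=
  (continuous_apply x).comp (lp.uniformContinuous_coe (E := fun _ : ι => Site N)
    (p := 2)).continuous

theorem continuous_act {N : ℕ} (M : Matrix (Fin N) (Fin N) ℂ) : Continuous (act M) :=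
  LinearMap.continuous_of_finiteDimensional _

/-- A linear map on `ℓ²` all of whose components are continuous is continuous. -/
theorem continuous_of_coord {N : ℕ} {ι : Type}
    (T : lp (fun _ : ι => Site N) 2 →ₗ[ℂ] lp (fun _ : ι => Site N) 2)
    (h : ∀ x, Continuous fun ψ => T ψ x) : Continuous T := by
  refine LinearMap.continuous_of_seq_closed_graph T fun u ψ χ hu hTu => ?_
  ext1
  funext x
  exact tendsto_nhds_unique (((continuous_lp_coord x).tendsto χ).comp hTu)
    (((h x).tendsto ψ).comp hu)

/-- The bulk Hamiltonian `H(k)`, a bounded operator on `ℓ²(ℤ; ℂ^N)`. -/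
def BulkHamiltonian.op {N : ℕ} (H : BulkHamiltonian N) (k : ℝ) :
    BulkSpace N →L[ℂ] BulkSpace N :=
  let T : BulkSpace N →ₗ[ℂ] BulkSpace N :=
    { toFun := fun ψ => ⟨bulkDiff H k ψ, memℓp_bulkDiff H k ψ⟩
      map_add' := fun ψ χ => by
        ext1
        funext n
        simp only [bulkDiff, lp.coeFn_add, Pi.add_apply, map_add]
        abel
      map_smul' := fun c ψ => by
        ext1
        funext n
        simp only [bulkDiff, lp.coeFn_smul, Pi.smul_apply, map_smul, RingHom.id_apply, smul_add] }
  { toLinearMap := T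
    cont := continuous_of_coord T fun n => by
      change Continuous fun ψ : BulkSpace N => bulkDiff H k ψ n
      exact (((continuous_act _).comp (continuous_lp_coord _)).add
        ((continuous_act _).comp (continuous_lp_coord _))).add
        ((continuous_act _).comp (continuous_lp_coord _)) }

theorem continuous_dirichlet {N : ℕ} (n : ℕ) :
    Continuous fun ψ : EdgeSpace N => dirichlet (ψ : ℕ+ → Site N) n := by
  unfold dirichlet
  split_ifs
  · exact continuous_lp_coord _
  · exact continuous_const

theorem dirichlet_add {N : ℕ} (ψ χ : ℕ+ → Site N) (n : ℕ) :
    dirichlet (ψ + χ) n = dirichlet ψ n + dirichlet χ n := by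
  unfold dirichlet
  split_ifs <;> simp

theorem dirichlet_smul {N : ℕ} (c : ℂ) (ψ : ℕ+ → Site N) (n : ℕ) :
    dirichlet (c • ψ) n = c • dirichlet ψ n := by
  unfold dirichlet
  split_ifs <;> simp

/-- The edge Hamiltonian `H♯(k)`, a bounded operator on `ℓ²({1, 2, …}; ℂ^N)`. -/
def EdgeHamiltonian.op {N : ℕ} {H : BulkHamiltonian N} (Hs : EdgeHamiltonian H) (k : ℝ) :
    EdgeSpace N →L[ℂ] EdgeSpace N :=
  let T : EdgeSpace N →ₗ[ℂ] EdgeSpace N :=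
    { toFun := fun ψ => ⟨edgeDiff Hs k ψ, memℓp_edgeDiff Hs k ψ⟩
      map_add' := fun ψ χ => by
        ext1
        funext n
        simp only [edgeDiff, lp.coeFn_add, Pi.add_apply, map_add, dirichlet_add]
        abel
      map_smul' := fun c ψ => by
        ext1
        funext n
        simp only [edgeDiff, lp.coeFn_smul, Pi.smul_apply, map_smul, RingHom.id_apply, smul_add,
          dirichlet_smul] }
  { toLinearMap := T
    cont := continuous_of_coord T fun n => by
      change Continuous fun ψ : EdgeSpace N => edgeDiff Hs k ψ n
      exact (((continuous_act _).comp (continuous_dirichlet _)).add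
        ((continuous_act _).comp (continuous_lp_coord _))).add
        ((continuous_act _).comp (continuous_lp_coord _)) }

/-! ### The bulk index -/

/-- The fibre `E_{z,k}`: all sequences `ψ : ℤ → ℂ^N` with `H(k) ψ = z ψ` that are
square-summable at `n → +∞`. -/
def solutionSpace {N : ℕ} (H : BulkHamiltonian N) (z : ℂ) (k : ℝ) :
    Submodule ℂ (ℤ → Site N) where
  carrier := {ψ | (∀ n, bulkDiff H k ψ n = z • ψ n) ∧ Summable fun n : ℕ => ‖ψ (n : ℤ)‖ ^ 2}
  zero_mem' := by
    refine ⟨fun n => by simp [bulkDiff], by simp⟩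
  add_mem' := by
    rintro ψ χ ⟨h1, h2⟩ ⟨h3, h4⟩
    refine ⟨fun n => ?_, ?_⟩
    · have : bulkDiff H k (ψ + χ) n = bulkDiff H k ψ n + bulkDiff H k χ n := by
        simp only [bulkDiff, Pi.add_apply, map_add]
        abel
      rw [this, h1, h3, Pi.add_apply, smul_add]
    · refine Summable.of_nonneg_of_le (fun n => by positivity) (fun n => ?_)
        ((h2.add h4).mul_left 2)
      have h5 := norm_add_le (ψ (n : ℤ)) (χ (n : ℤ))
      simp only [Pi.add_apply]
      nlinarith [norm_nonneg (ψ (n : ℤ) + χ (n : ℤ)), sq_nonneg (‖ψ (n : ℤ)‖ - ‖χ (n : ℤ)‖)]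
  smul_mem' := by
    rintro c ψ ⟨h1, h2⟩
    refine ⟨fun n => ?_, ?_⟩
    · have : bulkDiff H k (c • ψ) n = c • bulkDiff H k ψ n := by
        simp only [bulkDiff, Pi.smul_apply, map_smul, smul_add]
      rw [this, h1, Pi.smul_apply, smul_comm]
    · simpa [norm_smul, mul_pow] using h2.mul_left (‖c‖ ^ 2)

/-- A frame of `E_{z,k}`: an ordered basis `v = (v_1, …, v_N)` of that space. -/
def IsFrame {N : ℕ} (H : BulkHamiltonian N) (z : ℂ) (k : ℝ) (v : Fin N → ℤ → Site N) : Prop :=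
  LinearIndependent ℂ v ∧ Submodule.span ℂ (Set.range v) = solutionSpace H z k

/-- A reflection-symmetric loop `γ`, parametrized by `φ ∈ [-π, π]`, that encircles the part of the
bulk spectrum lying below `μ`: it meets the real axis at the Fermi energy `μ` (for `φ = ±π`) and at
a point to the left of `μ` and of the bulk spectrum below `μ` (for `φ = 0`), and lies in the
upper half-plane for `0 < φ < π`. In particular `γ` reaches `μ` from above as `φ → π`. -/
structure IsFermiLoop {N : ℕ} (H : BulkHamiltonian N) (μ : ℝ) (γ : ℝ → ℂ) : Prop where
  continuousOn : ContinuousOn γ (Icc (-π) π)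
  symm : ∀ φ ∈ Icc (-π) π, γ (-φ) = (starRingEnd ℂ) (γ φ)
  fermi : γ π = (μ : ℂ)
  upper : ∀ φ ∈ Ioo 0 π, 0 < (γ φ).im
  left_of_fermi : (γ 0).re < μ
  left_of_spectrum : ∀ k : ℝ, ∀ z ∈ spectrum ℂ (H.op k), z.re < μ → (γ 0).re < z.re

/-- A continuous section of the frame bundle of `E` over the torus `γ × S¹` cut along the Fermi
line `{μ} × S¹`. The space of sequences carries the product topology. -/
structure IsFrameSection {N : ℕ} (H : BulkHamiltonian N) (γ : ℝ → ℂ)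
    (v : ℝ → ℝ → Fin N → ℤ → Site N) : Prop where
  continuousOn : ContinuousOn (fun p : ℝ × ℝ => v p.1 p.2) (Icc (-π) π ×ˢ univ)
  periodic : ∀ φ ∈ Icc (-π) π, ∀ k, v φ (k + 2 * π) = v φ k
  frame : ∀ φ ∈ Icc (-π) π, ∀ k, IsFrame H (γ φ) k (v φ k)

/-- `T` is the transition matrix `v_+(k) = v_-(k) T(k)` between the boundary values
`v_±(k) = v(±π, k)` at the two sides of the cut. -/
def IsTransition {N : ℕ} (v : ℝ → ℝ → Fin N → ℤ → Site N)
    (T : ℝ → Matrix (Fin N) (Fin N) ℂ) : Prop :=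
  ∀ k j, v π k j = ∑ i, T k i j • v (-π) k i

/-- The `2π`-periodic nowhere vanishing function `f` is continuous and has winding number `m`
around `0`. -/
def HasWinding (f : ℝ → ℂ) (m : ℤ) : Prop :=
  ∃ g : ℝ → ℂ, Continuous g ∧ (∀ k, f k = Complex.exp (g k)) ∧
    g (2 * π) - g 0 = m * (2 * π * Complex.I)

/-- `m` is the winding number of `det T` for the transition matrix `T` of some section of the frame
bundle over the cut torus. -/
def IsBulkIndex {N : ℕ} (H : BulkHamiltonian N) (γ : ℝ → ℂ) (m : ℤ) : Prop :=
  ∃ (v : ℝ → ℝ → Fin N → ℤ → Site N) (T : ℝ → Matrix (Fin N) (Fin N) ℂ),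
    IsFrameSection H γ v ∧ IsTransition v T ∧ HasWinding (fun k => (T k).det) m

/-! ### The edge index -/

/-- The eigenspace of `H♯(k)` for the real number `x`. -/
def EdgeHamiltonian.eigenspace {N : ℕ} {H : BulkHamiltonian N} (Hs : EdgeHamiltonian H)
    (k x : ℝ) : Submodule ℂ (EdgeSpace N) :=
  Module.End.eigenspace (Hs.op k).toLinearMap (x : ℂ)

/-- `ε_1, …, ε_m` are the eigenvalue branches of `H♯` through `(k₀, μ)`, repeated according to
multiplicity. They are continuous near `k₀` and differentiable at `k₀`. -/
def IsEdgeBranches {N : ℕ} {H : BulkHamiltonian N} (Hs : EdgeHamiltonian H) (μ k₀ : ℝ) {m : ℕ}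
    (ε : Fin m → ℝ → ℝ) : Prop :=
  (∀ i, ε i k₀ = μ ∧ DifferentiableAt ℝ (ε i) k₀ ∧ ∀ᶠ k in 𝓝 k₀, ContinuousAt (ε i) k) ∧
  ∃ δ > 0, ∀ k, |k - k₀| < δ → ∀ x, |x - μ| < δ →
    Module.finrank ℂ (Hs.eigenspace k x) = Nat.card {i // ε i k = x}

/-- The level `μ` is crossed by the eigenvalue branches of `H♯` at only finitely many `k ∈ S¹`, in
each case with non-zero slope, and `m` is the number of signed crossings, counted positively for
decreasing branches. -/
def IsSignedCrossingNumber {N : ℕ} {H : BulkHamiltonian N} (Hs : EdgeHamiltonian H) (μ : ℝ)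
    (m : ℤ) : Prop :=
  ∃ (K : Finset ℝ) (d : ℝ → ℕ) (ε : (k : ℝ) → Fin (d k) → ℝ → ℝ),
    (∀ k, k ∈ K ↔ k ∈ Ico 0 (2 * π) ∧ Hs.eigenspace k μ ≠ ⊥) ∧
    (∀ k ∈ K, IsEdgeBranches Hs μ k (ε k) ∧ ∀ i, deriv (ε k i) k ≠ 0) ∧
    m = ∑ k ∈ K, ∑ i, -((SignType.sign (deriv (ε k i) k) : SignType) : ℤ)

/-- `[a, b]` is a closed interval containing `μ` in its interior and free of bulk spectrum. -/
def IsGapInterval {N : ℕ} (H : BulkHamiltonian N) (μ a b : ℝ) : Prop :=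
  a < μ ∧ μ < b ∧ ∀ k : ℝ, ∀ x ∈ Icc a b, (x : ℂ) ∉ spectrum ℂ (H.op k)

/-- `m` is the number of signed crossings of the Fermi energy, the latter being adjusted, if
needed, within the interval `[a, b]` so that all crossings have non-zero slope. -/
def IsEdgeIndex {N : ℕ} {H : BulkHamiltonian N} (Hs : EdgeHamiltonian H) (a b : ℝ) (m : ℤ) :
    Prop :=
  ∃ μ' ∈ Icc a b, IsSignedCrossingNumber Hs μ' m

end BulkEdge

end

/-!
Both indices are computed by one object, the boundary scattering matrix of an edge Hamiltonian. Let
`Q` be the projection onto the first site of the half-line and `X = H♯(k) - x` for a real energy `x`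
outside the bulk spectrum. Then `X` is semi-Fredholm, since up to finite rank it is the restriction
of the invertible operator `H(k) - x` to the half-line (`isProperOp_edge`), and an eigenvector of
`H♯(k)` which vanishes at the first site vanishes identically, since `A(k)` is invertible
(`eq_zero_of_apply_one_eq_zero`). Hence `X ∓ iQ` is invertible (`isUnit_edge`), and `boundaryScat Hs
x k`, the compression of `(X + iQ)(X - iQ)⁻¹` to the first site, is an invertible `N × N` matrix
which is continuous and periodic in `k`. The winding number of its determinant does not change when
`x` moves within the gap (`hasWinding_boundaryScat_energy`) or when the edge potential is deformed
(`hasWinding_boundaryScat_potential`).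

*Bulk side.* On the closed upper half of the loop `H⁺(k) - z - iQ` is invertible, `H⁺` being the
half-line Hamiltonian with potential `V`, and therefore solutions decaying at `+∞` correspond
bijectively to their boundary values `Aψ₀ + iψ₁`; on the lower half the same holds for `Aψ₀ - iψ₁`
(`eq_zero_of_boundaryValue`, `decaySol_spec`). So each half of the loop carries a canonical frame.
At the two real points of the loop, `μ` and `γ(0)`, the two boundary values of a solution are
related by the boundary scattering matrix (`boundaryValue_neg_one`), and the bulk index is the
difference of its winding numbers there (`isBulkIndex_iff`). The one at `γ(0)` vanishes: `γ(0)` can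
be moved below all edge eigenvalues without touching the bulk spectrum
(`hasWinding_boundaryScat_zero`).

*Edge side.* In the definition of the scattering matrix `Q` may be replaced by `q(k) Q` with a
continuous weight `q ≥ 0`, as long as `q(k) ≠ 0` wherever `x` is an eigenvalue of `H♯(k)`. Take `q`
supported near the crossings of the level `x`. The matrix is then `1` away from the crossings, and
near a crossing its determinant is a product of `N` explicit phases, to which each eigenvalue branch
contributes one turn, in the direction given by its slope (`eventually_hasIncrement_tentDet`). So
the winding number is the number of signed crossings (`hasWinding_of_isSignedCrossingNumber`).

The local picture comes from `(X + sQ)⁻¹` with a generic `s > 0`: the eigenvalue equation at energy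
`x` says that the compression of this operator to the first site has the eigenvalue `1/s`, and the
ordered eigenvalues of this Hermitian matrix are Lipschitz in `(k, x)` and strictly increasing in
`x` by Weyl's inequality (`exists_local_reduction`). Thus edge eigenvalues in the gap are locally
given by finitely many Lipschitz branches (`exists_local_branches`), almost every level is
noncritical for these by the theorems of Rademacher and Sard (`volume_critical_values`), and
admissible levels exist in every interval in the gap (`exists_isSignedCrossingNumber`).
-/


namespace BulkEdge

/-! ### Winding numbers -/

theorem exists_continuous_log {X : Type*} [TopologicalSpace X] [LocallyPathConnectedSpace X]
    [SimplyConnectedSpace X] {f : X → ℂ} (hf : Continuous f) (h0 : ∀ x, f x ≠ 0) :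
    ∃ g : X → ℂ, Continuous g ∧ ∀ x, f x = Complex.exp (g x) := by
  obtain ⟨x₀⟩ : Nonempty X := inferInstance
  obtain ⟨g, ⟨-, hg⟩, -⟩ := Complex.isCoveringMapOn_exp.existsUnique_continuousMap_lifts
    (⟨f, hf⟩ : C(X, ℂ)) (Complex.exp_log (h0 x₀)) (fun x => h0 x)
  exact ⟨g, g.continuous, fun x => (congrFun hg x).symm⟩

/-- A continuous logarithm of the constant function `1` is constant on connected sets. -/
theorem eq_of_exp_eq_one {S : Set ℝ} (hS : IsPreconnected S) {h : ℝ → ℂ} (hc : ContinuousOn h S)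
    (h1 : ∀ x ∈ S, Complex.exp (h x) = 1) {x y : ℝ} (hx : x ∈ S) (hy : y ∈ S) : h x = h y := by
  have hd : ∀ x ∈ S, ∃ n : ℤ, h x = n * (2 * π * Complex.I) := fun x hx =>
    Complex.exp_eq_one_iff.1 (h1 x hx)
  choose! n hn using hd
  have hpi : (2 * π * Complex.I : ℂ) ≠ 0 := Complex.two_pi_I_ne_zero
  have hcont : ContinuousOn n S := by
    have h2 : ContinuousOn (fun x => ((n x : ℤ) : ℝ)) S := by
      have h3 : ContinuousOn (fun x => (h x / (2 * π * Complex.I)).re) S :=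
        Complex.continuous_re.comp_continuousOn (hc.div_const _)
      refine h3.congr fun x hx => ?_
      have : h x / (2 * π * Complex.I) = ((n x : ℤ) : ℂ) := by
        rw [hn x hx, mul_div_cancel_right₀ _ hpi]
      simp only [this, Complex.intCast_re]
    exact Int.isClosedEmbedding_coe_real.isInducing.continuousOn_iff.2 h2
  rw [hn x hx, hn y hy, hS.constant hcont hx hy]

/-- The continuous argument (logarithm) of `f` changes by `w` along `[c, d]`. -/
def HasIncrement (f : ℝ → ℂ) (c d : ℝ) (w : ℂ) : Prop :=
  ∃ g : ℝ → ℂ, ContinuousOn g (Icc c d) ∧ (∀ k ∈ Icc c d, f k = Complex.exp (g k)) ∧ g d - g c = w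

theorem HasIncrement.unique {f : ℝ → ℂ} {c d : ℝ} (hcd : c ≤ d) {w w' : ℂ}
    (h : HasIncrement f c d w) (h' : HasIncrement f c d w') : w = w' := by
  obtain ⟨g, hg, hgf, rfl⟩ := h
  obtain ⟨g', hg', hgf', rfl⟩ := h'
  have := eq_of_exp_eq_one isPreconnected_Icc (hg.sub hg') (fun x hx => by
    rw [Pi.sub_apply, Complex.exp_sub, ← hgf x hx, ← hgf' x hx, div_self]
    rw [hgf x hx]
    exact Complex.exp_ne_zero _) (right_mem_Icc.2 hcd) (left_mem_Icc.2 hcd)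
  simp only [Pi.sub_apply] at this
  linear_combination this

theorem HasIncrement.mul {f f' : ℝ → ℂ} {c d : ℝ} {w w' : ℂ}
    (h : HasIncrement f c d w) (h' : HasIncrement f' c d w') :
    HasIncrement (fun k => f k * f' k) c d (w + w') := by
  obtain ⟨g, hg, hgf, rfl⟩ := h
  obtain ⟨g', hg', hgf', rfl⟩ := h'
  refine ⟨fun k => g k + g' k, hg.add hg', fun k hk => ?_, by ring⟩
  simp only [hgf k hk, hgf' k hk, Complex.exp_add]

theorem HasWinding.hasIncrement {f : ℝ → ℂ} {m : ℤ} (h : HasWinding f m) :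
    HasIncrement f 0 (2 * π) (m * (2 * π * Complex.I)) := by
  obtain ⟨g, hg, hgf, hw⟩ := h
  exact ⟨g, hg.continuousOn, fun k _ => hgf k, hw⟩

theorem HasWinding.continuous {f : ℝ → ℂ} {m : ℤ} (h : HasWinding f m) : Continuous f := by
  obtain ⟨g, hg, hgf, -⟩ := h
  rw [show f = fun k => Complex.exp (g k) from funext hgf]
  fun_prop

theorem HasWinding.ne_zero {f : ℝ → ℂ} {m : ℤ} (h : HasWinding f m) (k : ℝ) : f k ≠ 0 := by
  obtain ⟨g, hg, hgf, -⟩ := h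
  rw [hgf]
  exact Complex.exp_ne_zero _

theorem hasWinding_of_hasIncrement {f : ℝ → ℂ} {m : ℤ} (hf : Continuous f) (h0 : ∀ k, f k ≠ 0)
    (h : HasIncrement f 0 (2 * π) (m * (2 * π * Complex.I))) : HasWinding f m := by
  obtain ⟨g, hg, hgf⟩ := exists_continuous_log hf h0
  refine ⟨g, hg, hgf, ?_⟩
  exact HasIncrement.unique (by positivity) ⟨g, hg.continuousOn, fun k _ => hgf k, rfl⟩ h

theorem HasWinding.unique {f : ℝ → ℂ} {m m' : ℤ} (h : HasWinding f m) (h' : HasWinding f m') :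
    m = m' := by
  have := HasIncrement.unique (by positivity) h.hasIncrement h'.hasIncrement
  exact_mod_cast mul_right_cancel₀ Complex.two_pi_I_ne_zero this

theorem exists_hasWinding {f : ℝ → ℂ} (hf : Continuous f) (h0 : ∀ k, f k ≠ 0)
    (hp : f (2 * π) = f 0) : ∃ m, HasWinding f m := by
  obtain ⟨g, hg, hgf⟩ := exists_continuous_log hf h0
  have : Complex.exp (g (2 * π) - g 0) = 1 := by
    rw [Complex.exp_sub, ← hgf, ← hgf, hp, div_self (h0 0)]
  obtain ⟨m, hm⟩ := Complex.exp_eq_one_iff.1 this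
  exact ⟨m, g, hg, hgf, hm⟩

theorem HasWinding.mul {f f' : ℝ → ℂ} {m m' : ℤ} (h : HasWinding f m) (h' : HasWinding f' m') :
    HasWinding (fun k => f k * f' k) (m + m') := by
  refine hasWinding_of_hasIncrement (h.continuous.mul h'.continuous)
    (fun k => mul_ne_zero (h.ne_zero k) (h'.ne_zero k)) ?_
  have := h.hasIncrement.mul h'.hasIncrement
  push_cast
  rwa [add_mul]

/-- The increment of the logarithm is invariant under homotopies of closed paths: it varies
continuously in `2πi ℤ`. -/
theorem hasIncrement_homotopy {F : ℝ → ℝ → ℂ} {a b c d : ℝ} (hab : a ≤ b) (hcd : c ≤ d)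
    (hF : ContinuousOn (fun p : ℝ × ℝ => F p.1 p.2) (Icc a b ×ˢ Icc c d))
    (h0 : ∀ t ∈ Icc a b, ∀ k ∈ Icc c d, F t k ≠ 0) (hper : ∀ t ∈ Icc a b, F t d = F t c) :
    ∃ w, HasIncrement (F a) c d w ∧ HasIncrement (F b) c d w := by
  set pt : ℝ → ℝ := fun t => projIcc a b hab t
  set pk : ℝ → ℝ := fun t => projIcc c d hcd t
  have hpt : Continuous pt := continuous_subtype_val.comp continuous_projIcc
  have hpk : Continuous pk := continuous_subtype_val.comp continuous_projIcc
  have mt : ∀ t, pt t ∈ Icc a b := fun t => (projIcc a b hab t).2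
  have mk : ∀ t, pk t ∈ Icc c d := fun t => (projIcc c d hcd t).2
  have et : ∀ t ∈ Icc a b, pt t = t := fun t ht => by simp [pt, projIcc_of_mem hab ht]
  have ek : ∀ t ∈ Icc c d, pk t = t := fun t ht => by simp [pk, projIcc_of_mem hcd ht]
  obtain ⟨g, hg, hgf⟩ := exists_continuous_log
    (f := fun p : ℝ × ℝ => F (pt p.1) (pk p.2))
    (hF.comp_continuous ((hpt.comp continuous_fst).prodMk (hpk.comp continuous_snd))
      (fun p => ⟨mt _, mk _⟩)) (fun p => h0 _ (mt _) _ (mk _))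
  have key : g (a, d) - g (a, c) = g (b, d) - g (b, c) := by
    refine eq_of_exp_eq_one (S := univ) (h := fun t => g (t, d) - g (t, c)) isPreconnected_univ
      (by fun_prop) (fun t _ => ?_) (mem_univ a) (mem_univ b)
    rw [Complex.exp_sub, ← hgf, ← hgf]
    simp only [ek c (left_mem_Icc.2 hcd), ek d (right_mem_Icc.2 hcd)]
    rw [hper _ (mt t), div_self (h0 _ (mt t) _ (left_mem_Icc.2 hcd))]
  refine ⟨_, ⟨fun k => g (a, k), by fun_prop, fun k hk => ?_, rfl⟩,
    ⟨fun k => g (b, k), by fun_prop, fun k hk => ?_, key.symm⟩⟩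
  · rw [← hgf]
    simp only [et a (left_mem_Icc.2 hab), ek k hk]
  · rw [← hgf]
    simp only [et b (right_mem_Icc.2 hab), ek k hk]

theorem hasWinding_homotopy {F : ℝ → ℝ → ℂ} {a b : ℝ} (hab : a ≤ b)
    (hF : ContinuousOn (fun p : ℝ × ℝ => F p.1 p.2) (Icc a b ×ˢ univ))
    (h0 : ∀ t ∈ Icc a b, ∀ k, F t k ≠ 0) (hper : ∀ t ∈ Icc a b, F t (2 * π) = F t 0) :
    ∃ m, HasWinding (F a) m ∧ HasWinding (F b) m := by
  have hc : ∀ t ∈ Icc a b, Continuous (F t) := fun t ht =>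
    hF.comp_continuous (f := fun k : ℝ => (t, k)) (by fun_prop) (fun k => ⟨ht, mem_univ k⟩)
  have ha := left_mem_Icc.2 hab
  have hb := right_mem_Icc.2 hab
  obtain ⟨m, hm⟩ := exists_hasWinding (hc a ha) (h0 a ha) (hper a ha)
  obtain ⟨w, hw, hw'⟩ := hasIncrement_homotopy hab (by positivity : (0 : ℝ) ≤ 2 * π)
    (hF.mono (prod_mono_right (subset_univ _))) (fun t ht k _ => h0 t ht k) hper
  refine ⟨m, hm, hasWinding_of_hasIncrement (hc b hb) (h0 b hb) ?_⟩
  rwa [HasIncrement.unique (by positivity) hm.hasIncrement hw]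

/-- The winding number may be read off from any period interval. -/
theorem HasWinding.hasIncrement_period {f : ℝ → ℂ} {m : ℤ} (h : HasWinding f m)
    (hp : ∀ k, f (k + 2 * π) = f k) (c : ℝ) :
    HasIncrement f c (c + 2 * π) (m * (2 * π * Complex.I)) := by
  have h0 := h.ne_zero
  obtain ⟨g, hg, hgf, hw⟩ := h
  refine ⟨g, hg.continuousOn, fun k _ => hgf k, ?_⟩
  have := eq_of_exp_eq_one (S := univ) (h := fun t => g (t + 2 * π) - g t) isPreconnected_univ
    (by fun_prop) (fun t _ => by
      rw [Complex.exp_sub, ← hgf, ← hgf, hp, div_self (h0 t)]) (mem_univ c) (mem_univ 0)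
  simp only [zero_add] at this
  rw [this, hw]

/-! ### Invertibility modulo finite rank -/

section Abstract

variable {E F : Type*} [NormedAddCommGroup E] [InnerProductSpace ℂ E]
  [NormedAddCommGroup F] [InnerProductSpace ℂ F]

/-- A sequential form of the left semi-Fredholm property: a bounded sequence whose image converges
has a convergent subsequence. -/
def IsProperOp (T : E →L[ℂ] F) : Prop :=
  ∀ u : ℕ → E, (∃ C, ∀ n, ‖u n‖ ≤ C) → ∀ y, Tendsto (fun n => T (u n)) atTop (𝓝 y) →
    ∃ φ : ℕ → ℕ, StrictMono φ ∧ ∃ x, Tendsto (fun n => u (φ n)) atTop (𝓝 x)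

theorem exists_tendsto_of_isCompactOperator {K : E →L[ℂ] F} (hK : IsCompactOperator K)
    {u : ℕ → E} (hu : ∃ C, ∀ n, ‖u n‖ ≤ C) :
    ∃ φ : ℕ → ℕ, StrictMono φ ∧ ∃ x, Tendsto (fun n => K (u (φ n))) atTop (𝓝 x) := by
  obtain ⟨C, hC⟩ := hu
  obtain ⟨S, hS, hSK⟩ := IsCompactOperator.image_closedBall_subset_compact
    (f := (K : E →ₗ[ℂ] F)) hK C
  obtain ⟨x, -, φ, hφ, hx⟩ := hS.tendsto_subseq (x := fun n => K (u n)) (fun n =>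
    hSK ⟨u n, by simpa using hC n, rfl⟩)
  exact ⟨φ, hφ, x, hx⟩

theorem IsProperOp.add {T K : E →L[ℂ] F} (hT : IsProperOp T) (hK : IsCompactOperator K) :
    IsProperOp (T + K) := by
  intro u hu y hy
  obtain ⟨φ, hφ, x, hx⟩ := exists_tendsto_of_isCompactOperator hK hu
  obtain ⟨C, hC⟩ := hu
  obtain ⟨ψ, hψ, z, hz⟩ := hT (fun n => u (φ n)) ⟨C, fun n => hC _⟩ (y - x) (by
    have := (hy.comp hφ.tendsto_atTop).sub hx
    refine this.congr fun n => ?_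
    simp)
  exact ⟨fun n => φ (ψ n), hφ.comp hψ, z, hz⟩

theorem IsProperOp.exists_bound {T : E →L[ℂ] F} (hT : IsProperOp T)
    (hi : ∀ x, T x = 0 → x = 0) : ∃ K : NNReal, AntilipschitzWith K T := by
  by_contra! hcon
  have h1 : ∀ n : ℕ, ∃ x : E, ‖x‖ = 1 ∧ ‖T x‖ ≤ 1 / ((n : ℝ) + 1) := by
    intro n
    by_contra! h
    refine hcon ((n : NNReal) + 1) (T.antilipschitz_of_bound fun x => ?_)
    rcases eq_or_ne x 0 with rfl | hx
    · simp
    have hx' : 0 < ‖x‖ := norm_pos_iff.2 hx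
    have h2 := h (((‖x‖⁻¹ : ℝ) : ℂ) • x) (by
      rw [norm_smul, Complex.norm_real, norm_inv, norm_norm, inv_mul_cancel₀ hx'.ne'])
    rw [map_smul, norm_smul, Complex.norm_real, norm_inv, norm_norm, inv_mul_eq_div,
      div_lt_div_iff₀ (by positivity) hx'] at h2
    push_cast
    linarith
  choose u hu hTu using h1
  have h0 : Tendsto (fun n => T (u n)) atTop (𝓝 0) :=
    squeeze_zero_norm hTu tendsto_one_div_add_atTop_nhds_zero_nat
  obtain ⟨φ, hφ, x, hx⟩ := hT u ⟨1, fun n => (hu n).le⟩ 0 h0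
  have hx1 : ‖x‖ = 1 := tendsto_nhds_unique hx.norm (by simp [hu])
  have hx0 : T x = 0 := tendsto_nhds_unique ((T.continuous.tendsto x).comp hx)
    (h0.comp hφ.tendsto_atTop)
  rw [hi x hx0] at hx1
  simp at hx1

/-- A bounded operator which together with its adjoint is semi-Fredholm and injective is
invertible. -/
theorem isUnit_of_isProperOp [CompleteSpace E] {A B : E →L[ℂ] E}
    (hAB : ∀ x y, inner ℂ (A x) y = inner ℂ x (B y))
    (hA : IsProperOp A) (hAi : ∀ x, A x = 0 → x = 0) (hBi : ∀ x, B x = 0 → x = 0) :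
    IsUnit A := by
  rw [ContinuousLinearMap.isUnit_iff_bijective,
    ContinuousLinearMap.bijective_iff_dense_range_and_antilipschitz]
  refine ⟨?_, hA.exists_bound hAi⟩
  rw [Submodule.topologicalClosure_eq_top_iff, Submodule.eq_bot_iff]
  intro x hx
  refine hBi x ?_
  have : inner ℂ (A (B x)) x = 0 := hx (A (B x)) ⟨B x, rfl⟩
  rw [hAB] at this
  exact inner_self_eq_zero.1 this

theorem IsProperOp.finiteDimensional_ker {T : E →L[ℂ] F} (hT : IsProperOp T) :
    FiniteDimensional ℂ (LinearMap.ker (T : E →ₗ[ℂ] F)) := by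
  refine FiniteDimensional.of_isCompact_closedBall (𝕜 := ℂ) (r := 1) one_pos (c := 0) ?_
  refine IsSeqCompact.isCompact fun u hu => ?_
  have hu' : ∀ n, ‖(u n : E)‖ ≤ 1 := fun n => by simpa using hu n
  obtain ⟨φ, hφ, x, hx⟩ := hT (fun n => (u n : E)) ⟨1, hu'⟩ 0
    (tendsto_const_nhds.congr fun n => (LinearMap.mem_ker.1 (u n).2).symm)
  have hxk : T x = 0 := tendsto_nhds_unique ((T.continuous.tendsto x).comp hx)
    (tendsto_const_nhds.congr fun n => (LinearMap.mem_ker.1 (u (φ n)).2).symm)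
  refine ⟨⟨x, LinearMap.mem_ker.2 hxk⟩, ?_, φ, hφ, ?_⟩
  · have : ‖x‖ ≤ 1 := le_of_tendsto hx.norm (Eventually.of_forall fun n => hu' _)
    simpa using this
  · exact tendsto_subtype_rng.2 hx

/-! ### Compressed inverses -/

/-- The compression `⟨w a, A⁻¹ w b⟩` of the inverse of `A` to the vectors `w`. -/
noncomputable def compress (A : E →L[ℂ] E) {κ : Type*} (w : κ → E) : Matrix κ κ ℂ :=
  Matrix.of fun a b => inner ℂ (w a) (Ring.inverse A (w b))

theorem continuousOn_ring_inverse [CompleteSpace E] {P : Type*} [TopologicalSpace P]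
    {A : P → E →L[ℂ] E} {S : Set P} (hA : ContinuousOn A S) (hu : ∀ p ∈ S, IsUnit (A p)) :
    ContinuousOn (fun p => Ring.inverse (A p)) S := by
  intro p hp
  obtain ⟨u, hu⟩ := hu p hp
  have := NormedRing.inverse_continuousAt u
  rw [hu] at this
  exact ContinuousAt.comp_continuousWithinAt (f := A) this (hA p hp)

theorem continuousOn_compress [CompleteSpace E] {κ P : Type*} [TopologicalSpace P]
    {A : P → E →L[ℂ] E} {S : Set P} (hA : ContinuousOn A S) (hu : ∀ p ∈ S, IsUnit (A p))
    (w : κ → E) : ContinuousOn (fun p => compress (A p) w) S := by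
  refine continuousOn_pi.2 fun a => continuousOn_pi.2 fun b => ?_
  exact continuousOn_const.inner ((continuousOn_ring_inverse hA hu).clm_apply continuousOn_const)

/-! ### Finite rank perturbations -/

variable {ι : Type*} [Fintype ι]

/-- The finite rank operator `∑ a, β a • |w a⟩⟨w a|`. -/
noncomputable def finiteRank (β : ι → ℂ) (w : ι → E) : E →L[ℂ] E :=
  ∑ a, β a • InnerProductSpace.rankOne ℂ (w a) (w a)

theorem finiteRank_apply (β : ι → ℂ) (w : ι → E) (x : E) :
    finiteRank β w x = ∑ a, (β a * inner ℂ (w a) x) • w a := by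
  simp only [finiteRank, _root_.sum_apply, _root_.smul_apply,
    InnerProductSpace.rankOne_apply]
  exact Finset.sum_congr rfl fun a _ => (mul_smul _ _ _).symm

theorem finiteRank_smul (c : ℂ) (β : ι → ℂ) (w : ι → E) :
    c • finiteRank β w = finiteRank (c • β) w := by
  simp [finiteRank, Finset.smul_sum, smul_smul]

theorem inner_finiteRank_left (β : ι → ℂ) (w : ι → E) (x y : E) :
    inner ℂ (finiteRank β w x) y = inner ℂ x (finiteRank (fun a => starRingEnd ℂ (β a)) w y) := by
  simp only [finiteRank_apply, sum_inner, inner_sum, inner_smul_left, inner_smul_right, map_mul,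
    inner_conj_symm]
  exact Finset.sum_congr rfl fun a _ => by ring

theorem inner_finiteRank_self (q : ι → ℝ) (w : ι → E) (x : E) :
    inner ℂ x (finiteRank (fun a => (q a : ℂ)) w x) = ((∑ a, q a * ‖inner ℂ (w a) x‖ ^ 2 : ℝ) : ℂ) := by
  simp only [finiteRank_apply, inner_sum, inner_smul_right]
  push_cast
  refine Finset.sum_congr rfl fun a _ => ?_
  rw [← inner_conj_symm x (w a), mul_assoc, Complex.mul_conj']

theorem isCompactOperator_finiteRank (β : ι → ℂ) (w : ι → E) :
    IsCompactOperator (finiteRank β w) := by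
  have : finiteRank β w = (∑ a, (ContinuousLinearMap.toSpanSingleton ℂ (w a)).comp
      (β a • innerSL ℂ (w a))) := by
    ext x
    simp only [finiteRank, _root_.sum_apply, _root_.smul_apply, InnerProductSpace.rankOne_apply,
      ContinuousLinearMap.comp_apply, ContinuousLinearMap.toSpanSingleton_apply, innerSL_apply_apply,
      smul_eq_mul]
    exact Finset.sum_congr rfl fun a _ => (mul_smul _ _ _).symm
  have h1 : ∀ a, IsCompactOperator ((ContinuousLinearMap.toSpanSingleton ℂ (w a)).comp
      (β a • innerSL ℂ (w a))) := fun a =>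
    ((isCompactOperator_id (E := ℂ)).comp_clm (β a • innerSL ℂ (w a))).clm_comp
      (ContinuousLinearMap.toSpanSingleton ℂ (w a))
  rw [this]
  refine Finset.sum_induction _ (fun T : E →L[ℂ] E => IsCompactOperator T)
    (fun _ _ ha hb => ha.add hb) isCompactOperator_zero fun a _ => h1 a

/-- `X ∓ iQ` is invertible if `X = X*` is semi-Fredholm, `Q ≥ 0` has finite rank and the kernels of
`X` and `Q` meet trivially. -/
theorem isUnit_sub_I_finiteRank [CompleteSpace E] {X : E →L[ℂ] E}
    (hX : ∀ x y, inner ℂ (X x) y = inner ℂ x (X y)) (hp : IsProperOp X)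
    {q : ι → ℝ} (hq : ∀ a, 0 ≤ q a) {w : ι → E} {s : ℝ} (hs : s ≠ 0)
    (hker : ∀ x, X x = 0 → (∀ a, q a ≠ 0 → inner ℂ (w a) x = 0) → x = 0) :
    IsUnit (X - (s * Complex.I) • finiteRank (fun a => (q a : ℂ)) w) := by
  have hinj : ∀ s : ℝ, s ≠ 0 → ∀ x,
      (X - (s * Complex.I) • finiteRank (fun a => (q a : ℂ)) w) x = 0 → x = 0 := by
    intro s hs x hx
    have h1 : X x = (s * Complex.I) • finiteRank (fun a => (q a : ℂ)) w x := by
      simpa [sub_eq_zero] using hx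
    have h2 : (inner ℂ x (X x) : ℂ).im = 0 := by
      rw [← Complex.conj_eq_iff_im, inner_conj_symm, hX]
    rw [h1, inner_smul_right, inner_finiteRank_self] at h2
    simp only [Complex.mul_im, Complex.mul_re, Complex.ofReal_re, Complex.I_re, mul_zero,
      Complex.ofReal_im, Complex.I_im, mul_one, zero_add, add_zero, sub_self,
      mul_eq_zero, hs, false_or] at h2
    have h3 : ∀ a, q a ≠ 0 → inner ℂ (w a) x = 0 := by
      intro a ha
      have := (Finset.sum_eq_zero_iff_of_nonneg (fun a _ =>
        mul_nonneg (hq a) (sq_nonneg _))).1 h2 a (Finset.mem_univ a)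
      simpa [ha] using this
    refine hker x ?_ h3
    rw [h1, finiteRank_apply, Finset.sum_eq_zero, smul_zero]
    intro a _
    by_cases ha : q a = 0
    · simp [ha]
    · simp [h3 a ha]
  have hprop : IsProperOp (X - (s * Complex.I) • finiteRank (fun a => (q a : ℂ)) w) := by
    rw [finiteRank_smul, sub_eq_add_neg]
    exact hp.add (isCompactOperator_finiteRank _ _).neg
  refine isUnit_of_isProperOp (B := X - ((-s : ℝ) * Complex.I) • finiteRank (fun a => (q a : ℂ)) w)
    ?_ hprop (hinj s hs) (hinj (-s) (neg_ne_zero.2 hs))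
  intro x y
  simp only [_root_.sub_apply, inner_sub_left, inner_sub_right, hX,
    _root_.smul_apply, inner_smul_left, inner_smul_right, inner_finiteRank_left]
  simp

/-- `X - z - isQ` is invertible if `X = X*`, `Q ≥ 0` and `s` has the sign of `Im z ≠ 0`: the imaginary
part of its quadratic form is then bounded away from zero. -/
theorem isUnit_of_im_ne_zero [CompleteSpace E] {X : E →L[ℂ] E}
    (hX : ∀ x y, inner ℂ (X x) y = inner ℂ x (X y))
    {q : ι → ℝ} (hq : ∀ a, 0 ≤ q a) {w : ι → E} {s : ℝ} {z : ℂ} (hz : 0 < s * z.im) :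
    IsUnit (X - z • (1 : E →L[ℂ] E) - (s * Complex.I) • finiteRank (fun a => (q a : ℂ)) w) := by
  have hz0 : z.im ≠ 0 := by
    rintro h
    simp [h] at hz
  refine ContinuousLinearMap.isUnit_of_forall_le_norm_inner_map _ (c := ‖z.im‖₊)
    (by simpa using hz0) fun x => ?_
  rw [← norm_inner_symm]
  refine le_trans ?_ (Complex.abs_im_le_norm _)
  have h2 : (inner ℂ x (X x) : ℂ).im = 0 := by
    rw [← Complex.conj_eq_iff_im, inner_conj_symm, hX]
  simp only [_root_.sub_apply, _root_.smul_apply, inner_sub_right,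
    inner_smul_right, one_apply_eq_self, inner_finiteRank_self, Complex.sub_im, h2,
    inner_self_eq_norm_sq_to_K]
  set r := ∑ a, q a * ‖inner ℂ (w a) x‖ ^ 2 with hr
  have hr0 : 0 ≤ r := Finset.sum_nonneg fun a _ => mul_nonneg (hq a) (sq_nonneg _)
  have h4 : (z * ((‖x‖ : ℝ) : ℂ) ^ 2).im = z.im * ‖x‖ ^ 2 := by
    rw [← Complex.ofReal_pow, Complex.im_mul_ofReal]
  have h5 : ((s * Complex.I) * (r : ℂ)).im = s * r := by simp
  erw [h4, h5]
  rw [coe_nnnorm, Real.norm_eq_abs]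
  have hs0 : 0 ≤ s * r * z.im := by nlinarith
  rw [mul_comm (‖x‖ ^ 2), ← abs_of_nonneg (sq_nonneg ‖x‖), ← abs_mul, ← sq_le_sq]
  rw [abs_of_nonneg (sq_nonneg ‖x‖)]
  nlinarith [sq_nonneg (s * r), sq_nonneg ‖x‖, mul_nonneg hs0 (sq_nonneg ‖x‖)]

/-! ### Scattering matrices of finite rank perturbations -/

variable [DecidableEq ι]

/-- The resolvent identity `A⁻¹ - B⁻¹ = A⁻¹ (B - A) B⁻¹`, compressed to the vectors `w` on which
`B - A` is supported. -/
theorem compress_sub {A B : E →L[ℂ] E} (hA : IsUnit A) (hB : IsUnit B) {β : ι → ℂ} {w : ι → E}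
    (h : B - A = finiteRank β w) :
    compress A w - compress B w = compress A w * Matrix.diagonal β * compress B w := by
  have h1 : Ring.inverse A - Ring.inverse B = Ring.inverse A * (B - A) * Ring.inverse B := by
    rw [mul_sub, sub_mul, Ring.inverse_mul_cancel A hA, mul_assoc, Ring.mul_inverse_cancel B hB,
      mul_one, one_mul]
  ext a b
  have h2 : Ring.inverse A (w b) - Ring.inverse B (w b) =
      Ring.inverse A (finiteRank β w (Ring.inverse B (w b))) := by
    rw [← h]
    exact congrArg (fun T : E →L[ℂ] E => T (w b)) h1
  rw [Matrix.sub_apply, compress, compress, Matrix.of_apply, Matrix.of_apply, ← inner_sub_right, h2,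
    finiteRank_apply, map_sum, inner_sum, Matrix.mul_apply]
  refine Finset.sum_congr rfl fun c _ => ?_
  rw [map_smul, inner_smul_right, Matrix.mul_diagonal, Matrix.of_apply, Matrix.of_apply]
  ring

/-- The matrix of `(X + iQ)(X - iQ)⁻¹ = 1 + 2iQ(X - iQ)⁻¹` for `Q = ∑ a, q a |w a⟩⟨w a|`, expressed
in the (not necessarily independent) vectors `w a`. For `X = H♯(k) - x` and `Q` the projection onto
the first site, it relates the boundary values of decaying solutions. -/
noncomputable def scat (X : E →L[ℂ] E) (q : ι → ℝ) (w : ι → E) : Matrix ι ι ℂ :=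
  1 + (2 * Complex.I) • (Matrix.diagonal (fun a => (q a : ℂ)) *
    compress (X - Complex.I • finiteRank (fun a => (q a : ℂ)) w) w)

/-- The compression of `(X - iQ)(X + iQ)⁻¹` is an inverse of the scattering matrix. -/
theorem scat_det_ne_zero {X : E →L[ℂ] E} {q : ι → ℝ} {w : ι → E}
    (h1 : IsUnit (X - Complex.I • finiteRank (fun a => (q a : ℂ)) w))
    (h2 : IsUnit (X + Complex.I • finiteRank (fun a => (q a : ℂ)) w)) :
    (scat X q w).det ≠ 0 := by
  have h3 := compress_sub h1 h2 (β := (2 * Complex.I) • fun a => (q a : ℂ)) (w := w) (by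
    rw [← finiteRank_smul, two_mul, add_smul]
    abel)
  set D := Matrix.diagonal (fun a => (q a : ℂ)) with hD
  have h4 : Matrix.diagonal ((2 * Complex.I) • fun a => (q a : ℂ)) = (2 * Complex.I) • D := by
    rw [hD, ← Matrix.diagonal_smul]
  rw [h4] at h3
  set N₁ := compress (X - Complex.I • finiteRank (fun a => (q a : ℂ)) w) w
  set N₂ := compress (X + Complex.I • finiteRank (fun a => (q a : ℂ)) w) w
  have h5 : scat X q w * (1 - (2 * Complex.I) • (D * N₂)) = 1 := by
    have : scat X q w = 1 + (2 * Complex.I) • (D * N₁) := rfl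
    rw [this]
    have h6 : (1 + (2 * Complex.I) • (D * N₁)) * (1 - (2 * Complex.I) • (D * N₂)) =
        1 + (2 * Complex.I) • (D * ((N₁ - N₂) - N₁ * ((2 * Complex.I) • D) * N₂)) := by
      simp only [mul_sub, add_mul, mul_one, one_mul, smul_mul_assoc, mul_smul_comm, smul_sub,
        mul_assoc, smul_add]
      abel
    rw [h6, h3, sub_self, mul_zero, smul_zero, add_zero]
  intro h0
  have := congrArg Matrix.det h5
  rw [Matrix.det_mul, h0, zero_mul, Matrix.det_one] at this
  exact zero_ne_one this

theorem continuousOn_scat [CompleteSpace E] {P : Type*} [TopologicalSpace P]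
    {X : P → E →L[ℂ] E} {q : P → ι → ℝ} {w : ι → E} {S : Set P} (hX : ContinuousOn X S)
    (hq : ContinuousOn q S)
    (hu : ∀ p ∈ S, IsUnit (X p - Complex.I • finiteRank (fun a => (q p a : ℂ)) w)) :
    ContinuousOn (fun p => (scat (X p) (q p) w).det) S := by
  have hq' : ∀ a, ContinuousOn (fun p => (q p a : ℂ)) S := fun a =>
    Complex.continuous_ofReal.comp_continuousOn ((continuous_apply a).comp_continuousOn hq)
  have hA : ContinuousOn (fun p => X p - Complex.I • finiteRank (fun a => (q p a : ℂ)) w) S := by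
    refine hX.sub (ContinuousOn.fun_const_smul ?_ _)
    unfold finiteRank
    exact continuousOn_finsetSum _ fun a _ => (hq' a).fun_smul continuousOn_const
  have hN := continuousOn_compress hA hu w
  have hD : ContinuousOn (fun p => Matrix.diagonal (fun a => (q p a : ℂ))) S :=
    (Continuous.matrix_diagonal continuous_id).comp_continuousOn (continuousOn_pi.2 hq')
  have h : ContinuousOn (fun p => scat (X p) (q p) w) S := by
    unfold scat
    refine continuousOn_const.add (ContinuousOn.fun_const_smul ?_ _)
    exact continuous_mul.comp_continuousOn (hD.prodMk hN)
  exact (Continuous.matrix_det continuous_id).comp_continuousOn h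

end Abstract

variable {N : ℕ}

/-! ### Norm estimates and symmetry of the Hamiltonians -/

theorem sum_sq_le_of_injOn {ι κ : Type} (u : lp (fun _ : κ => Site N) 2) {φ : ι → Site N} {a : ℝ}
    (f : ι → κ) (hφ : ∀ n, φ n ≠ 0 → ‖φ n‖ ≤ a * ‖u (f n)‖)
    (hf : ∀ m n, φ m ≠ 0 → φ n ≠ 0 → f m = f n → m = n) (s : Finset ι) :
    ∑ n ∈ s, ‖φ n‖ ^ (2 : ENNReal).toReal ≤ (a * ‖u‖) ^ (2 : ENNReal).toReal := by
  classical
  have h1 : ∑ n ∈ s, ‖φ n‖ ^ (2 : ENNReal).toReal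
      = ∑ n ∈ s with φ n ≠ 0, ‖φ n‖ ^ (2 : ENNReal).toReal := by
    refine (Finset.sum_filter_of_ne (p := fun n => φ n ≠ 0) fun n _ hn h0 => hn ?_).symm
    simp [h0]
  rw [h1]
  have h2 : ∑ n ∈ s with φ n ≠ 0, ‖φ n‖ ^ (2 : ENNReal).toReal ≤
      ∑ n ∈ s with φ n ≠ 0, a ^ 2 * ‖u (f n)‖ ^ (2 : ENNReal).toReal := by
    refine Finset.sum_le_sum fun n hn => ?_
    have := hφ n (Finset.mem_filter.1 hn).2
    simp only [ENNReal.toReal_ofNat, Real.rpow_ofNat]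
    rw [← mul_pow]
    exact pow_le_pow_left₀ (norm_nonneg _) this 2
  refine h2.trans ?_
  rw [← Finset.mul_sum, ← Finset.sum_image (f := fun m => ‖u m‖ ^ (2 : ENNReal).toReal) (g := f)]
  · have := lp.sum_rpow_le_norm_rpow (by norm_num) u (Finset.image f (s.filter fun n => φ n ≠ 0))
    refine (mul_le_mul_of_nonneg_left this (sq_nonneg a)).trans (le_of_eq ?_)
    simp only [ENNReal.toReal_ofNat, Real.rpow_ofNat]
    ring
  · intro m hm n hn h
    exact hf m n (by simpa using (Finset.mem_filter.1 hm).2) (by simpa using (Finset.mem_filter.1 hn).2) h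

/-- An `ℓ²` element from a family which is bounded by an injective rearrangement of another. -/
theorem exists_lp_of_injOn {ι κ : Type} (u : lp (fun _ : κ => Site N) 2) (φ : ι → Site N) {a : ℝ}
    (ha : 0 ≤ a) (f : ι → κ) (hφ : ∀ n, φ n ≠ 0 → ‖φ n‖ ≤ a * ‖u (f n)‖)
    (hf : ∀ m n, φ m ≠ 0 → φ n ≠ 0 → f m = f n → m = n) :
    ∃ χ : lp (fun _ : ι => Site N) 2, (∀ n, χ n = φ n) ∧ ‖χ‖ ≤ a * ‖u‖ := by
  refine ⟨⟨φ, memℓp_gen' (sum_sq_le_of_injOn u f hφ hf)⟩, fun n => rfl, ?_⟩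
  exact lp.norm_le_of_forall_sum_le (by norm_num) (by positivity)
    (sum_sq_le_of_injOn u f hφ hf)

theorem dirichlet_zero (ψ : ℕ+ → Site N) : dirichlet ψ 0 = 0 := by simp [dirichlet]

theorem dirichlet_coe (ψ : ℕ+ → Site N) (n : ℕ+) : dirichlet ψ n = ψ n := by
  unfold dirichlet
  rw [dif_pos n.pos]
  rfl

theorem dirichlet_of_pos (ψ : ℕ+ → Site N) {n : ℕ} (h : 0 < n) :
    dirichlet ψ n = ψ n.toPNat' := by
  unfold dirichlet
  rw [dif_pos h]
  congr 1
  exact PNat.coe_injective (by rw [Nat.toPNat'_coe, if_pos h]; rfl)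

theorem toPNat'_inj {m n : ℕ} (hm : 0 < m) (hn : 0 < n) (h : m.toPNat' = n.toPNat') : m = n := by
  have := congrArg (fun p : ℕ+ => (p : ℕ)) h
  simpa [hm, hn] using this

theorem dirichlet_ne_zero {ψ : ℕ+ → Site N} {n : ℕ} (h : dirichlet ψ n ≠ 0) : 0 < n := by
  by_contra h0
  exact h (by simp [dirichlet, h0])

theorem exists_pnat_sub_one {n : ℕ+} (h : 0 < (n : ℕ) - 1) : ∃ m : ℕ+, n = m + 1 :=
  PNat.exists_eq_succ_of_ne_one fun h1 => by simp [h1] at h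

theorem act_sub (M M' : Matrix (Fin N) (Fin N) ℂ) (v : Site N) :
    act (M - M') v = act M v - act M' v := by
  simp [act]

theorem edge_op_apply {H : BulkHamiltonian N} (Hs : EdgeHamiltonian H) (k : ℝ) (ψ : EdgeSpace N)
    (n : ℕ+) : Hs.op k ψ n = edgeDiff Hs k ψ n := rfl

theorem bulk_op_apply (H : BulkHamiltonian N) (k : ℝ) (ψ : BulkSpace N)
    (n : ℤ) : H.op k ψ n = bulkDiff H k ψ n := rfl

theorem exists_lp_dirichlet_act (M : Matrix (Fin N) (Fin N) ℂ) {C : ℝ} (hC : 0 ≤ C)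
    (hM : ∀ i j, ‖M i j‖ ≤ C) (ψ : EdgeSpace N) :
    ∃ χ : EdgeSpace N, (∀ n, χ n = act M (dirichlet ψ ((n : ℕ) - 1))) ∧
      ‖χ‖ ≤ N * (N * C) * ‖ψ‖ := by
  have h0 : ∀ n : ℕ+, act M (dirichlet ψ ((n : ℕ) - 1)) ≠ 0 → 0 < (n : ℕ) - 1 := fun n h =>
    dirichlet_ne_zero (ψ := ψ) fun h' => h (by rw [h', map_zero])
  refine exists_lp_of_injOn ψ _ (by positivity)
    (fun n => ((n : ℕ) - 1).toPNat') ?_ ?_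
  · intro n hn
    have := norm_act_le M C hM (dirichlet ψ ((n : ℕ) - 1))
    rwa [dirichlet_of_pos _ (h0 n hn)] at this ⊢
  · intro m n hm hn h
    have h1 := toPNat'_inj (h0 m hm) (h0 n hn) h
    have h2 := h0 m hm
    exact PNat.coe_injective (by omega)

theorem exists_lp_act_comp {ι : Type} (M : ι → Matrix (Fin N) (Fin N) ℂ) {C : ℝ} (hC : 0 ≤ C)
    (hM : ∀ n i j, ‖M n i j‖ ≤ C) {f : ι → ι} (hf : Function.Injective f)
    (ψ : lp (fun _ : ι => Site N) 2) :
    ∃ χ : lp (fun _ : ι => Site N) 2, (∀ n, χ n = act (M n) (ψ (f n))) ∧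
      ‖χ‖ ≤ N * (N * C) * ‖ψ‖ :=
  exists_lp_of_injOn ψ _ (by positivity) f (fun n _ => norm_act_le (M n) C (hM n) _)
    fun _ _ _ _ h => hf h

theorem norm_conjTranspose_apply_le {M : Matrix (Fin N) (Fin N) ℂ} {C : ℝ}
    (hM : ∀ i j, ‖M i j‖ ≤ C) (i j : Fin N) : ‖M.conjTranspose i j‖ ≤ C := by
  rw [Matrix.conjTranspose_apply, norm_star]
  exact hM j i

theorem norm_edge_op_sub_le {H : BulkHamiltonian N} (Hs Hs' : EdgeHamiltonian H) (k k' : ℝ)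
    {a v : ℝ} (ha : 0 ≤ a) (hv : 0 ≤ v) (hA : ∀ i j, ‖(H.A k - H.A k') i j‖ ≤ a)
    (hV : ∀ n i j, ‖(Hs.V n k - Hs'.V n k') i j‖ ≤ v) :
    ‖Hs.op k - Hs'.op k'‖ ≤ N * (N * (2 * a + v)) := by
  refine ContinuousLinearMap.opNorm_le_bound _ (by positivity) fun ψ => ?_
  obtain ⟨χ₁, h1, h1'⟩ := exists_lp_dirichlet_act (H.A k - H.A k') ha hA ψ
  obtain ⟨χ₂, h2, h2'⟩ := exists_lp_act_comp (fun _ : ℕ+ => (H.A k - H.A k').conjTranspose) ha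
    (fun _ => norm_conjTranspose_apply_le hA) (add_left_injective (1 : ℕ+)) ψ
  obtain ⟨χ₃, h3, h3'⟩ := exists_lp_act_comp (fun n : ℕ+ => Hs.V n k - Hs'.V n k') hv hV
    Function.injective_id ψ
  have : (Hs.op k - Hs'.op k') ψ = χ₁ + χ₂ + χ₃ := by
    ext1
    funext n
    rw [_root_.sub_apply, lp.coeFn_sub, lp.coeFn_add, lp.coeFn_add, Pi.sub_apply, Pi.add_apply,
      Pi.add_apply, h1, h2, h3, edge_op_apply, edge_op_apply, edgeDiff, edgeDiff,
      Matrix.conjTranspose_sub, act_sub, act_sub, act_sub, id]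
    abel
  rw [this]
  refine (norm_add_le _ _).trans ((add_le_add (norm_add_le _ _) le_rfl).trans ?_)
  calc _ ≤ N * (N * a) * ‖ψ‖ + N * (N * a) * ‖ψ‖ + N * (N * v) * ‖ψ‖ := by gcongr
    _ = _ := by ring

theorem norm_bulk_op_sub_le (H : BulkHamiltonian N) (k k' : ℝ)
    {a v : ℝ} (ha : 0 ≤ a) (hv : 0 ≤ v) (hA : ∀ i j, ‖(H.A k - H.A k') i j‖ ≤ a)
    (hV : ∀ n i j, ‖(H.V n k - H.V n k') i j‖ ≤ v) :
    ‖H.op k - H.op k'‖ ≤ N * (N * (2 * a + v)) := by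
  refine ContinuousLinearMap.opNorm_le_bound _ (by positivity) fun ψ => ?_
  obtain ⟨χ₁, h1, h1'⟩ := exists_lp_act_comp (fun _ : ℤ => (H.A k - H.A k')) ha
    (fun _ => hA) (sub_left_injective (b := (1 : ℤ))) ψ
  obtain ⟨χ₂, h2, h2'⟩ := exists_lp_act_comp (fun _ : ℤ => (H.A k - H.A k').conjTranspose) ha
    (fun _ => norm_conjTranspose_apply_le hA) (add_left_injective (1 : ℤ)) ψ
  obtain ⟨χ₃, h3, h3'⟩ := exists_lp_act_comp (fun n : ℤ => H.V n k - H.V n k') hv hV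
    Function.injective_id ψ
  have : (H.op k - H.op k') ψ = χ₁ + χ₂ + χ₃ := by
    ext1
    funext n
    rw [_root_.sub_apply, lp.coeFn_sub, lp.coeFn_add, lp.coeFn_add, Pi.sub_apply, Pi.add_apply,
      Pi.add_apply, h1, h2, h3, bulk_op_apply, bulk_op_apply, bulkDiff, bulkDiff,
      Matrix.conjTranspose_sub, act_sub, act_sub, act_sub, id]
    abel
  rw [this]
  refine (norm_add_le _ _).trans ((add_le_add (norm_add_le _ _) le_rfl).trans ?_)
  calc _ ≤ N * (N * a) * ‖ψ‖ + N * (N * a) * ‖ψ‖ + N * (N * v) * ‖ψ‖ := by gcongr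
    _ = _ := by ring

/-- A periodic `C¹` matrix function is Lipschitz. -/
theorem exists_lipschitz_hopping (H : BulkHamiltonian N) :
    ∃ L : ℝ, 0 ≤ L ∧ ∀ k k' i j, ‖(H.A k - H.A k') i j‖ ≤ L * |k - k'| := by
  have h1 : ∀ i j, ∃ C : ℝ, ∀ k, ‖deriv (fun κ => H.A κ i j) k‖ ≤ C := by
    intro i j
    have hc : Continuous (deriv (fun κ => H.A κ i j)) := (H.A_contDiff i j).continuous_deriv le_rfl
    have hp : Function.Periodic (deriv (fun κ => H.A κ i j)) (2 * π) := by
      intro k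
      rw [← deriv_comp_add_const]
      simp only [H.A_periodic]
    obtain ⟨C, hC⟩ := (hp.compact_of_continuous (by positivity) hc).isBounded.exists_norm_le
    exact ⟨C, fun k => hC _ ⟨k, rfl⟩⟩
  choose C hC using h1
  refine ⟨∑ i, ∑ j, |C i j|, by positivity, fun k k' i j => ?_⟩
  have h2 := Convex.norm_image_sub_le_of_norm_deriv_le (f := fun κ => H.A κ i j) (s := univ)
    (x := k') (y := k) (C := C i j)
    (fun x _ => ((H.A_contDiff i j).differentiable one_ne_zero) x) (fun x _ => hC i j x)
    convex_univ (mem_univ _) (mem_univ _)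
  rw [Matrix.sub_apply]
  refine h2.trans (mul_le_mul_of_nonneg_right ?_ (norm_nonneg _))
  exact (le_abs_self _).trans ((Finset.single_le_sum (f := fun j => |C i j|)
    (fun _ _ => abs_nonneg _) (Finset.mem_univ j)).trans
    (Finset.single_le_sum (f := fun i => ∑ j, |C i j|)
      (fun _ _ => Finset.sum_nonneg fun _ _ => abs_nonneg _) (Finset.mem_univ i)))

theorem UniformC1.exists_lipschitz {ι : Type} {V : ι → ℝ → Matrix (Fin N) (Fin N) ℂ}
    (hV : UniformC1 V) : ∃ L : ℝ, 0 ≤ L ∧ ∀ k k' n i j, ‖(V n k - V n k') i j‖ ≤ L * |k - k'| := by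
  obtain ⟨h1, ⟨C, hC⟩, -⟩ := hV
  refine ⟨|C|, abs_nonneg _, fun k k' n i j => ?_⟩
  rw [Matrix.sub_apply]
  exact Convex.norm_image_sub_le_of_norm_deriv_le (f := fun κ => V n κ i j) (s := univ)
    (x := k') (y := k) (C := |C|) (fun x _ => ((h1 n i j).differentiable one_ne_zero) x)
    (fun x _ => (hC n x i j).2.trans (le_abs_self _)) convex_univ (mem_univ _) (mem_univ _)

theorem exists_lipschitz_edge_op {H : BulkHamiltonian N} (Hs : EdgeHamiltonian H) :
    ∃ L : ℝ, 0 ≤ L ∧ ∀ k k', ‖Hs.op k - Hs.op k'‖ ≤ L * |k - k'| := by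
  obtain ⟨a, ha, hA⟩ := exists_lipschitz_hopping H
  obtain ⟨v, hv, hV⟩ := Hs.V_uniformC1.exists_lipschitz
  refine ⟨N * (N * (2 * a + v)), by positivity, fun k k' => ?_⟩
  refine (norm_edge_op_sub_le Hs Hs k k' (by positivity) (by positivity) (hA k k')
    (hV k k')).trans (le_of_eq ?_)
  ring

theorem continuous_of_norm_sub_le {E : Type*} [SeminormedAddCommGroup E] {f : ℝ → E} {L : ℝ}
    (hL : 0 ≤ L) (h : ∀ k k', ‖f k - f k'‖ ≤ L * |k - k'|) : Continuous f :=
  (LipschitzWith.of_dist_le_mul (K := ⟨L, hL⟩) fun k k' => by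
    rw [dist_eq_norm, Real.dist_eq]
    exact h k k').continuous

theorem continuous_edge_op {H : BulkHamiltonian N} (Hs : EdgeHamiltonian H) :
    Continuous Hs.op := by
  obtain ⟨L, hL, h⟩ := exists_lipschitz_edge_op Hs
  exact continuous_of_norm_sub_le hL h

theorem continuous_bulk_op (H : BulkHamiltonian N) : Continuous H.op := by
  obtain ⟨a, ha, hA⟩ := exists_lipschitz_hopping H
  obtain ⟨v, hv, hV⟩ := H.V_uniformC1.exists_lipschitz
  refine continuous_of_norm_sub_le (L := N * (N * (2 * a + v))) (by positivity) fun k k' => ?_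
  refine (norm_bulk_op_sub_le H k k' (by positivity) (by positivity) (hA k k')
    (hV k k')).trans (le_of_eq ?_)
  ring

theorem edge_op_periodic {H : BulkHamiltonian N} (Hs : EdgeHamiltonian H) (k : ℝ) :
    Hs.op (k + 2 * π) = Hs.op k := by
  ext ψ n : 3
  rw [edge_op_apply, edge_op_apply, edgeDiff, edgeDiff, H.A_periodic, Hs.V_periodic]

theorem bulk_op_periodic (H : BulkHamiltonian N) (k : ℝ) : H.op (k + 2 * π) = H.op k := by
  ext ψ n : 3
  rw [bulk_op_apply, bulk_op_apply, bulkDiff, bulkDiff, H.A_periodic, H.V_periodic]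

theorem inner_act_left (M : Matrix (Fin N) (Fin N) ℂ) (v w : Site N) :
    inner ℂ (act M v) w = inner ℂ v (act M.conjTranspose w) := by
  rw [act, act, Matrix.toEuclideanLin_conjTranspose_eq_adjoint, LinearMap.adjoint_inner_right]

theorem inner_edge_op {H : BulkHamiltonian N} (Hs : EdgeHamiltonian H) (k : ℝ)
    (ψ χ : EdgeSpace N) : inner ℂ (Hs.op k ψ) χ = inner ℂ ψ (Hs.op k χ) := by
  obtain ⟨C, hC⟩ := exists_bound_const (ι := ℕ+) (H.A k)
  have hA : ∀ i j, ‖H.A k i j‖ ≤ |C| := fun i j => (hC 1 i j).trans (le_abs_self _)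
  obtain ⟨C', hC'⟩ := Hs.V_uniformC1.2.1
  have hV : ∀ n i j, ‖Hs.V n k i j‖ ≤ |C'| := fun n i j => (hC' n k i j).1.trans (le_abs_self _)
  have key : ∀ ψ : EdgeSpace N, ∃ R L D : EdgeSpace N,
      (∀ n, R n = act (H.A k) (dirichlet ψ ((n : ℕ) - 1))) ∧
      (∀ n, L n = act (H.A k).conjTranspose (ψ (n + 1))) ∧
      (∀ n, D n = act (Hs.V n k) (ψ n)) ∧ Hs.op k ψ = R + L + D := by
    intro ψ
    obtain ⟨χ₁, h1, -⟩ := exists_lp_dirichlet_act (H.A k) (abs_nonneg _) hA ψ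
    obtain ⟨χ₂, h2, -⟩ := exists_lp_act_comp (fun _ : ℕ+ => (H.A k).conjTranspose) (abs_nonneg _)
      (fun _ => norm_conjTranspose_apply_le hA) (add_left_injective (1 : ℕ+)) ψ
    obtain ⟨χ₃, h3, -⟩ := exists_lp_act_comp (fun n : ℕ+ => Hs.V n k) (abs_nonneg _) hV
      Function.injective_id ψ
    refine ⟨χ₁, χ₂, χ₃, h1, h2, h3, ?_⟩
    ext1
    funext n
    rw [lp.coeFn_add, lp.coeFn_add, Pi.add_apply, Pi.add_apply, h1, h2, h3]
    rfl
  have key2 : ∀ ψ χ R L : EdgeSpace N, (∀ n, R n = act (H.A k) (dirichlet ψ ((n : ℕ) - 1))) →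
      (∀ n, L n = act (H.A k).conjTranspose (χ (n + 1))) → inner ℂ R χ = inner ℂ ψ L := by
    intro ψ χ R L hR hL
    rw [lp.inner_eq_tsum, lp.inner_eq_tsum]
    have hinj : Function.Injective (fun n : ℕ+ => n + 1) := add_left_injective 1
    rw [← hinj.tsum_eq (f := fun n => inner ℂ (R n) (χ n))]
    · refine tsum_congr fun n => ?_
      rw [hR, hL, ← inner_act_left]
      have : ((n + 1 : ℕ+) : ℕ) - 1 = (n : ℕ) := by simp
      rw [this, dirichlet_coe]
    · intro n hn
      have h0 : 0 < (n : ℕ) - 1 := by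
        refine dirichlet_ne_zero (ψ := ψ) fun h' => hn ?_
        simp only
        rw [hR, h', map_zero, inner_zero_left]
      obtain ⟨m, rfl⟩ := exists_pnat_sub_one h0
      exact ⟨m, rfl⟩
  obtain ⟨R, L, D, hR, hL, hD, h⟩ := key ψ
  obtain ⟨R', L', D', hR', hL', hD', h'⟩ := key χ
  rw [h, h', inner_add_left, inner_add_left, inner_add_right, inner_add_right,
    key2 ψ χ R L' hR hL']
  have h3 : inner ℂ L χ = inner ℂ ψ R' := by
    rw [← inner_conj_symm, ← key2 χ ψ R' L hR' hL, inner_conj_symm]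
  have h4 : inner ℂ D χ = inner ℂ ψ D' := by
    rw [lp.inner_eq_tsum, lp.inner_eq_tsum]
    refine tsum_congr fun n => ?_
    rw [hD, hD', inner_act_left, (Hs.V_hermitian n k).eq]
  rw [h3, h4]
  ring

/-! ### The half-line inside the line -/

/-- Extension by zero from `{1, 2, …}` to `ℤ`. -/
theorem exists_extend : ∃ e : EdgeSpace N →L[ℂ] BulkSpace N,
    ∀ ψ (n : ℤ), e ψ n = dirichlet ψ n.toNat := by
  have h : ∀ ψ : EdgeSpace N, ∃ χ : BulkSpace N, (∀ n : ℤ, χ n = dirichlet ψ n.toNat) ∧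
      ‖χ‖ ≤ 1 * ‖ψ‖ := by
    intro ψ
    refine exists_lp_of_injOn ψ _ zero_le_one
      (fun n : ℤ => n.toNat.toPNat') ?_ ?_
    · intro n hn
      rw [dirichlet_of_pos _ (dirichlet_ne_zero hn), one_mul]
    · intro m n hm hn h
      have hm := dirichlet_ne_zero hm
      have h1 := toPNat'_inj hm (dirichlet_ne_zero hn) h
      omega
  choose e he hn using h
  refine ⟨LinearMap.mkContinuous { toFun := e, map_add' := ?_, map_smul' := ?_ } 1 hn, he⟩
  · intro ψ χ
    ext1
    funext n
    rw [lp.coeFn_add, Pi.add_apply, he, he, he, lp.coeFn_add, dirichlet_add]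
  · intro c ψ
    ext1
    funext n
    rw [RingHom.id_apply, lp.coeFn_smul, Pi.smul_apply, he, he, lp.coeFn_smul, dirichlet_smul]

/-- Restriction from `ℤ` to `{1, 2, …}`. -/
theorem exists_restrict : ∃ r : BulkSpace N →L[ℂ] EdgeSpace N,
    ∀ ψ (n : ℕ+), r ψ n = ψ ((n : ℕ) : ℤ) := by
  have h : ∀ ψ : BulkSpace N, ∃ χ : EdgeSpace N, (∀ n : ℕ+, χ n = ψ ((n : ℕ) : ℤ)) ∧
      ‖χ‖ ≤ 1 * ‖ψ‖ := by
    intro ψ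
    refine exists_lp_of_injOn ψ _ zero_le_one (fun n : ℕ+ => ((n : ℕ) : ℤ)) (fun n _ => by simp) ?_
    intro m n _ _ h
    exact PNat.coe_injective (by exact_mod_cast h)
  choose e he hn using h
  refine ⟨LinearMap.mkContinuous { toFun := e, map_add' := ?_, map_smul' := ?_ } 1 hn, he⟩
  · intro ψ χ
    ext1
    funext n
    rw [lp.coeFn_add, Pi.add_apply, he, he, he, lp.coeFn_add, Pi.add_apply]
  · intro c ψ
    ext1
    funext n
    rw [RingHom.id_apply, lp.coeFn_smul, Pi.smul_apply, he, he, lp.coeFn_smul, Pi.smul_apply]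

/-- The edge Hamiltonian is semi-Fredholm at energies in the bulk gap: it differs from the bulk
Hamiltonian, read on sequences supported on the half-line, by a finite rank operator. -/
theorem isProperOp_edge {H : BulkHamiltonian N} (Hs : EdgeHamiltonian H) {k : ℝ} {z : ℂ}
    (hz : z ∉ spectrum ℂ (H.op k)) : IsProperOp (Hs.op k - z • (1 : EdgeSpace N →L[ℂ] EdgeSpace N)) := by
  obtain ⟨e, he⟩ := exists_extend (N := N)
  obtain ⟨r, hr⟩ := exists_restrict (N := N)
  obtain ⟨n₀, hn₀⟩ := Hs.eventually_bulk
  have hre : ∀ ψ, r (e ψ) = ψ := by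
    intro ψ
    ext1
    funext n
    rw [hr, he, Int.toNat_natCast, dirichlet_coe]
  set K : EdgeSpace N →L[ℂ] BulkSpace N := (H.op k).comp e - e.comp (Hs.op k) with hK
  have hK0 : ∀ ψ (n : ℤ), n ∉ Finset.Icc (0 : ℤ) n₀ → K ψ n = 0 := by
    intro ψ n hn
    rw [hK, _root_.sub_apply, lp.coeFn_sub, Pi.sub_apply, ContinuousLinearMap.comp_apply,
      ContinuousLinearMap.comp_apply, bulk_op_apply, bulkDiff, he, he, he, he]
    rcases lt_or_ge n 0 with h | h
    · rw [Int.toNat_of_nonpos (by omega), Int.toNat_of_nonpos (by omega),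
        Int.toNat_of_nonpos (by omega)]
      simp [dirichlet_zero]
    · have hn' : n₀ < n := by
        by_contra h'
        exact hn (Finset.mem_Icc.2 ⟨h, by omega⟩)
      lift n to ℕ using h
      have hn'' : n₀ < n := by exact_mod_cast hn'
      have hn1 : 0 < n := by omega
      have e1 : (((n : ℤ) - 1).toNat) = n - 1 := by omega
      have e2 : (((n : ℤ) + 1).toNat) = n + 1 := by omega
      rw [e1, e2, Int.toNat_natCast]
      obtain ⟨p, rfl⟩ : ∃ p : ℕ+, (p : ℕ) = n := ⟨⟨n, hn1⟩, rfl⟩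
      have h3 := dirichlet_coe ψ (p + 1)
      rw [PNat.add_coe, PNat.one_coe] at h3
      have h5 : Hs.op k ψ p = act (H.A k) (dirichlet ψ ((p : ℕ) - 1)) +
          act (H.A k).conjTranspose (ψ (p + 1)) + act (Hs.V p k) (ψ p) := rfl
      rw [h3, dirichlet_coe, dirichlet_coe, h5, hn₀ p hn'' k, sub_self]
  have hKc : IsCompactOperator K := by
    have : K = ∑ n ∈ Finset.Icc (0 : ℤ) n₀,
        (lp.singleContinuousLinearMap ℂ (fun _ : ℤ => Site N) 2 n).comp
          ((lp.evalCLM ℂ (fun _ : ℤ => Site N) (p := 2) n).comp K) := by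
      ext ψ m : 3
      rw [_root_.sum_apply, lp.coeFn_sum, Finset.sum_apply]
      simp only [ContinuousLinearMap.comp_apply, lp.singleContinuousLinearMap_apply]
      by_cases hm : m ∈ Finset.Icc (0 : ℤ) n₀
      · rw [Finset.sum_eq_single_of_mem m hm]
        · rw [lp.single_apply_self]
          rfl
        · intro n _ hnm
          exact lp.single_apply_ne _ _ _ hnm.symm
      · rw [hK0 ψ m hm, Finset.sum_eq_zero]
        intro n hn
        refine lp.single_apply_ne _ _ _ ?_
        rintro rfl
        exact hm hn
    rw [this]
    refine Finset.sum_induction _ (fun T : EdgeSpace N →L[ℂ] BulkSpace N => IsCompactOperator T)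
      (fun _ _ ha hb => ha.add hb) isCompactOperator_zero fun n _ => ?_
    exact ((isCompactOperator_id (E := Site N)).comp_clm
      ((lp.evalCLM ℂ (fun _ : ℤ => Site N) (p := 2) n).comp K)).clm_comp
        (lp.singleContinuousLinearMap ℂ (fun _ : ℤ => Site N) 2 n)
  have hu : IsUnit (H.op k - z • (1 : BulkSpace N →L[ℂ] BulkSpace N)) := by
    have := spectrum.notMem_iff.1 hz
    rw [← IsUnit.neg_iff, neg_sub]
    rwa [Algebra.algebraMap_eq_smul_one] at this
  intro u hub y hy
  obtain ⟨φ, hφ, x, hx⟩ := exists_tendsto_of_isCompactOperator hKc hub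
  refine ⟨φ, hφ, ?_⟩
  set S := Ring.inverse (H.op k - z • (1 : BulkSpace N →L[ℂ] BulkSpace N)) with hS
  have hSu : ∀ n, u n = r (S (e ((Hs.op k - z • (1 : EdgeSpace N →L[ℂ] EdgeSpace N)) (u n))
      + K (u n))) := by
    intro n
    have h1 : e ((Hs.op k - z • (1 : EdgeSpace N →L[ℂ] EdgeSpace N)) (u n)) + K (u n) =
        (H.op k - z • (1 : BulkSpace N →L[ℂ] BulkSpace N)) (e (u n)) := by
      simp [hK]
    have h2 := congrArg (fun T : BulkSpace N →L[ℂ] BulkSpace N => T (e (u n)))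
      (Ring.inverse_mul_cancel _ hu)
    simp only [mul_apply_eq_comp, one_apply_eq_self] at h2
    rw [h1, h2, hre]
  refine ⟨r (S (e y + x)), ?_⟩
  have h1 : Tendsto (fun n => e ((Hs.op k - z • (1 : EdgeSpace N →L[ℂ] EdgeSpace N)) (u (φ n)))
      + K (u (φ n))) atTop (𝓝 (e y + x)) :=
    ((e.continuous.tendsto y).comp (hy.comp hφ.tendsto_atTop)).add hx
  refine (((r.comp S).continuous.tendsto _).comp h1).congr fun n => ?_
  exact (hSu _).symm

theorem act_injective {M : Matrix (Fin N) (Fin N) ℂ} (hM : IsUnit M) {v : Site N}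
    (h : act M v = 0) : v = 0 := by
  have h1 : M.mulVec v.ofLp = 0 := by
    have := congrArg WithLp.ofLp h
    simpa [act, Matrix.toLpLin_apply] using this
  have h2 := Matrix.eq_zero_of_mulVec_eq_zero (M := M)
    ((Matrix.isUnit_iff_isUnit_det M).1 hM).ne_zero h1
  ext i
  simpa using congrFun h2 i

/-- An eigenvector of the edge Hamiltonian is determined by its value at the first site. -/
theorem eq_zero_of_apply_one_eq_zero {H : BulkHamiltonian N} (Hs : EdgeHamiltonian H) {k : ℝ} {z : ℂ}
    {ψ : EdgeSpace N} (h : Hs.op k ψ = z • ψ) (h1 : ψ 1 = 0) : ψ = 0 := by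
  have hrec : ∀ n : ℕ+, dirichlet ψ ((n : ℕ) - 1) = 0 ∧ ψ n = 0 := by
    intro n
    induction n using PNat.recOn with
    | one => exact ⟨by simp [dirichlet_zero], h1⟩
    | succ n ih =>
      have hn : ((n + 1 : ℕ+) : ℕ) - 1 = (n : ℕ) := by simp
      refine ⟨by rw [hn, dirichlet_coe]; exact ih.2, ?_⟩
      have h2 := congrArg (fun χ : EdgeSpace N => χ n) h
      simp only [edge_op_apply, edgeDiff, ih.1, ih.2, map_zero, zero_add, add_zero, lp.coeFn_smul,
        Pi.smul_apply, smul_zero] at h2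
      exact act_injective (H.A_invertible k).star h2
  ext1
  funext n
  exact (hrec n).2

/-! ### The boundary scattering matrix of an edge Hamiltonian -/

/-- The `a`-th unit vector at the first site of the half-line. -/
noncomputable def siteVec (a : Fin N) : EdgeSpace N :=
  lp.single 2 (1 : ℕ+) (EuclideanSpace.single a (1 : ℂ))

theorem inner_siteVec (a : Fin N) (ψ : EdgeSpace N) : inner ℂ (siteVec a) ψ = ψ 1 a := by
  rw [siteVec, lp.inner_single_left, EuclideanSpace.inner_single_left]
  simp

theorem inner_edge_op_sub {H : BulkHamiltonian N} (Hs : EdgeHamiltonian H) (k x : ℝ)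
    (ψ χ : EdgeSpace N) :
    inner ℂ ((Hs.op k - (x : ℂ) • (1 : EdgeSpace N →L[ℂ] EdgeSpace N)) ψ) χ =
      inner ℂ ψ ((Hs.op k - (x : ℂ) • (1 : EdgeSpace N →L[ℂ] EdgeSpace N)) χ) := by
  simp only [_root_.sub_apply, _root_.smul_apply, one_apply_eq_self, inner_sub_left, inner_sub_right,
    inner_edge_op, inner_smul_left, inner_smul_right, Complex.conj_ofReal]

theorem eq_zero_of_siteVec {H : BulkHamiltonian N} (Hs : EdgeHamiltonian H) {k : ℝ} {z : ℂ}
    {ψ : EdgeSpace N} (h : (Hs.op k - z • (1 : EdgeSpace N →L[ℂ] EdgeSpace N)) ψ = 0)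
    (h1 : ∀ a, inner ℂ (siteVec a) ψ = 0) : ψ = 0 := by
  refine eq_zero_of_apply_one_eq_zero Hs (k := k) (z := z) ?_ ?_
  · simpa [sub_eq_zero] using h
  · ext a
    simpa [inner_siteVec] using h1 a

/-- For `s · Im z ≥ 0` the operator `H♯(k) - z - isQ`, `Q` the projection onto the first site, is
invertible as long as `z` is not a real point of the bulk spectrum; edge eigenvalues do no harm, as
eigenvectors do not vanish at the first site. -/
theorem isUnit_edge {H : BulkHamiltonian N} (Hs : EdgeHamiltonian H) {k : ℝ} {z : ℂ} {s : ℝ}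
    (hs : s ≠ 0) (hsz : 0 ≤ s * z.im) (hz : z.im = 0 → z ∉ spectrum ℂ (H.op k)) :
    IsUnit (Hs.op k - z • (1 : EdgeSpace N →L[ℂ] EdgeSpace N) -
      (s * Complex.I) • finiteRank (fun _ => ((1 : ℝ) : ℂ)) siteVec) := by
  by_cases h0 : z.im = 0
  · obtain ⟨x, rfl⟩ : ∃ x : ℝ, z = x := ⟨z.re, Complex.ext rfl (by simp [h0])⟩
    exact isUnit_sub_I_finiteRank (inner_edge_op_sub Hs k x) (isProperOp_edge Hs (hz h0))
      (fun _ => zero_le_one) hs fun ψ h1 h2 =>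
        eq_zero_of_siteVec Hs h1 fun a => h2 a one_ne_zero
  · exact isUnit_of_im_ne_zero (inner_edge_op Hs k) (fun _ => zero_le_one)
      (lt_of_le_of_ne hsz (mul_ne_zero hs h0).symm)

/-- The matrix `S(x, k)` which at a real energy `x` relates the boundary values
`A ψ₀ + i ψ₁` and `A ψ₀ - i ψ₁` of the decaying solutions. -/
noncomputable def boundaryScat {H : BulkHamiltonian N} (Hs : EdgeHamiltonian H) (x k : ℝ) :
    Matrix (Fin N) (Fin N) ℂ :=
  scat (Hs.op k - (x : ℂ) • (1 : EdgeSpace N →L[ℂ] EdgeSpace N)) (fun _ => 1) siteVec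

theorem isUnit_edge_real {H : BulkHamiltonian N} (Hs : EdgeHamiltonian H) {k x : ℝ}
    (hx : (x : ℂ) ∉ spectrum ℂ (H.op k)) :
    IsUnit (Hs.op k - (x : ℂ) • (1 : EdgeSpace N →L[ℂ] EdgeSpace N) -
      Complex.I • finiteRank (fun _ => ((1 : ℝ) : ℂ)) siteVec) ∧
    IsUnit (Hs.op k - (x : ℂ) • (1 : EdgeSpace N →L[ℂ] EdgeSpace N) +
      Complex.I • finiteRank (fun _ => ((1 : ℝ) : ℂ)) siteVec) := by
  have h1 := isUnit_edge Hs (z := (x : ℂ)) one_ne_zero (by simp) (fun _ => hx)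
  have h2 := isUnit_edge Hs (z := (x : ℂ)) (s := -1) (by norm_num) (by simp) (fun _ => hx)
  simp only [Complex.ofReal_one, one_mul, Complex.ofReal_neg, neg_mul, neg_smul, sub_neg_eq_add]
    at h1 h2 ⊢
  exact ⟨h1, h2⟩

theorem boundaryScat_det_ne_zero {H : BulkHamiltonian N} (Hs : EdgeHamiltonian H) {k x : ℝ}
    (hx : (x : ℂ) ∉ spectrum ℂ (H.op k)) : (boundaryScat Hs x k).det ≠ 0 :=
  scat_det_ne_zero (isUnit_edge_real Hs hx).1 (isUnit_edge_real Hs hx).2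

theorem continuousOn_boundaryScat_det {P : Type*} [TopologicalSpace P] {H : BulkHamiltonian N}
    (Hs : EdgeHamiltonian H) {x k : P → ℝ} {S : Set P} (hx : ContinuousOn x S)
    (hk : ContinuousOn k S) (h : ∀ p ∈ S, (x p : ℂ) ∉ spectrum ℂ (H.op (k p))) :
    ContinuousOn (fun p => (boundaryScat Hs (x p) (k p)).det) S := by
  refine continuousOn_scat ?_ continuousOn_const fun p hp => (isUnit_edge_real Hs (h p hp)).1
  exact ((continuous_edge_op Hs).comp_continuousOn hk).sub
    ((Complex.continuous_ofReal.comp_continuousOn hx).fun_smul continuousOn_const)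

theorem boundaryScat_periodic {H : BulkHamiltonian N} (Hs : EdgeHamiltonian H) (x k : ℝ) :
    boundaryScat Hs x (k + 2 * π) = boundaryScat Hs x k := by
  rw [boundaryScat, edge_op_periodic, boundaryScat]

theorem boundaryScat_two_pi {H : BulkHamiltonian N} (Hs : EdgeHamiltonian H) (x : ℝ) :
    boundaryScat Hs x (2 * π) = boundaryScat Hs x 0 := by
  have := boundaryScat_periodic Hs x 0
  rwa [zero_add] at this

theorem exists_hasWinding_boundaryScat {H : BulkHamiltonian N} (Hs : EdgeHamiltonian H) {x : ℝ}
    (hx : ∀ k : ℝ, (x : ℂ) ∉ spectrum ℂ (H.op k)) :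
    ∃ m, HasWinding (fun k => (boundaryScat Hs x k).det) m := by
  refine exists_hasWinding ?_ (fun k => boundaryScat_det_ne_zero Hs (hx k)) ?_
  · exact continuousOn_univ.1 (continuousOn_boundaryScat_det Hs continuousOn_const continuousOn_id
      fun k _ => hx k)
  · simp only [boundaryScat_two_pi]

/-- The winding number of the boundary scattering matrix is constant on intervals of energies free of
bulk spectrum, whether or not there are edge eigenvalues. -/
theorem hasWinding_boundaryScat_energy {H : BulkHamiltonian N} (Hs : EdgeHamiltonian H) {a b : ℝ}
    (hab : ∀ k : ℝ, ∀ x ∈ uIcc a b, (x : ℂ) ∉ spectrum ℂ (H.op k)) {m : ℤ}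
    (h : HasWinding (fun k => (boundaryScat Hs a k).det) m) :
    HasWinding (fun k => (boundaryScat Hs b k).det) m := by
  have key : ∀ a b : ℝ, a ≤ b → (∀ k : ℝ, ∀ x ∈ Icc a b, (x : ℂ) ∉ spectrum ℂ (H.op k)) →
      ∃ m, HasWinding (fun k => (boundaryScat Hs a k).det) m ∧
        HasWinding (fun k => (boundaryScat Hs b k).det) m := by
    intro a b hle hab
    refine hasWinding_homotopy (F := fun x k => (boundaryScat Hs x k).det) hle ?_ ?_ ?_
    · exact continuousOn_boundaryScat_det Hs continuousOn_fst continuousOn_snd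
        fun p hp => hab _ _ hp.1
    · exact fun x hx k => boundaryScat_det_ne_zero Hs (hab k x hx)
    · exact fun x hx => by simp only [boundaryScat_two_pi]
  rcases le_total a b with hle | hle
  · rw [uIcc_of_le hle] at hab
    obtain ⟨m', h1, h2⟩ := key a b hle hab
    rwa [h.unique h1]
  · rw [uIcc_of_ge hle] at hab
    obtain ⟨m', h1, h2⟩ := key b a hle hab
    rwa [h.unique h2]

/-! ### Deformation of the edge potential -/

theorem UniformC1.combine {ι : Type} {V V' : ι → ℝ → Matrix (Fin N) (Fin N) ℂ}
    (hV : UniformC1 V) (hV' : UniformC1 V') (s t : ℂ) :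
    UniformC1 (fun n k => s • V n k + t • V' n k) := by
  obtain ⟨h1, ⟨C, hC⟩, h3⟩ := hV
  obtain ⟨h1', ⟨C', hC'⟩, h3'⟩ := hV'
  have hd : ∀ n i j k, deriv (fun κ => (s • V n κ + t • V' n κ) i j) k =
      s * deriv (fun κ => V n κ i j) k + t * deriv (fun κ => V' n κ i j) k := by
    intro n i j k
    have e1 := ((h1 n i j).differentiable one_ne_zero k).hasDerivAt.const_mul s
    have e2 := ((h1' n i j).differentiable one_ne_zero k).hasDerivAt.const_mul t
    exact (e1.add e2).deriv
  refine ⟨fun n i j => ?_, ⟨‖s‖ * C + ‖t‖ * C', fun n k i j => ⟨?_, ?_⟩⟩, fun η hη => ?_⟩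
  · exact ((h1 n i j).const_smul s).add ((h1' n i j).const_smul t)
  · refine (norm_add_le _ _).trans ?_
    simp only [Matrix.smul_apply, norm_smul]
    gcongr
    · exact (hC n k i j).1
    · exact (hC' n k i j).1
  · rw [hd]
    refine (norm_add_le _ _).trans ?_
    simp only [norm_mul]
    gcongr
    · exact (hC n k i j).2
    · exact (hC' n k i j).2
  · have hpos : 0 < ‖s‖ + ‖t‖ + 1 := by positivity
    obtain ⟨δ, hδ, h4⟩ := h3 (η / (‖s‖ + ‖t‖ + 1)) (by positivity)
    obtain ⟨δ', hδ', h4'⟩ := h3' (η / (‖s‖ + ‖t‖ + 1)) (by positivity)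
    refine ⟨min δ δ', lt_min hδ hδ', fun n k k' i j hk => ?_⟩
    have e1 := h4 n k k' i j (hk.trans_le (min_le_left _ _))
    have e2 := h4' n k k' i j (hk.trans_le (min_le_right _ _))
    rw [hd, hd]
    set p := deriv (fun κ => V n κ i j) k - deriv (fun κ => V n κ i j) k' with hp
    set p' := deriv (fun κ => V' n κ i j) k - deriv (fun κ => V' n κ i j) k' with hp'
    have e3 : s * deriv (fun κ => V n κ i j) k + t * deriv (fun κ => V' n κ i j) k -
        (s * deriv (fun κ => V n κ i j) k' + t * deriv (fun κ => V' n κ i j) k') =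
        s * p + t * p' := by
      rw [hp, hp']
      ring
    rw [e3]
    calc ‖s * p + t * p'‖ ≤ ‖s‖ * ‖p‖ + ‖t‖ * ‖p'‖ := by
          refine (norm_add_le _ _).trans ?_
          rw [norm_mul, norm_mul]
      _ ≤ ‖s‖ * (η / (‖s‖ + ‖t‖ + 1)) + ‖t‖ * (η / (‖s‖ + ‖t‖ + 1)) := by gcongr
      _ < η := by
          rw [← add_mul, mul_div_assoc', div_lt_iff₀ hpos]
          nlinarith

/-- The edge Hamiltonian of the half-line with unmodified potential. -/
noncomputable def halfLine (H : BulkHamiltonian N) : EdgeHamiltonian H where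
  V := fun n k => H.V ((n : ℕ) : ℤ) k
  V_periodic := fun n k => H.V_periodic _ k
  V_uniformC1 := by
    obtain ⟨h1, ⟨C, hC⟩, h3⟩ := H.V_uniformC1
    refine ⟨fun n => h1 _, ⟨C, fun n => hC _⟩, fun η hη => ?_⟩
    obtain ⟨δ, hδ, h⟩ := h3 η hη
    exact ⟨δ, hδ, fun n => h _⟩
  V_hermitian := fun n k => H.V_hermitian _ k
  eventually_bulk := ⟨0, fun n _ k => rfl⟩

/-- The linear interpolation between two edge Hamiltonians of the same bulk. -/
noncomputable def interpolate {H : BulkHamiltonian N} (Hs Hs' : EdgeHamiltonian H) (t : ℝ) :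
    EdgeHamiltonian H where
  V := fun n k => ((1 - t : ℝ) : ℂ) • Hs.V n k + (t : ℂ) • Hs'.V n k
  V_periodic := fun n k => by simp only [Hs.V_periodic, Hs'.V_periodic]
  V_uniformC1 := Hs.V_uniformC1.combine Hs'.V_uniformC1 _ _
  V_hermitian := fun n k => by
    refine Matrix.IsHermitian.add ?_ ?_
    · rw [Matrix.IsHermitian, Matrix.conjTranspose_smul, (Hs.V_hermitian n k).eq]
      simp
    · rw [Matrix.IsHermitian, Matrix.conjTranspose_smul, (Hs'.V_hermitian n k).eq]
      simp
  eventually_bulk := by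
    obtain ⟨n₀, h⟩ := Hs.eventually_bulk
    obtain ⟨n₁, h'⟩ := Hs'.eventually_bulk
    refine ⟨max n₀ n₁, fun n hn k => ?_⟩
    rw [h n ((le_max_left _ _).trans_lt hn), h' n ((le_max_right _ _).trans_lt hn), ← add_smul,
      ← Complex.ofReal_add]
    simp

theorem interpolate_op {H : BulkHamiltonian N} (Hs Hs' : EdgeHamiltonian H) (t k : ℝ) :
    (interpolate Hs Hs' t).op k = ((1 - t : ℝ) : ℂ) • Hs.op k + (t : ℂ) • Hs'.op k := by
  ext ψ n : 3
  have h1 : ((interpolate Hs Hs' t).op k ψ) n = edgeDiff (interpolate Hs Hs' t) k ψ n := rfl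
  have h2 : ((((1 - t : ℝ) : ℂ) • Hs.op k + (t : ℂ) • Hs'.op k) ψ) n =
      ((1 - t : ℝ) : ℂ) • edgeDiff Hs k ψ n + (t : ℂ) • edgeDiff Hs' k ψ n := rfl
  rw [h1, h2]
  have h3 : ∀ v, act ((interpolate Hs Hs' t).V n k) v =
      ((1 - t : ℝ) : ℂ) • act (Hs.V n k) v + (t : ℂ) • act (Hs'.V n k) v := by
    intro v
    simp only [act, interpolate, map_add, map_smul, LinearMap.add_apply, LinearMap.smul_apply]
  simp only [edgeDiff, h3, smul_add, Complex.ofReal_sub, Complex.ofReal_one, sub_smul, one_smul]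
  abel

/-- The winding number of the boundary scattering matrix depends on the bulk only. -/
theorem hasWinding_boundaryScat_potential {H : BulkHamiltonian N} (Hs Hs' : EdgeHamiltonian H)
    {x : ℝ} (hx : ∀ k : ℝ, (x : ℂ) ∉ spectrum ℂ (H.op k)) {m : ℤ}
    (h : HasWinding (fun k => (boundaryScat Hs x k).det) m) :
    HasWinding (fun k => (boundaryScat Hs' x k).det) m := by
  have e0 : (interpolate Hs Hs' 0).op = Hs.op := by
    funext k
    rw [interpolate_op]
    simp
  have e1 : (interpolate Hs Hs' 1).op = Hs'.op := by
    funext k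
    rw [interpolate_op]
    simp
  obtain ⟨m', h1, h2⟩ := hasWinding_homotopy (a := 0) (b := 1)
    (F := fun t k => (boundaryScat (interpolate Hs Hs' t) x k).det) zero_le_one (by
      refine continuousOn_scat ?_ continuousOn_const fun p _ => (isUnit_edge_real _ (hx _)).1
      simp only [interpolate_op]
      have c1 := (continuous_edge_op Hs).comp (continuous_snd (X := ℝ) (Y := ℝ))
      have c2 := (continuous_edge_op Hs').comp (continuous_snd (X := ℝ) (Y := ℝ))
      refine Continuous.continuousOn (Continuous.sub (Continuous.add ?_ ?_) continuous_const)
      · exact Continuous.smul (Complex.continuous_ofReal.comp (by fun_prop)) c1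
      · exact Continuous.smul (Complex.continuous_ofReal.comp (by fun_prop)) c2)
    (fun t _ k => boundaryScat_det_ne_zero _ (hx k))
    (fun t _ => by simp only [boundaryScat_two_pi])
  simp only [boundaryScat, e0, e1] at h1 h2 h ⊢
  rwa [h.unique h1]

/-- The gap condition persists in a neighbourhood of `μ`. -/
theorem exists_isGapInterval (H : BulkHamiltonian N) (μ : ℝ)
    (hμ : ∀ k : ℝ, (μ : ℂ) ∉ spectrum ℂ (H.op k)) : ∃ a b : ℝ, IsGapInterval H μ a b := by
  have hc : Continuous fun p : ℝ × ℝ =>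
      (p.1 : ℂ) • (1 : BulkSpace N →L[ℂ] BulkSpace N) - H.op p.2 :=
    ((Complex.continuous_ofReal.comp continuous_fst).smul continuous_const).sub
      ((continuous_bulk_op H).comp continuous_snd)
  obtain ⟨U, hU, hUo⟩ : ∃ U : Set (ℝ × ℝ),
      (∀ x k, (x, k) ∈ U ↔ (x : ℂ) ∉ spectrum ℂ (H.op k)) ∧ IsOpen U := by
    refine ⟨_, fun x k => ?_, Units.isOpen.preimage hc⟩
    rw [spectrum.notMem_iff, Algebra.algebraMap_eq_smul_one]
    rfl
  obtain ⟨u, v, hu, hv, hμu, hv', huv⟩ := generalized_tube_lemma (s := {μ}) isCompact_singleton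
    (t := Icc (0 : ℝ) (2 * π)) isCompact_Icc hUo (by
      rintro ⟨x, k⟩ ⟨hx, -⟩
      rw [mem_singleton_iff] at hx
      simp only at hx
      rw [hU, hx]
      exact hμ k)
  obtain ⟨ε, hε, hball⟩ := Metric.isOpen_iff.1 hu μ (hμu rfl)
  refine ⟨μ - ε / 2, μ + ε / 2, by linarith, by linarith, fun k x hx => ?_⟩
  have hxu : x ∈ u := hball (by
    rw [Metric.mem_ball, Real.dist_eq, abs_lt]
    constructor <;> linarith [hx.1, hx.2])
  have hp : Function.Periodic H.op (2 * π) := bulk_op_periodic H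
  obtain ⟨k', hk', he⟩ := hp.exists_mem_Ico₀ (by positivity) k
  rw [he, ← hU]
  exact huv (mk_mem_prod hxu (hv' (Ico_subset_Icc_self hk')))

/-! ### Decaying solutions and their boundary values -/

/-- The sequence supported at the first site. -/
noncomputable def atFirst (c : Site N) : EdgeSpace N := lp.single 2 (1 : ℕ+) c

theorem finiteRank_siteVec (ψ : EdgeSpace N) :
    finiteRank (fun _ => ((1 : ℝ) : ℂ)) siteVec ψ = atFirst (ψ 1) := by
  rw [finiteRank_apply]
  have h : ∀ a : Fin N, (((1 : ℝ) : ℂ) * inner ℂ (siteVec a) ψ) • siteVec a =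
      lp.singleContinuousLinearMap ℂ (fun _ : ℕ+ => Site N) 2 1
        ((ψ 1 a) • EuclideanSpace.single a (1 : ℂ)) := by
    intro a
    rw [inner_siteVec, Complex.ofReal_one, one_mul, map_smul]
    rfl
  simp only [h]
  rw [← map_sum, lp.singleContinuousLinearMap_apply, atFirst]
  congr 1
  ext i
  simp [Pi.single_apply]

theorem continuous_atFirst : Continuous (atFirst : Site N → EdgeSpace N) :=
  (lp.singleContinuousLinearMap ℂ (fun _ : ℕ+ => Site N) 2 1).continuous

/-- The operator `H⁺(k) - z - i s Q` on the half-line, `Q` the projection onto the first site. -/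
noncomputable def absorbing (H : BulkHamiltonian N) (s : ℝ) (z : ℂ) (k : ℝ) :
    EdgeSpace N →L[ℂ] EdgeSpace N :=
  (halfLine H).op k - z • (1 : EdgeSpace N →L[ℂ] EdgeSpace N) -
      (s * Complex.I) • finiteRank (fun _ => ((1 : ℝ) : ℂ)) siteVec

theorem absorbing_apply (H : BulkHamiltonian N) (s : ℝ) (z : ℂ) (k : ℝ) (ψ : EdgeSpace N) :
    absorbing H s z k ψ = (halfLine H).op k ψ - z • ψ - (s * Complex.I) • atFirst (ψ 1) := by
  rw [absorbing, _root_.sub_apply, _root_.sub_apply, _root_.smul_apply, _root_.smul_apply,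
    finiteRank_siteVec, one_apply_eq_self]

/-- The linear functional `ψ ↦ A ψ₀ + i s ψ₁` on sequences. -/
noncomputable def boundaryValue (H : BulkHamiltonian N) (s : ℝ) (k : ℝ) :
    (ℤ → Site N) →ₗ[ℂ] Site N where
  toFun ψ := act (H.A k) (ψ 0) + (s * Complex.I) • ψ 1
  map_add' ψ χ := by
    simp only [Pi.add_apply, map_add, smul_add]
    abel
  map_smul' c ψ := by
    simp only [Pi.smul_apply, map_smul, smul_add, RingHom.id_apply]
    rw [smul_comm]

theorem boundaryValue_apply (H : BulkHamiltonian N) (s : ℝ) (k : ℝ) (ψ : ℤ → Site N) :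
    boundaryValue H s k ψ = act (H.A k) (ψ 0) + (s * Complex.I) • ψ 1 := rfl

theorem halfLine_op_apply (H : BulkHamiltonian N) (k : ℝ) (ψ : EdgeSpace N) (n : ℕ+) :
    (halfLine H).op k ψ n = act (H.A k) (dirichlet ψ ((n : ℕ) - 1)) +
      act (H.A k).conjTranspose (ψ (n + 1)) + act (H.V ((n : ℕ) : ℤ) k) (ψ n) := rfl

theorem atFirst_one (c : Site N) : atFirst c 1 = c := lp.single_apply_self _ _ _

theorem atFirst_add_one (c : Site N) (m : ℕ+) : atFirst c (m + 1) = 0 :=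
  lp.single_apply_ne _ _ _ (by
    intro h
    have := congrArg (fun p : ℕ+ => (p : ℕ)) h
    have h2 := m.pos
    simp only [PNat.add_coe, PNat.one_coe] at this
    omega)

/-- Restricted to the half-line, a decaying solution solves an inhomogeneous equation whose source
is the boundary value. -/
theorem exists_halfLine_solution (H : BulkHamiltonian N) (s : ℝ) {z : ℂ} {k : ℝ} {ψ : ℤ → Site N}
    (hψ : ψ ∈ solutionSpace H z k) : ∃ χ : EdgeSpace N, (∀ n : ℕ+, χ n = ψ ((n : ℕ) : ℤ)) ∧
      absorbing H s z k χ = -atFirst (boundaryValue H s k ψ) := by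
  obtain ⟨h1, h2⟩ := hψ
  have hm : Memℓp (fun n : ℕ+ => ψ ((n : ℕ) : ℤ)) 2 := by
    refine memℓp_gen ?_
    simp only [ENNReal.toReal_ofNat, Real.rpow_ofNat]
    exact h2.comp_injective PNat.coe_injective
  obtain ⟨χ, hχ⟩ : ∃ χ : EdgeSpace N, ∀ n : ℕ+, χ n = ψ ((n : ℕ) : ℤ) := ⟨⟨_, hm⟩, fun _ => rfl⟩
  refine ⟨χ, hχ, ?_⟩
  ext1
  funext n
  rw [absorbing_apply]
  simp only [lp.coeFn_sub, lp.coeFn_smul, lp.coeFn_neg, Pi.sub_apply, Pi.smul_apply, Pi.neg_apply]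
  rw [halfLine_op_apply]
  have hn := h1 ((n : ℕ) : ℤ)
  unfold bulkDiff at hn
  have hχ' : χ (n + 1) = ψ (((n : ℕ) : ℤ) + 1) := by
    rw [hχ]
    simp
  rw [← hχ', ← hχ] at hn
  rcases eq_or_ne n 1 with rfl | hne
  · rw [atFirst_one, atFirst_one, boundaryValue_apply]
    have e1 : (((1 : ℕ+) : ℕ) : ℤ) - 1 = 0 := by simp
    have e2 : ((1 : ℕ+) : ℕ) - 1 = 0 := by simp
    have e3 : χ 1 = ψ 1 := by
      rw [hχ]
      simp
    rw [e2, dirichlet_zero, map_zero, zero_add, ← hn, e1, ← e3]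
    abel
  · obtain ⟨m, rfl⟩ := PNat.exists_eq_succ_of_ne_one hne
    have e1 : (((m + 1 : ℕ+) : ℕ) : ℤ) - 1 = ((m : ℕ) : ℤ) := by simp
    have e2 : ((m + 1 : ℕ+) : ℕ) - 1 = (m : ℕ) := by simp
    rw [e1, ← hχ] at hn
    rw [atFirst_add_one, atFirst_add_one, e2, dirichlet_coe, hn]
    simp

theorem isUnit_absorbing {H : BulkHamiltonian N} {k : ℝ} {z : ℂ} {s : ℝ}
    (hs : s ≠ 0) (hsz : 0 ≤ s * z.im) (hz : z.im = 0 → z ∉ spectrum ℂ (H.op k)) :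
    IsUnit (absorbing H s z k) := isUnit_edge (halfLine H) hs hsz hz

theorem inverse_absorbing {H : BulkHamiltonian N} {s : ℝ} {z : ℂ} {k : ℝ}
    (hu : IsUnit (absorbing H s z k)) (χ : EdgeSpace N) :
    Ring.inverse (absorbing H s z k) (absorbing H s z k χ) = χ := by
  have := congrArg (fun T : EdgeSpace N →L[ℂ] EdgeSpace N => T χ) (Ring.inverse_mul_cancel _ hu)
  simpa using this

theorem absorbing_inverse {H : BulkHamiltonian N} {s : ℝ} {z : ℂ} {k : ℝ}
    (hu : IsUnit (absorbing H s z k)) (χ : EdgeSpace N) :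
    absorbing H s z k (Ring.inverse (absorbing H s z k) χ) = χ := by
  have := congrArg (fun T : EdgeSpace N →L[ℂ] EdgeSpace N => T χ) (Ring.mul_inverse_cancel _ hu)
  simpa using this

/-- A decaying solution is determined by its boundary value. -/
theorem eq_zero_of_boundaryValue {H : BulkHamiltonian N} {s : ℝ} {z : ℂ} {k : ℝ}
    (hu : IsUnit (absorbing H s z k)) {ψ : ℤ → Site N} (hψ : ψ ∈ solutionSpace H z k)
    (h0 : boundaryValue H s k ψ = 0) : ψ = 0 := by
  obtain ⟨χ, hχ, hχ'⟩ := exists_halfLine_solution H s hψ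
  have hχ0 : χ = 0 := by
    rw [← inverse_absorbing hu χ, hχ', h0, atFirst, lp.single_zero, neg_zero, map_zero]
  have h1 : ∀ n : ℤ, 1 ≤ n → ψ n = 0 := by
    intro n hn
    have := hχ (n.toNat.toPNat')
    rw [hχ0, Nat.toPNat'_coe, if_pos (by omega), Int.toNat_of_nonneg (by omega)] at this
    exact this.symm
  have h2 : ψ 0 = 0 := by
    rw [boundaryValue_apply, h1 1 le_rfl, smul_zero, add_zero] at h0
    exact act_injective (H.A_invertible k) h0
  have h3 : ∀ m : ℕ, ψ (-(m : ℤ)) = 0 ∧ ψ (-(m : ℤ) + 1) = 0 := by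
    intro m
    induction m with
    | zero => exact ⟨by simpa using h2, by simpa using h1 1 le_rfl⟩
    | succ m ih =>
      have e1 : (-((m + 1 : ℕ) : ℤ)) = -(m : ℤ) - 1 := by push_cast; ring
      have e2 : (-((m + 1 : ℕ) : ℤ)) + 1 = -(m : ℤ) := by push_cast; ring
      rw [e2, e1]
      refine ⟨?_, ih.1⟩
      have := hψ.1 (-(m : ℤ))
      rw [bulkDiff, ih.1, ih.2, map_zero, map_zero, add_zero, add_zero, smul_zero] at this
      exact act_injective (H.A_invertible k) this
  funext n
  rcases le_or_gt 1 n with hn | hn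
  · exact h1 n hn
  · have := (h3 (-n).toNat).1
    rwa [Int.toNat_of_nonneg (by omega), neg_neg] at this

/-- The part on `{1, 2, …}` of the decaying solution with boundary value `c`. -/
noncomputable def decayHalf (H : BulkHamiltonian N) (s : ℝ) (z : ℂ) (k : ℝ) (c : Site N) :
    EdgeSpace N := -Ring.inverse (absorbing H s z k) (atFirst c)

/-- The values at the sites `1, 0, -1, …` of the decaying solution with boundary value `c`,
obtained by solving the recursion to the left. -/
noncomputable def decayBack (H : BulkHamiltonian N) (s : ℝ) (z : ℂ) (k : ℝ) (c : Site N) :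
    ℕ → Site N
  | 0 => decayHalf H s z k c 1
  | 1 => act (H.A k)⁻¹ (c - (s * Complex.I) • decayHalf H s z k c 1)
  | m + 2 => act (H.A k)⁻¹ (z • decayBack H s z k c (m + 1) -
      act (H.A k).conjTranspose (decayBack H s z k c m) -
      act (H.V (-(m : ℤ)) k) (decayBack H s z k c (m + 1)))

/-- The decaying solution with boundary value `c`. -/
noncomputable def decaySol (H : BulkHamiltonian N) (s : ℝ) (z : ℂ) (k : ℝ) (c : Site N) (n : ℤ) :
    Site N :=
  if 1 ≤ n then decayHalf H s z k c n.toNat.toPNat' else decayBack H s z k c (1 - n).toNat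

theorem act_act_inv {H : BulkHamiltonian N} (k : ℝ) (v : Site N) :
    act (H.A k) (act (H.A k)⁻¹ v) = v := by
  have h := (Matrix.isUnit_iff_isUnit_det _).1 (H.A_invertible k)
  ext i
  simp [act, Matrix.toLpLin_apply, Matrix.mulVec_mulVec, Matrix.mul_nonsing_inv _ h]

theorem decaySol_coe (H : BulkHamiltonian N) (s : ℝ) (z : ℂ) (k : ℝ) (c : Site N) (n : ℕ+) :
    decaySol H s z k c ((n : ℕ) : ℤ) = decayHalf H s z k c n := by
  have := n.pos
  rw [decaySol, if_pos (by omega)]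
  simp

theorem decaySol_back (H : BulkHamiltonian N) (s : ℝ) (z : ℂ) (k : ℝ) (c : Site N) (m : ℕ) :
    decaySol H s z k c (1 - (m : ℤ)) = decayBack H s z k c m := by
  rcases Nat.eq_zero_or_pos m with rfl | hm
  · have := decaySol_coe H s z k c 1
    simpa [decayBack] using this
  · rw [decaySol, if_neg (by omega)]
    congr 1
    omega

/-- Every vector is the boundary value of a decaying solution. -/
theorem decaySol_spec {H : BulkHamiltonian N} {s : ℝ} {z : ℂ} {k : ℝ}
    (hu : IsUnit (absorbing H s z k)) (c : Site N) :
    decaySol H s z k c ∈ solutionSpace H z k ∧ boundaryValue H s k (decaySol H s z k c) = c := by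
  have h0 : decaySol H s z k c 0 = decayBack H s z k c 1 := by
    simpa using decaySol_back H s z k c 1
  have h1 : decaySol H s z k c 1 = decayHalf H s z k c 1 := by
    simpa using decaySol_coe H s z k c 1
  have hbv : boundaryValue H s k (decaySol H s z k c) = c := by
    rw [boundaryValue_apply, h0, h1, decayBack, act_act_inv, sub_add_cancel]
  have heq : (halfLine H).op k (decayHalf H s z k c) = z • decayHalf H s z k c +
      (s * Complex.I) • atFirst (decayHalf H s z k c 1) - atFirst c := by
    have h2 : absorbing H s z k (decayHalf H s z k c) = -atFirst c := by
      rw [decayHalf, map_neg, absorbing_inverse hu]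
    rw [absorbing_apply] at h2
    rw [sub_eq_iff_eq_add, sub_eq_iff_eq_add] at h2
    rw [h2]
    abel
  refine ⟨⟨fun n => ?_, ?_⟩, hbv⟩
  · rcases le_or_gt 1 n with hn | hn
    · obtain ⟨p, rfl⟩ : ∃ p : ℕ+, ((p : ℕ) : ℤ) = n :=
        ⟨⟨n.toNat, by omega⟩, by simp; omega⟩
      have h2 := congrArg (fun χ : EdgeSpace N => χ p) heq
      simp only [lp.coeFn_sub, lp.coeFn_add, lp.coeFn_smul, Pi.sub_apply, Pi.add_apply,
        Pi.smul_apply] at h2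
      rw [halfLine_op_apply] at h2
      have e3 : decaySol H s z k c (((p : ℕ) : ℤ) + 1) = decayHalf H s z k c (p + 1) := by
        rw [← decaySol_coe]
        simp
      rw [bulkDiff, e3, decaySol_coe]
      rcases eq_or_ne p 1 with rfl | hne
      · have e1 : (((1 : ℕ+) : ℕ) : ℤ) - 1 = 0 := by simp
        have e2 : ((1 : ℕ+) : ℕ) - 1 = 0 := by simp
        rw [e2, dirichlet_zero, map_zero, zero_add, atFirst_one, atFirst_one] at h2
        rw [e1, h0, decayBack, act_act_inv, add_assoc, h2]
        abel
      · obtain ⟨m, rfl⟩ := PNat.exists_eq_succ_of_ne_one hne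
        have e1 : (((m + 1 : ℕ+) : ℕ) : ℤ) - 1 = ((m : ℕ) : ℤ) := by simp
        have e2 : ((m + 1 : ℕ+) : ℕ) - 1 = (m : ℕ) := by simp
        rw [e2, dirichlet_coe, atFirst_add_one, atFirst_add_one, smul_zero, add_zero, sub_zero] at h2
        rw [e1, decaySol_coe, h2]
    · obtain ⟨m, rfl⟩ : ∃ m : ℕ, n = -(m : ℤ) := ⟨(-n).toNat, by omega⟩
      have e1 := decaySol_back H s z k c (m + 2)
      have e2 := decaySol_back H s z k c (m + 1)
      have e3 := decaySol_back H s z k c m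
      rw [show (1 : ℤ) - ((m + 2 : ℕ) : ℤ) = -(m : ℤ) - 1 by push_cast; ring] at e1
      rw [show (1 : ℤ) - ((m + 1 : ℕ) : ℤ) = -(m : ℤ) by push_cast; ring] at e2
      rw [show (1 : ℤ) - (m : ℤ) = -(m : ℤ) + 1 by ring] at e3
      rw [bulkDiff, e1, e2, e3, decayBack, act_act_inv]
      abel
  · have hm := (memℓp_gen_iff (by norm_num : 0 < (2 : ENNReal).toReal)).1 (decayHalf H s z k c).2
    rw [← summable_nat_add_iff 1]
    have h3 := (Equiv.pnatEquivNat.symm.summable_iff).2 hm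
    refine h3.congr fun n => ?_
    simp only [Function.comp_apply, ENNReal.toReal_ofNat, Real.rpow_ofNat]
    rw [← decaySol_coe]
    simp [Nat.succPNat]

/-! ### Continuity of decaying solutions -/

section Continuity

variable {P : Type*} [TopologicalSpace P] {S : Set P}

theorem continuousOn_act {M : P → Matrix (Fin N) (Fin N) ℂ} {v : P → Site N}
    (hM : ContinuousOn M S) (hv : ContinuousOn v S) : ContinuousOn (fun p => act (M p) (v p)) S := by
  have h1 : ContinuousOn (fun p => (M p).mulVec (v p).ofLp) S := by
    have : Continuous fun q : Matrix (Fin N) (Fin N) ℂ × (Fin N → ℂ) => q.1.mulVec q.2 :=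
      continuous_fst.matrix_mulVec continuous_snd
    exact this.comp_continuousOn (hM.prodMk ((PiLp.continuous_ofLp 2 _).comp_continuousOn hv))
  have h2 := (PiLp.continuous_toLp 2 (fun _ : Fin N => ℂ)).comp_continuousOn h1
  refine h2.congr fun p _ => ?_
  simp [act, Matrix.toLpLin_apply]

theorem continuous_hopping (H : BulkHamiltonian N) : Continuous H.A :=
  continuous_pi fun i => continuous_pi fun j => (H.A_contDiff i j).continuous

theorem continuous_potential (H : BulkHamiltonian N) (n : ℤ) : Continuous (H.V n) :=
  continuous_pi fun i => continuous_pi fun j => (H.V_uniformC1.1 n i j).continuous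

theorem continuous_hopping_inv (H : BulkHamiltonian N) : Continuous fun k => (H.A k)⁻¹ := by
  have hA := continuous_hopping H
  have : ∀ k, (H.A k)⁻¹ = ((H.A k).det)⁻¹ • (H.A k).adjugate := fun k => by
    rw [Matrix.inv_def, Ring.inverse_eq_inv']
  simp only [this]
  exact (hA.matrix_det.inv₀ fun k =>
    ((Matrix.isUnit_iff_isUnit_det _).1 (H.A_invertible k)).ne_zero).smul hA.matrix_adjugate

variable {H : BulkHamiltonian N} {s : ℝ} {z : P → ℂ} {k : P → ℝ} {c : P → Site N}

theorem continuousOn_decaySol (hz : ContinuousOn z S) (hk : ContinuousOn k S)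
    (hc : ContinuousOn c S) (hu : ∀ p ∈ S, IsUnit (absorbing H s (z p) (k p))) (n : ℤ) :
    ContinuousOn (fun p => decaySol H s (z p) (k p) (c p) n) S := by
  have hB : ContinuousOn (fun p => absorbing H s (z p) (k p)) S :=
    (((continuous_edge_op (halfLine H)).comp_continuousOn hk).sub
      (hz.fun_smul continuousOn_const)).sub continuousOn_const
  have hhalf : ContinuousOn (fun p => decayHalf H s (z p) (k p) (c p)) S :=
    ((continuousOn_ring_inverse hB hu).clm_apply (continuous_atFirst.comp_continuousOn hc)).neg
  have hhalf' : ∀ m : ℕ+, ContinuousOn (fun p => decayHalf H s (z p) (k p) (c p) m) S := fun m =>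
    (continuous_lp_coord m).comp_continuousOn hhalf
  have hAi := (continuous_hopping_inv H).comp_continuousOn hk
  have hA := (continuous_hopping H).matrix_conjTranspose.comp_continuousOn hk
  have hback : ∀ m : ℕ, ContinuousOn (fun p => decayBack H s (z p) (k p) (c p) m) S ∧
      ContinuousOn (fun p => decayBack H s (z p) (k p) (c p) (m + 1)) S := by
    intro m
    induction m with
    | zero =>
      refine ⟨hhalf' 1, ?_⟩
      simp only [decayBack]
      exact continuousOn_act hAi (hc.sub ((hhalf' 1).fun_const_smul _))
    | succ m ih =>
      refine ⟨ih.2, ?_⟩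
      simp only [decayBack]
      exact continuousOn_act hAi (((hz.fun_smul ih.2).sub (continuousOn_act hA ih.1)).sub
        (continuousOn_act ((continuous_potential H _).comp_continuousOn hk) ih.2))
  unfold decaySol
  split_ifs
  · exact hhalf' _
  · exact (hback _).1

end Continuity

/-! ### Frames of decaying solutions -/

/-- The matrix whose columns are the boundary values of `v₁, …, v_N`. -/
noncomputable def boundaryMatrix (H : BulkHamiltonian N) (s k : ℝ) (v : Fin N → ℤ → Site N) :
    Matrix (Fin N) (Fin N) ℂ := Matrix.of fun i j => boundaryValue H s k (v j) i

theorem linearIndependent_iff_det_ne_zero (c : Fin N → Site N) :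
    LinearIndependent ℂ c ↔ (Matrix.of fun i j => c j i).det ≠ 0 := by
  rw [← isUnit_iff_ne_zero, ← Matrix.isUnit_iff_isUnit_det,
    ← Matrix.linearIndependent_cols_iff_isUnit]
  have : (Matrix.of fun i j => c j i).col = (WithLp.linearEquiv 2 ℂ (Fin N → ℂ)) ∘ c := by
    funext j
    rfl
  rw [this]
  exact (LinearMap.linearIndependent_iff _ (LinearEquiv.ker _)).symm

/-- Decaying solutions form a frame if and only if their boundary values form a basis of `ℂ^N`. -/
theorem isFrame_iff {H : BulkHamiltonian N} {s : ℝ} {z : ℂ} {k : ℝ}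
    (hu : IsUnit (absorbing H s z k)) {v : Fin N → ℤ → Site N} :
    IsFrame H z k v ↔ (∀ j, v j ∈ solutionSpace H z k) ∧ (boundaryMatrix H s k v).det ≠ 0 := by
  have hb : (boundaryMatrix H s k v).det ≠ 0 ↔ LinearIndependent ℂ (boundaryValue H s k ∘ v) :=
    (linearIndependent_iff_det_ne_zero _).symm
  rw [hb]
  constructor
  · rintro ⟨h1, h2⟩
    refine ⟨fun j => h2 ▸ Submodule.subset_span ⟨j, rfl⟩, h1.map ?_⟩
    rw [h2, Submodule.disjoint_def]
    intro ψ hψ h0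
    exact eq_zero_of_boundaryValue hu hψ h0
  · rintro ⟨h1, h2⟩
    have h3 : LinearIndependent ℂ v := h2.of_comp _
    refine ⟨h3, ?_⟩
    have hle : Submodule.span ℂ (Set.range v) ≤ solutionSpace H z k :=
      Submodule.span_le.2 (by rintro _ ⟨j, rfl⟩; exact h1 j)
    set f : solutionSpace H z k →ₗ[ℂ] Site N := (boundaryValue H s k).domRestrict _ with hf
    have hfi : Function.Injective f := by
      rw [← LinearMap.ker_eq_bot, Submodule.eq_bot_iff]
      intro ψ hψ
      exact Subtype.ext (eq_zero_of_boundaryValue hu ψ.2 (LinearMap.mem_ker.1 hψ))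
    have : FiniteDimensional ℂ (solutionSpace H z k) := FiniteDimensional.of_injective f hfi
    refine Submodule.eq_of_le_of_finrank_le hle ?_
    rw [finrank_span_eq_card h3]
    simpa using LinearMap.finrank_le_finrank_of_injective hfi

/-- At a real energy the two boundary values of decaying solutions are related by the boundary
scattering matrix. -/
theorem boundaryValue_neg_one {H : BulkHamiltonian N} {x k : ℝ}
    (hx : (x : ℂ) ∉ spectrum ℂ (H.op k)) {ψ : ℤ → Site N} (hψ : ψ ∈ solutionSpace H x k) :
    boundaryValue H (-1) k ψ = act (boundaryScat (halfLine H) x k) (boundaryValue H 1 k ψ) := by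
  have hu : IsUnit (absorbing H 1 x k) := isUnit_absorbing one_ne_zero (by simp) fun _ => hx
  obtain ⟨χ, hχ, hχ'⟩ := exists_halfLine_solution H 1 hψ
  set c := boundaryValue H 1 k ψ with hc
  have h1 : χ = -Ring.inverse (absorbing H 1 x k) (atFirst c) := by
    rw [← inverse_absorbing hu χ, hχ', map_neg]
  have h2 : χ 1 = ψ 1 := by
    rw [hχ]
    simp
  have h3 : boundaryValue H (-1) k ψ = c - (2 * Complex.I) • χ 1 := by
    rw [hc, boundaryValue_apply, boundaryValue_apply, h2, two_mul, add_smul]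
    simp only [Complex.ofReal_neg, Complex.ofReal_one, neg_mul, one_mul, neg_smul]
    abel
  have h4 : atFirst c = ∑ b, c b • siteVec b := by
    have := finiteRank_siteVec (atFirst c)
    rw [atFirst_one, finiteRank_apply] at this
    rw [← this]
    simp only [inner_siteVec, atFirst_one, Complex.ofReal_one, one_mul]
  have h5 : absorbing H 1 x k = (halfLine H).op k - (x : ℂ) • (1 : EdgeSpace N →L[ℂ] EdgeSpace N) -
      Complex.I • finiteRank (fun _ => ((1 : ℝ) : ℂ)) siteVec := by
    rw [absorbing, Complex.ofReal_one, one_mul]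
  have h6 : ∀ a, χ 1 a = -∑ b, compress (absorbing H 1 x k) siteVec a b * c b := by
    intro a
    rw [← inner_siteVec, h1, h4, map_sum, inner_neg_right, inner_sum]
    congr 1
    refine Finset.sum_congr rfl fun b _ => ?_
    rw [map_smul, inner_smul_right, compress, Matrix.of_apply, mul_comm]
  have h7 : boundaryScat (halfLine H) x k =
      1 + (2 * Complex.I) • compress (absorbing H 1 x k) siteVec := by
    have hd : Matrix.diagonal (fun _ : Fin N => ((1 : ℝ) : ℂ)) = 1 := by
      rw [Complex.ofReal_one, Matrix.diagonal_one]
    rw [boundaryScat, scat, h5, hd, one_mul]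
  rw [h3, h7]
  ext a
  have h8 : (act (1 + (2 * Complex.I) • compress (absorbing H 1 x k) siteVec) c) a =
      c a + (2 * Complex.I) * ∑ b, compress (absorbing H 1 x k) siteVec a b * c b := by
    simp only [act, Matrix.toLpLin_apply, Matrix.add_mulVec, Matrix.one_mulVec, Matrix.smul_mulVec]
    rfl
  rw [h8]
  have h9 : (c - (2 * Complex.I) • χ 1) a = c a - (2 * Complex.I) * χ 1 a := rfl
  rw [h9, h6]
  ring

theorem boundaryMatrix_neg_one {H : BulkHamiltonian N} {x k : ℝ}
    (hx : (x : ℂ) ∉ spectrum ℂ (H.op k)) {v : Fin N → ℤ → Site N}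
    (hv : ∀ j, v j ∈ solutionSpace H x k) :
    boundaryMatrix H (-1) k v = boundaryScat (halfLine H) x k * boundaryMatrix H 1 k v := by
  ext i j
  rw [boundaryMatrix, Matrix.of_apply, boundaryValue_neg_one hx (hv j)]
  rfl

/-! ### The bulk index as a winding number of boundary scattering matrices -/

section Loop

variable {H : BulkHamiltonian N} {μ : ℝ} {γ : ℝ → ℂ}

theorem IsFermiLoop.at_zero (hγ : IsFermiLoop H μ γ) : γ 0 = ((γ 0).re : ℂ) := by
  have h := hγ.symm 0 ⟨by linarith [pi_pos], pi_pos.le⟩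
  rw [neg_zero] at h
  exact (Complex.conj_eq_iff_re.1 h.symm).symm

theorem IsFermiLoop.at_neg_pi (hγ : IsFermiLoop H μ γ) : γ (-π) = μ := by
  rw [hγ.symm π ⟨by linarith [pi_pos], le_rfl⟩, hγ.fermi, Complex.conj_ofReal]

theorem IsFermiLoop.notMem_spectrum_of_le (hγ : IsFermiLoop H μ γ) {x : ℝ} (hx : x ≤ (γ 0).re)
    (k : ℝ) : (x : ℂ) ∉ spectrum ℂ (H.op k) := by
  intro h
  have := hγ.left_of_spectrum k x h (by
    rw [Complex.ofReal_re]
    exact hx.trans_lt hγ.left_of_fermi)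
  rw [Complex.ofReal_re] at this
  linarith

theorem IsFermiLoop.isUnit_upper (hgap : ∀ k : ℝ, (μ : ℂ) ∉ spectrum ℂ (H.op k))
    (hγ : IsFermiLoop H μ γ) {φ : ℝ} (hφ : φ ∈ Icc 0 π) (k : ℝ) :
    IsUnit (absorbing H 1 (γ φ) k) := by
  rcases hφ.1.eq_or_lt with rfl | h0
  · rw [hγ.at_zero]
    exact isUnit_absorbing one_ne_zero (by simp) fun _ => hγ.notMem_spectrum_of_le le_rfl k
  rcases hφ.2.eq_or_lt with rfl | h1
  · rw [hγ.fermi]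
    exact isUnit_absorbing one_ne_zero (by simp) fun _ => hgap k
  · have := hγ.upper φ ⟨h0, h1⟩
    exact isUnit_absorbing one_ne_zero (by rw [one_mul]; exact this.le)
      fun h => absurd h this.ne'

theorem IsFermiLoop.isUnit_lower (hgap : ∀ k : ℝ, (μ : ℂ) ∉ spectrum ℂ (H.op k))
    (hγ : IsFermiLoop H μ γ) {φ : ℝ} (hφ : φ ∈ Icc (-π) 0) (k : ℝ) :
    IsUnit (absorbing H (-1) (γ φ) k) := by
  rcases hφ.2.eq_or_lt with rfl | h0
  · rw [hγ.at_zero]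
    exact isUnit_absorbing (by norm_num) (by simp) fun _ => hγ.notMem_spectrum_of_le le_rfl k
  rcases hφ.1.eq_or_lt with rfl | h1
  · rw [hγ.at_neg_pi]
    exact isUnit_absorbing (by norm_num) (by simp) fun _ => hgap k
  · have := hγ.upper (-φ) ⟨by linarith, by linarith⟩
    rw [hγ.symm φ ⟨hφ.1, by linarith [pi_pos]⟩, Complex.conj_im] at this
    exact isUnit_absorbing (by norm_num) (by linarith) fun h => by linarith

theorem continuousOn_boundaryMatrix {P : Type*} [TopologicalSpace P] {S : Set P} (s : ℝ)
    {k : P → ℝ} {v : P → Fin N → ℤ → Site N} (hk : ContinuousOn k S) (hv : ContinuousOn v S) :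
    ContinuousOn (fun p => (boundaryMatrix H s (k p) (v p)).det) S := by
  refine (Continuous.matrix_det continuous_id).comp_continuousOn
    (f := fun p => boundaryMatrix H s (k p) (v p))
    (continuousOn_pi.2 fun i => continuousOn_pi.2 fun j => ?_)
  have hvn : ∀ n, ContinuousOn (fun p => v p j n) S := fun n =>
    continuousOn_pi.1 (continuousOn_pi.1 hv j) n
  have := (continuousOn_act ((continuous_hopping H).comp_continuousOn hk) (hvn 0)).add
    ((hvn 1).fun_const_smul (s * Complex.I))
  exact ((EuclideanSpace.proj (𝕜 := ℂ) i).continuous).comp_continuousOn this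

theorem boundaryMatrix_two_pi (H : BulkHamiltonian N) (s : ℝ) {v : ℝ → Fin N → ℤ → Site N}
    (hv : ∀ k, v (k + 2 * π) = v k) :
    boundaryMatrix H s (2 * π) (v (2 * π)) = boundaryMatrix H s 0 (v 0) := by
  have h1 := H.A_periodic 0
  have h2 := hv 0
  rw [zero_add] at h1 h2
  ext i j
  simp only [boundaryMatrix, Matrix.of_apply, boundaryValue_apply, h1, h2]

theorem boundaryMatrix_transition (H : BulkHamiltonian N) (s k : ℝ) {v w : Fin N → ℤ → Site N}
    {T : Matrix (Fin N) (Fin N) ℂ} (h : ∀ j, w j = ∑ i, T i j • v i) :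
    boundaryMatrix H s k w = boundaryMatrix H s k v * T := by
  ext a j
  rw [boundaryMatrix, Matrix.of_apply, h, map_sum, Matrix.mul_apply, boundaryMatrix]
  have : (∑ i, boundaryValue H s k (T i j • v i)) a =
      ∑ i, (boundaryValue H s k (T i j • v i)) a := by
    simp [Finset.sum_apply]
  rw [this]
  refine Finset.sum_congr rfl fun i _ => ?_
  rw [map_smul, PiLp.smul_apply, smul_eq_mul, Matrix.of_apply, mul_comm]

/-- The winding number of the transition matrix of any section of the cut frame bundle. -/
theorem winding_transition (hgap : ∀ k : ℝ, (μ : ℂ) ∉ spectrum ℂ (H.op k))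
    (hγ : IsFermiLoop H μ γ) {n n₀ m : ℤ}
    (hn : HasWinding (fun k => (boundaryScat (halfLine H) μ k).det) n)
    (hn₀ : HasWinding (fun k => (boundaryScat (halfLine H) (γ 0).re k).det) n₀)
    {v : ℝ → ℝ → Fin N → ℤ → Site N} {T : ℝ → Matrix (Fin N) (Fin N) ℂ}
    (hv : IsFrameSection H γ v) (hT : IsTransition v T)
    (hm : HasWinding (fun k => (T k).det) m) : m = n - n₀ := by
  have hpi := pi_pos
  have sub1 : Icc 0 π ⊆ Icc (-π) π := Icc_subset_Icc (by linarith) le_rfl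
  have sub2 : Icc (-π) 0 ⊆ Icc (-π) π := Icc_subset_Icc le_rfl (by linarith)
  -- Over each half of the loop the determinant of the boundary values has a constant winding number.
  obtain ⟨p, hp0, hpπ⟩ := hasWinding_homotopy (a := 0) (b := π)
    (F := fun φ k => (boundaryMatrix H 1 k (v φ k)).det) hpi.le
    (continuousOn_boundaryMatrix 1 continuousOn_snd
      (hv.continuousOn.mono (prod_mono_left sub1)))
    (fun φ hφ k => ((isFrame_iff (hγ.isUnit_upper hgap hφ k)).1 (hv.frame φ (sub1 hφ) k)).2)
    (fun φ hφ => by rw [boundaryMatrix_two_pi H 1 (hv.periodic φ (sub1 hφ))])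
  obtain ⟨r, hrπ, hr0⟩ := hasWinding_homotopy (a := -π) (b := 0)
    (F := fun φ k => (boundaryMatrix H (-1) k (v φ k)).det) (by linarith)
    (continuousOn_boundaryMatrix (-1) continuousOn_snd
      (hv.continuousOn.mono (prod_mono_left sub2)))
    (fun φ hφ k => ((isFrame_iff (hγ.isUnit_lower hgap hφ k)).1 (hv.frame φ (sub2 hφ) k)).2)
    (fun φ hφ => by rw [boundaryMatrix_two_pi H (-1) (hv.periodic φ (sub2 hφ))])
  have m0 : (0 : ℝ) ∈ Icc (-π) π := ⟨by linarith, hpi.le⟩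
  have mπ : π ∈ Icc (-π) π := ⟨by linarith, le_rfl⟩
  -- The two boundary values are compared at the leftmost point and at the Fermi energy, where the
  -- sections over the two halves differ in addition by the transition matrix.
  have e0 : n₀ + p = r := by
    refine HasWinding.unique (f := fun k => (boundaryMatrix H (-1) k (v 0 k)).det) ?_ hr0
    have := hn₀.mul hp0
    convert this using 2 with k
    rw [← Matrix.det_mul, ← boundaryMatrix_neg_one (hγ.notMem_spectrum_of_le le_rfl k)]
    intro j
    rw [← hγ.at_zero]
    exact ((isFrame_iff (hγ.isUnit_upper hgap ⟨le_rfl, hpi.le⟩ k)).1 (hv.frame 0 m0 k)).1 j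
  have e1 : n + p = r + m := by
    refine HasWinding.unique (f := fun k => (boundaryMatrix H (-1) k (v π k)).det) ?_ ?_
    · have := hn.mul hpπ
      convert this using 2 with k
      rw [← Matrix.det_mul, ← boundaryMatrix_neg_one (hgap k)]
      intro j
      rw [← hγ.fermi]
      exact ((isFrame_iff (hγ.isUnit_upper hgap ⟨hpi.le, le_rfl⟩ k)).1 (hv.frame π mπ k)).1 j
    · have := hrπ.mul hm
      convert this using 2 with k
      rw [← Matrix.det_mul, boundaryMatrix_transition H (-1) k (hT k)]
  omega

/-- A section of the cut frame bundle: over the upper half of the loop the basis with boundary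
values `A v₀ + i v₁ = 1`, over the lower half the basis given by `A v₀ - i v₁`, matched at the
leftmost point of the loop. -/
noncomputable def frameSection (H : BulkHamiltonian N) (γ : ℝ → ℂ) (φ k : ℝ) (j : Fin N) :
    ℤ → Site N :=
  if 0 ≤ φ then decaySol H 1 (γ φ) k (EuclideanSpace.single j 1)
  else decaySol H (-1) (γ φ) k
    (act (boundaryScat (halfLine H) (γ 0).re k) (EuclideanSpace.single j 1))

/-- The two definitions of the section agree at `φ = 0`, so that it is continuous there. -/
theorem frameSection_lower (hgap : ∀ k : ℝ, (μ : ℂ) ∉ spectrum ℂ (H.op k))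
    (hγ : IsFermiLoop H μ γ) {φ : ℝ} (hφ : φ ∈ Icc (-π) 0) (k : ℝ) (j : Fin N) :
    frameSection H γ φ k j = decaySol H (-1) (γ φ) k
      (act (boundaryScat (halfLine H) (γ 0).re k) (EuclideanSpace.single j 1)) := by
  rcases hφ.2.eq_or_lt with rfl | h0
  · have hpi := pi_pos
    obtain ⟨h1, h1'⟩ := decaySol_spec (hγ.isUnit_upper hgap ⟨le_rfl, hpi.le⟩ k)
      (EuclideanSpace.single j (1 : ℂ))
    obtain ⟨h2, h2'⟩ := decaySol_spec (hγ.isUnit_lower hgap hφ k)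
      (act (boundaryScat (halfLine H) (γ 0).re k) (EuclideanSpace.single j 1))
    rw [frameSection, if_pos le_rfl, ← sub_eq_zero]
    refine eq_zero_of_boundaryValue (hγ.isUnit_lower hgap hφ k) (Submodule.sub_mem _ h1 h2) ?_
    rw [map_sub, h2', sub_eq_zero]
    have h3 := h1
    rw [hγ.at_zero, boundaryValue_neg_one (hγ.notMem_spectrum_of_le le_rfl k)
      (by rw [hγ.at_zero] at h1; exact h1)]
    rw [← hγ.at_zero, h1']
  · rw [frameSection, if_neg h0.not_ge]

theorem boundaryMatrix_frameSection_lower (hgap : ∀ k : ℝ, (μ : ℂ) ∉ spectrum ℂ (H.op k))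
    (hγ : IsFermiLoop H μ γ) {φ : ℝ} (hφ : φ ∈ Icc (-π) 0) (k : ℝ) :
    boundaryMatrix H (-1) k (frameSection H γ φ k) = boundaryScat (halfLine H) (γ 0).re k := by
  ext i j
  rw [boundaryMatrix, Matrix.of_apply, frameSection_lower hgap hγ hφ,
    (decaySol_spec (hγ.isUnit_lower hgap hφ k) _).2]
  simp [act, Matrix.toLpLin_apply]

theorem boundaryMatrix_frameSection_upper (hgap : ∀ k : ℝ, (μ : ℂ) ∉ spectrum ℂ (H.op k))
    (hγ : IsFermiLoop H μ γ) {φ : ℝ} (hφ : φ ∈ Icc 0 π) (k : ℝ) :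
    boundaryMatrix H 1 k (frameSection H γ φ k) = 1 := by
  ext i j
  rw [boundaryMatrix, Matrix.of_apply, frameSection, if_pos hφ.1,
    (decaySol_spec (hγ.isUnit_upper hgap hφ k) _).2]
  simp [Matrix.one_apply]

theorem continuousOn_boundaryScat {P : Type*} [TopologicalSpace P]
    (Hs : EdgeHamiltonian H) {x : ℝ} {k : P → ℝ} {S : Set P}
    (hk : ContinuousOn k S) (h : ∀ p ∈ S, (x : ℂ) ∉ spectrum ℂ (H.op (k p))) :
    ContinuousOn (fun p => boundaryScat Hs x (k p)) S := by
  unfold boundaryScat scat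
  refine continuousOn_const.add (ContinuousOn.fun_const_smul ?_ _)
  refine continuousOn_const.mul (continuousOn_compress ?_
    (fun p hp => (isUnit_edge_real Hs (h p hp)).1) _)
  exact (((continuous_edge_op Hs).comp_continuousOn hk).sub continuousOn_const).sub
    continuousOn_const

theorem isFrameSection_frameSection (hgap : ∀ k : ℝ, (μ : ℂ) ∉ spectrum ℂ (H.op k))
    (hγ : IsFermiLoop H μ γ) : IsFrameSection H γ (frameSection H γ) := by
  have hpi := pi_pos
  have hx := hγ.notMem_spectrum_of_le (le_refl (γ 0).re)
  have hunion : Icc (-π) π ×ˢ (univ : Set ℝ) =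
      (Icc (-π) 0 ×ˢ (univ : Set ℝ)) ∪ (Icc 0 π ×ˢ (univ : Set ℝ)) := by
    rw [← union_prod, Icc_union_Icc_eq_Icc (by linarith) hpi.le]
  have hγ1 : ContinuousOn (fun p : ℝ × ℝ => γ p.1) (Icc (-π) π ×ˢ univ) :=
    hγ.continuousOn.comp continuousOn_fst fun p hp => hp.1
  refine ⟨?_, fun φ _ k => ?_, fun φ hφ k => ?_⟩
  · refine continuousOn_pi.2 fun j => continuousOn_pi.2 fun n => ?_
    rw [hunion]
    refine ContinuousOn.union_of_isClosed ?_ ?_ (isClosed_Icc.prod isClosed_univ)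
      (isClosed_Icc.prod isClosed_univ)
    · refine ContinuousOn.congr (f := fun p : ℝ × ℝ => decaySol H (-1) (γ p.1) p.2
        (act (boundaryScat (halfLine H) (γ 0).re p.2) (EuclideanSpace.single j 1)) n) ?_
        fun p hp => by
          simp only
          rw [frameSection_lower hgap hγ hp.1]
      refine continuousOn_decaySol (hγ1.mono ?_) continuousOn_snd ?_
        (fun p hp => hγ.isUnit_lower hgap hp.1 p.2) n
      · rw [hunion]
        exact subset_union_left
      · exact continuousOn_act (continuousOn_boundaryScat _ continuousOn_snd fun p _ => hx p.2)
          continuousOn_const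
    · refine ContinuousOn.congr (f := fun p : ℝ × ℝ => decaySol H 1 (γ p.1) p.2
        (EuclideanSpace.single j 1) n) ?_ fun p hp => by
          simp only
          rw [frameSection, if_pos hp.1.1]
      refine continuousOn_decaySol (hγ1.mono ?_) continuousOn_snd continuousOn_const
        (fun p hp => hγ.isUnit_upper hgap hp.1 p.2) n
      rw [hunion]
      exact subset_union_right
  · have hA := H.A_periodic k
    have hV := fun n => H.V_periodic n k
    have hab : ∀ s z, absorbing H s z (k + 2 * π) = absorbing H s z k := fun s z => by
      rw [absorbing, edge_op_periodic, absorbing]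
    have hhalf : ∀ s z c, decayHalf H s z (k + 2 * π) c = decayHalf H s z k c := fun s z c => by
      rw [decayHalf, hab, decayHalf]
    have hback : ∀ s z c m, decayBack H s z (k + 2 * π) c m = decayBack H s z k c m ∧
        decayBack H s z (k + 2 * π) c (m + 1) = decayBack H s z k c (m + 1) := by
      intro s z c m
      induction m with
      | zero => simp only [decayBack, hhalf, hA, and_self]
      | succ m ih =>
        refine ⟨ih.2, ?_⟩
        rw [decayBack, ih.1, ih.2, hA, hV, decayBack]
    have hsol : ∀ s z c, decaySol H s z (k + 2 * π) c = decaySol H s z k c := by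
      intro s z c
      funext n
      simp only [decaySol, hhalf, (hback s z c _).1]
    funext j
    simp only [frameSection, hsol, boundaryScat_periodic]
  · rcases le_total 0 φ with h | h
    · rw [isFrame_iff (hγ.isUnit_upper hgap ⟨h, hφ.2⟩ k),
        boundaryMatrix_frameSection_upper hgap hγ ⟨h, hφ.2⟩]
      refine ⟨fun j => ?_, by simp⟩
      rw [frameSection, if_pos h]
      exact (decaySol_spec (hγ.isUnit_upper hgap ⟨h, hφ.2⟩ k) _).1
    · rw [isFrame_iff (hγ.isUnit_lower hgap ⟨hφ.1, h⟩ k),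
        boundaryMatrix_frameSection_lower hgap hγ ⟨hφ.1, h⟩]
      refine ⟨fun j => ?_, boundaryScat_det_ne_zero _ (hx k)⟩
      rw [frameSection_lower hgap hγ ⟨hφ.1, h⟩]
      exact (decaySol_spec (hγ.isUnit_lower hgap ⟨hφ.1, h⟩ k) _).1

/-- The bulk index is the difference of the winding numbers of the boundary scattering matrix at
the two real points of the loop. -/
theorem isBulkIndex_iff (hgap : ∀ k : ℝ, (μ : ℂ) ∉ spectrum ℂ (H.op k))
    (hγ : IsFermiLoop H μ γ) {n n₀ : ℤ}
    (hn : HasWinding (fun k => (boundaryScat (halfLine H) μ k).det) n)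
    (hn₀ : HasWinding (fun k => (boundaryScat (halfLine H) (γ 0).re k).det) n₀) (m : ℤ) :
    IsBulkIndex H γ m ↔ m = n - n₀ := by
  have hpi := pi_pos
  constructor
  · rintro ⟨v, T, hv, hT, hm⟩
    exact winding_transition hgap hγ hn hn₀ hv hT hm
  · intro hm
    have hv := isFrameSection_frameSection hgap hγ
    have hx := hγ.notMem_spectrum_of_le (le_refl (γ 0).re)
    have hne : ∀ k, (boundaryScat (halfLine H) (γ 0).re k).det ≠ 0 := fun k =>
      boundaryScat_det_ne_zero _ (hx k)
    have mπ : π ∈ Icc (0 : ℝ) π := ⟨hpi.le, le_rfl⟩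
    have mπ' : -π ∈ Icc (-π) (0 : ℝ) := ⟨le_rfl, by linarith⟩
    set T : ℝ → Matrix (Fin N) (Fin N) ℂ := fun k =>
      (boundaryScat (halfLine H) (γ 0).re k)⁻¹ * boundaryScat (halfLine H) μ k with hTdef
    have hT : IsTransition (frameSection H γ) T := by
      intro k j
      have f1 : ∀ j, frameSection H γ π k j ∈ solutionSpace H μ k := fun j => by
        rw [← hγ.fermi]
        exact ((isFrame_iff (hγ.isUnit_upper hgap mπ k)).1
          (hv.frame π ⟨by linarith, le_rfl⟩ k)).1 j
      have f2 : ∀ j, frameSection H γ (-π) k j ∈ solutionSpace H μ k := fun j => by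
        rw [← hγ.at_neg_pi]
        exact ((isFrame_iff (hγ.isUnit_lower hgap mπ' k)).1
          (hv.frame (-π) ⟨le_rfl, by linarith⟩ k)).1 j
      have hu := hγ.isUnit_lower hgap mπ' k
      rw [hγ.at_neg_pi] at hu
      rw [← sub_eq_zero]
      refine eq_zero_of_boundaryValue hu (Submodule.sub_mem _ (f1 j)
        (Submodule.sum_mem _ fun i _ => Submodule.smul_mem _ _ (f2 i))) ?_
      have h1 := boundaryMatrix_neg_one (hgap k) f1
      rw [boundaryMatrix_frameSection_upper hgap hγ mπ, mul_one] at h1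
      have h2 := boundaryMatrix_transition H (-1) k (v := frameSection H γ (-π) k)
        (w := fun j => ∑ i, T k i j • frameSection H γ (-π) k i) (T := T k) fun j => rfl
      rw [boundaryMatrix_frameSection_lower hgap hγ mπ', hTdef,
        Matrix.mul_nonsing_inv_cancel_left _ _ (isUnit_iff_ne_zero.2 (hne k)), ← h1] at h2
      rw [map_sub, sub_eq_zero]
      ext i
      exact (congrFun (congrFun h2 i) j).symm
    have hc : ∀ x : ℝ, (∀ k : ℝ, (x : ℂ) ∉ spectrum ℂ (H.op k)) →
        Continuous fun k => (boundaryScat (halfLine H) x k).det := fun x hx =>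
      continuousOn_univ.1 (continuousOn_boundaryScat_det _ continuousOn_const continuousOn_id
        fun k _ => hx k)
    obtain ⟨m', hm'⟩ := exists_hasWinding (f := fun k => (T k).det) (by
        simp only [hTdef, Matrix.det_mul, Matrix.det_nonsing_inv, Ring.inverse_eq_inv']
        exact ((hc _ hx).inv₀ hne).mul (hc _ hgap))
      (fun k => by
        simp only [hTdef, Matrix.det_mul, Matrix.det_nonsing_inv, Ring.inverse_eq_inv']
        exact mul_ne_zero (inv_ne_zero (hne k)) (boundaryScat_det_ne_zero _ (hgap k)))
      (by simp only [hTdef, boundaryScat_two_pi])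
    have := winding_transition hgap hγ hn hn₀ hv hT hm'
    rw [hm, ← this]
    exact ⟨_, T, hv, hT, hm'⟩

end Loop

/-! ### Ordered eigenvalues of Hermitian matrices -/

section Weyl

variable {E : Type*} [NormedAddCommGroup E] [InnerProductSpace ℂ E] [FiniteDimensional ℂ E]

theorem re_inner_eq_sum_eigenvalues {T : E →ₗ[ℂ] E} (hT : T.IsSymmetric) {n : ℕ}
    (hn : Module.finrank ℂ E = n) (x : E) :
    (inner ℂ x (T x)).re =
      ∑ i, hT.eigenvalues hn i * ‖(hT.eigenvectorBasis hn).repr x i‖ ^ 2 := by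
  rw [← (hT.eigenvectorBasis hn).repr.inner_map_map x (T x), PiLp.inner_apply, Complex.re_sum]
  refine Finset.sum_congr rfl fun i _ => ?_
  rw [hT.eigenvectorBasis_apply_self_apply hn, RCLike.inner_apply, mul_assoc, Complex.mul_conj']
  rw [← Complex.ofReal_pow]
  exact Complex.re_ofReal_mul _ _

/-- **Weyl's inequality**: the decreasingly ordered eigenvalues are monotone and `1`-Lipschitz in
the quadratic form. -/
theorem eigenvalues_le_add {T T' : E →ₗ[ℂ] E} (hT : T.IsSymmetric) (hT' : T'.IsSymmetric) {n : ℕ}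
    (hn : Module.finrank ℂ E = n) {ε : ℝ}
    (h : ∀ x, (inner ℂ x (T x)).re ≤ (inner ℂ x (T' x)).re + ε * ‖x‖ ^ 2) (i : Fin n) :
    hT.eigenvalues hn i ≤ hT'.eigenvalues hn i + ε := by
  set b := hT.eigenvectorBasis hn
  set b' := hT'.eigenvectorBasis hn
  -- A nonzero vector in the span of the first `i + 1` eigenvectors of `T` and of the eigenvectors
  -- of `T'` from the `i`-th on.
  obtain ⟨x, hx0, hx1, hx2⟩ : ∃ x : E, x ≠ 0 ∧ (∀ j, i < j → b.repr x j = 0) ∧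
      (∀ j, j < i → b'.repr x j = 0) := by
    set f : E →ₗ[ℂ] (Fin n → ℂ) :=
      LinearMap.pi fun j => if j < i then (LinearMap.proj j).comp
          ((WithLp.linearEquiv 2 ℂ (Fin n → ℂ)).toLinearMap.comp b'.repr.toLinearEquiv.toLinearMap)
        else if i < j then (LinearMap.proj j).comp
          ((WithLp.linearEquiv 2 ℂ (Fin n → ℂ)).toLinearMap.comp b.repr.toLinearEquiv.toLinearMap)
        else 0 with hf
    have hni : ¬ Function.Injective f := by
      rw [LinearMap.injective_iff_surjective_of_finrank_eq_finrank (by simp [hn])]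
      intro hs
      obtain ⟨x, hx⟩ := hs (Pi.single i 1)
      have := congrFun hx i
      simp [hf] at this
    rw [← LinearMap.ker_eq_bot, Submodule.eq_bot_iff] at hni
    push Not at hni
    obtain ⟨x, hx, hx0⟩ := hni
    refine ⟨x, hx0, fun j hj => ?_, fun j hj => ?_⟩
    · have := congrFun (LinearMap.mem_ker.1 hx) j
      simpa [hf, hj, hj.not_gt] using this
    · have := congrFun (LinearMap.mem_ker.1 hx) j
      simpa [hf, hj] using this
  have hpos : 0 < ‖x‖ ^ 2 := by positivity
  have n1 : ∑ j, ‖b.repr x j‖ ^ 2 = ‖x‖ ^ 2 := by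
    rw [← EuclideanSpace.norm_sq_eq, LinearIsometryEquiv.norm_map]
  have n2 : ∑ j, ‖b'.repr x j‖ ^ 2 = ‖x‖ ^ 2 := by
    rw [← EuclideanSpace.norm_sq_eq, LinearIsometryEquiv.norm_map]
  have h1 : hT.eigenvalues hn i * ‖x‖ ^ 2 ≤ (inner ℂ x (T x)).re := by
    rw [re_inner_eq_sum_eigenvalues hT hn, ← n1, Finset.mul_sum]
    refine Finset.sum_le_sum fun j _ => ?_
    rcases le_or_gt j i with hj | hj
    · exact mul_le_mul_of_nonneg_right (hT.eigenvalues_antitone hn hj) (sq_nonneg _)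
    · simp [b, hx1 j hj]
  have h2 : (inner ℂ x (T' x)).re ≤ hT'.eigenvalues hn i * ‖x‖ ^ 2 := by
    rw [re_inner_eq_sum_eigenvalues hT' hn, ← n2, Finset.mul_sum]
    refine Finset.sum_le_sum fun j _ => ?_
    rcases le_or_gt i j with hj | hj
    · exact mul_le_mul_of_nonneg_right (hT'.eigenvalues_antitone hn hj) (sq_nonneg _)
    · simp [b', hx2 j hj]
  have h3 := h x
  have h4 : hT.eigenvalues hn i * ‖x‖ ^ 2 ≤ (hT'.eigenvalues hn i + ε) * ‖x‖ ^ 2 := by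
    rw [add_mul]
    linarith
  exact le_of_mul_le_mul_right h4 hpos

variable {d : ℕ}

theorem hermitian_eigenvalues_le_add {M M' : Matrix (Fin d) (Fin d) ℂ} (hM : M.IsHermitian)
    (hM' : M'.IsHermitian) {ε : ℝ}
    (h : ∀ c : Site d, (inner ℂ c (act M c)).re ≤ (inner ℂ c (act M' c)).re + ε * ‖c‖ ^ 2)
    (i : Fin d) : hM.eigenvalues i ≤ hM'.eigenvalues i + ε :=
  eigenvalues_le_add (Matrix.isSymmetric_toEuclideanLin_iff.mpr hM)
    (Matrix.isSymmetric_toEuclideanLin_iff.mpr hM') finrank_euclideanSpace h _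

/-- A Hermitian matrix has each eigenvalue with its geometric multiplicity. -/
theorem card_eigenvalues_eq {M : Matrix (Fin d) (Fin d) ℂ} (hM : M.IsHermitian) (x : ℝ) :
    Nat.card {i // hM.eigenvalues i = x} =
      Module.finrank ℂ (Module.End.eigenspace (act M) (x : ℂ)) := by
  have hT := Matrix.isSymmetric_toEuclideanLin_iff.mpr hM
  have h1 := hT.card_filter_eigenvalues_eq (finrank_euclideanSpace (𝕜 := ℂ) (ι := Fin d)) (x : ℂ)
  rw [← h1, ← Fintype.card_subtype, ← Nat.card_eq_fintype_card]
  refine Nat.card_congr ((Fintype.equivOfCardEq (Fintype.card_fin _)).symm.subtypeEquiv fun i => ?_)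
  change hM.eigenvalues i = x ↔ ((hM.eigenvalues i : ℝ) : ℂ) = x
  exact Complex.ofReal_inj.symm

theorem det_smul_one_add_smul {M : Matrix (Fin d) (Fin d) ℂ} (hM : M.IsHermitian) (α : ℂ) {β : ℂ}
    (hβ : β ≠ 0) : (α • (1 : Matrix (Fin d) (Fin d) ℂ) + β • M).det =
      ∏ i, (α + β * hM.eigenvalues i) := by
  have h1 : α • (1 : Matrix (Fin d) (Fin d) ℂ) + β • M =
      (-β) • (Matrix.scalar (Fin d) (-α / β) - M) := by
    rw [smul_sub, neg_smul, neg_smul, sub_neg_eq_add]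
    congr 1
    ext i j
    simp only [Matrix.smul_apply, Matrix.one_apply, Matrix.neg_apply, Matrix.scalar_apply,
      Matrix.diagonal_apply, smul_eq_mul]
    split_ifs
    · field_simp
    · simp
  have h2 : (Matrix.scalar (Fin d) (-α / β) - M).det = ∏ i, (-α / β - hM.eigenvalues i) := by
    rw [← Matrix.eval_charpoly, hM.charpoly_eq, Polynomial.eval_prod]
    simp
  rw [h1, Matrix.det_smul, h2, Fintype.card_fin]
  have h3 : (-β) ^ d = ∏ _i : Fin d, (-β) := by simp
  rw [h3, ← Finset.prod_mul_distrib]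
  refine Finset.prod_congr rfl fun i _ => ?_
  field_simp
  ring

end Weyl

/-! ### Roots of monotone families -/

/-- If `φ k y` is Lipschitz and strictly decreasing in `y`, at a rate bounded below, a root at
`(k₀, y₀)` persists for `k` near `k₀`. -/
theorem exists_root_of_strictAnti {φ : ℝ → ℝ → ℝ} {k₀ y₀ δ c C : ℝ} (hδ : 0 < δ) (hc : 0 < c)
    (hC : 0 ≤ C)
    (hmono : ∀ k y y', |k - k₀| < δ → |y - y₀| < δ → |y' - y₀| < δ → y ≤ y' →
      φ k y' ≤ φ k y - c * (y' - y))
    (hlip : ∀ k k' y y', |k - k₀| < δ → |k' - k₀| < δ → |y - y₀| < δ → |y' - y₀| < δ →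
      φ k y ≤ φ k' y' + C * (|k - k'| + |y - y'|))
    (h0 : φ k₀ y₀ = 0) :
    ∃ δ' > 0, δ' ≤ δ ∧ ∀ k, |k - k₀| < δ' → ∃ y, |y - y₀| < δ ∧ φ k y = 0 := by
  refine ⟨min δ (c * δ / (8 * (C + 1))), by positivity, min_le_left _ _, fun k hk => ?_⟩
  have hk1 := hk.trans_le (min_le_left _ _)
  have hk2 := hk.trans_le (min_le_right _ _)
  rw [lt_div_iff₀ (by positivity)] at hk2
  have hself : |k₀ - k₀| < δ := by simpa using hδ
  have hy0 : |y₀ - y₀| < δ := by simpa using hδ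
  have hm : ∀ y ∈ Icc (y₀ - δ / 2) (y₀ + δ / 2), |y - y₀| < δ := fun y hy => by
    rw [abs_lt]
    constructor <;> linarith [hy.1, hy.2]
  have hle : y₀ - δ / 2 ≤ y₀ + δ / 2 := by linarith
  have ha := hm _ (left_mem_Icc.2 hle)
  have hb := hm _ (right_mem_Icc.2 hle)
  have hkn : C * |k - k₀| ≤ c * δ / 8 := by nlinarith [abs_nonneg (k - k₀)]
  have h1 : 0 ≤ φ k (y₀ - δ / 2) := by
    have e1 := hmono k₀ (y₀ - δ / 2) y₀ hself ha hy0 (by linarith)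
    have e2 := hlip k₀ k (y₀ - δ / 2) (y₀ - δ / 2) hself hk1 ha ha
    rw [sub_self, abs_zero, add_zero, abs_sub_comm] at e2
    nlinarith
  have h2 : φ k (y₀ + δ / 2) ≤ 0 := by
    have e1 := hmono k₀ y₀ (y₀ + δ / 2) hself hy0 hb (by linarith)
    have e2 := hlip k k₀ (y₀ + δ / 2) (y₀ + δ / 2) hk1 hself hb hb
    rw [sub_self, abs_zero, add_zero] at e2
    nlinarith
  have hcont : ContinuousOn (φ k) (Icc (y₀ - δ / 2) (y₀ + δ / 2)) := by
    refine LipschitzOnWith.continuousOn (K := ⟨C, hC⟩)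
      (LipschitzOnWith.of_dist_le_mul fun y hy y' hy' => ?_)
    rw [Real.dist_eq, Real.dist_eq, abs_sub_le_iff]
    have e1 := hlip k k y y' hk1 hk1 (hm y hy) (hm y' hy')
    have e2 := hlip k k y' y hk1 hk1 (hm y' hy') (hm y hy)
    rw [abs_sub_comm y' y] at e2
    rw [sub_self, abs_zero, zero_add] at e1 e2
    change φ k y - φ k y' ≤ C * _ ∧ φ k y' - φ k y ≤ C * _
    constructor <;> linarith
  obtain ⟨y, hy, hy'⟩ := intermediate_value_Icc' hle hcont ⟨h2, h1⟩
  exact ⟨y, hm y hy, hy'⟩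

/-! ### Reduction of the eigenvalue problem to finite dimensions -/

section Reduction

variable {E : Type*} [NormedAddCommGroup E] [InnerProductSpace ℂ E] {d : ℕ}

/-- The linear combination `∑ a, c a • w a`. -/
noncomputable def synth (w : Fin d → E) (c : Site d) : E := ∑ a, c a • w a

/-- The coefficients `⟨w a, x⟩`; this is the adjoint of `synth w`. -/
noncomputable def coeffs (w : Fin d → E) : E →ₗ[ℂ] Site d where
  toFun x := WithLp.toLp 2 fun a => inner ℂ (w a) x
  map_add' x y := by
    ext a
    simp
  map_smul' c x := by
    ext a
    simp

theorem coeffs_apply (w : Fin d → E) (x : E) (a : Fin d) : coeffs w x a = inner ℂ (w a) x := rfl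

theorem finiteRank_eq_synth (w : Fin d → E) (x : E) :
    finiteRank (fun _ => ((1 : ℝ) : ℂ)) w x = synth w (coeffs w x) := by
  simp [finiteRank_apply, synth, coeffs_apply]

theorem inner_coeffs (w : Fin d → E) (c : Site d) (x : E) :
    inner ℂ c (coeffs w x) = inner ℂ (synth w c) x := by
  simp only [PiLp.inner_apply, coeffs_apply, synth, sum_inner, inner_smul_left, RCLike.inner_apply]
  exact Finset.sum_congr rfl fun a _ => mul_comm _ _

theorem norm_synth {w : Fin d → E} (hw : Orthonormal ℂ w) (c : Site d) : ‖synth w c‖ = ‖c‖ := by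
  have h : coeffs w (synth w c) = c := by
    ext a
    rw [coeffs_apply, synth, hw.inner_right_fintype]
  have h1 : inner ℂ (synth w c) (synth w c) = (inner ℂ c c : ℂ) := by
    rw [← inner_coeffs, h]
  rw [inner_self_eq_norm_sq_to_K, inner_self_eq_norm_sq_to_K] at h1
  have h2 : ‖synth w c‖ ^ 2 = ‖c‖ ^ 2 := by exact_mod_cast h1
  exact (sq_eq_sq₀ (norm_nonneg _) (norm_nonneg _)).1 h2

theorem act_compress (A : E →L[ℂ] E) (w : Fin d → E) (c : Site d) :
    act (compress A w) c = coeffs w (Ring.inverse A (synth w c)) := by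
  ext a
  have : act (compress A w) c a = ∑ b, compress A w a b * c b := by
    simp [act, Matrix.toLpLin_apply, Matrix.mulVec, dotProduct]
  rw [this, coeffs_apply, synth, map_sum, inner_sum]
  refine Finset.sum_congr rfl fun b _ => ?_
  rw [map_smul, inner_smul_right, compress, Matrix.of_apply, mul_comm]

theorem inner_act_compress (A : E →L[ℂ] E) (w : Fin d → E) (c : Site d) :
    inner ℂ c (act (compress A w) c) = inner ℂ (synth w c) (Ring.inverse A (synth w c)) := by
  rw [act_compress, inner_coeffs]

theorem isHermitian_compress {A : E →L[ℂ] E} (hA : ∀ x y, inner ℂ (A x) y = inner ℂ x (A y))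
    (w : Fin d → E) : (compress A w).IsHermitian := by
  by_cases hu : IsUnit A
  · have h1 : ∀ x, A (Ring.inverse A x) = x := fun x =>
      congrArg (fun T : E →L[ℂ] E => T x) (Ring.mul_inverse_cancel A hu)
    ext a b
    rw [Matrix.conjTranspose_apply, compress, Matrix.of_apply, Matrix.of_apply]
    change starRingEnd ℂ _ = _
    rw [inner_conj_symm]
    conv_lhs => rw [← h1 (w b)]
    rw [← hA, h1]
  · ext a b
    simp [compress, Ring.inverse_non_unit A hu]

/-- Adding a generic positive multiple of `Q = ∑ a, |w a⟩⟨w a|` makes `X` invertible. -/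
theorem exists_isUnit_add [CompleteSpace E] {X : E →L[ℂ] E}
    (hX : ∀ x y, inner ℂ (X x) y = inner ℂ x (X y)) (hp : IsProperOp X) {w : Fin d → E}
    (hker : ∀ x, X x = 0 → (∀ a, inner ℂ (w a) x = 0) → x = 0) :
    ∃ s : ℝ, 0 < s ∧ IsUnit (X + (s : ℂ) • finiteRank (fun _ => ((1 : ℝ) : ℂ)) w) := by
  have hu : IsUnit (X - Complex.I • finiteRank (fun _ => ((1 : ℝ) : ℂ)) w) := by
    have := isUnit_sub_I_finiteRank (q := fun _ => 1) (w := w) hX hp (fun _ => zero_le_one)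
      one_ne_zero fun x h1 h2 => hker x h1 fun a => h2 a one_ne_zero
    simpa using this
  set A := X - Complex.I • finiteRank (fun _ => ((1 : ℝ) : ℂ)) w with hA
  -- A vector in the kernel of `X + sQ` gives an eigenvector of the compression of `(X - iQ)⁻¹`, with
  -- the eigenvalue `-1 / (s + i)`. There are only finitely many eigenvalues.
  have hfin : {z | Module.End.HasEigenvalue (act (compress A w)) z}.Finite := by
    refine (Module.End.finite_spectrum (act (compress A w))).subset fun z hz => hz.mem_spectrum
  have hinf : ((fun s : ℝ => -1 / ((s : ℂ) + Complex.I)) '' Ioi 0).Infinite := by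
    refine (Ioi_infinite (0 : ℝ)).image fun s _ t _ hst => ?_
    have hs : (s : ℂ) + Complex.I ≠ 0 := fun h => by simpa using congrArg Complex.im h
    have ht : (t : ℂ) + Complex.I ≠ 0 := fun h => by simpa using congrArg Complex.im h
    have h2 : -1 / ((s : ℂ) + Complex.I) = -1 / ((t : ℂ) + Complex.I) := hst
    rw [div_eq_div_iff hs ht] at h2
    have := congrArg Complex.re h2
    simpa using this.symm
  obtain ⟨z, ⟨s, hs, rfl⟩, hz⟩ := (hinf.sdiff hfin).nonempty
  refine ⟨s, hs, ?_⟩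
  have hsI : (s : ℂ) + Complex.I ≠ 0 := fun h => by simpa using congrArg Complex.im h
  have hinj : ∀ x, (X + (s : ℂ) • finiteRank (fun _ => ((1 : ℝ) : ℂ)) w) x = 0 → x = 0 := by
    intro x hx
    have h1 : X x = -((s : ℂ) • synth w (coeffs w x)) := by
      rw [← finiteRank_eq_synth]
      simpa [add_eq_zero_iff_eq_neg] using hx
    have h2 : A x = -((s : ℂ) + Complex.I) • synth w (coeffs w x) := by
      rw [hA, _root_.sub_apply, _root_.smul_apply, finiteRank_eq_synth, h1, neg_smul, add_smul]
      abel
    have h3 : x = -((s : ℂ) + Complex.I) • Ring.inverse A (synth w (coeffs w x)) := by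
      rw [← map_smul, ← h2]
      exact (congrArg (fun T : E →L[ℂ] E => T x) (Ring.inverse_mul_cancel A hu)).symm
    have h4 : act (compress A w) (coeffs w x) = (-1 / ((s : ℂ) + Complex.I)) • coeffs w x := by
      have h5 : coeffs w x = -((s : ℂ) + Complex.I) • act (compress A w) (coeffs w x) := by
        conv_lhs => rw [h3]
        rw [map_smul, act_compress]
      conv_rhs => rw [h5]
      rw [smul_smul, div_mul_eq_mul_div, neg_one_mul, neg_neg, div_self hsI, one_smul]
    by_cases hc : coeffs w x = 0
    · refine hker x ?_ fun a => ?_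
      · rw [h1, hc]
        simp [synth]
      · rw [← coeffs_apply, hc]
        rfl
    · exact absurd (Module.End.hasEigenvalue_of_hasEigenvector
        ⟨Module.End.mem_eigenspace_iff.2 h4, hc⟩) hz
  have hprop : IsProperOp (X + (s : ℂ) • finiteRank (fun _ => ((1 : ℝ) : ℂ)) w) := by
    rw [finiteRank_smul]
    exact hp.add (isCompactOperator_finiteRank _ _)
  refine isUnit_of_isProperOp (fun x y => ?_) hprop hinj hinj
  simp only [_root_.add_apply, _root_.smul_apply, inner_add_left, inner_add_right, hX,
    inner_smul_left, inner_smul_right, inner_finiteRank_left]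
  simp

/-- If `X + sQ` is invertible, the kernel of `X` corresponds to the eigenspace for `1/s` of the
compression of `(X + sQ)⁻¹`. -/
theorem finrank_ker_eq {X : E →L[ℂ] E} {w : Fin d → E} {s : ℝ} (hs : s ≠ 0)
    (hu : IsUnit (X + (s : ℂ) • finiteRank (fun _ => ((1 : ℝ) : ℂ)) w)) :
    Module.finrank ℂ (LinearMap.ker (X : E →ₗ[ℂ] E)) =
      Module.finrank ℂ (Module.End.eigenspace
        (act (compress (X + (s : ℂ) • finiteRank (fun _ => ((1 : ℝ) : ℂ)) w) w))
        ((s⁻¹ : ℝ) : ℂ)) := by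
  set B := X + (s : ℂ) • finiteRank (fun _ => ((1 : ℝ) : ℂ)) w with hB
  have hs' : (s : ℂ) ≠ 0 := by exact_mod_cast hs
  have hGB : ∀ x, Ring.inverse B (B x) = x := fun x =>
    congrArg (fun T : E →L[ℂ] E => T x) (Ring.inverse_mul_cancel B hu)
  have hBG : ∀ x, B (Ring.inverse B x) = x := fun x =>
    congrArg (fun T : E →L[ℂ] E => T x) (Ring.mul_inverse_cancel B hu)
  have hBx : ∀ x, B x = X x + (s : ℂ) • synth w (coeffs w x) := fun x => by
    rw [← finiteRank_eq_synth]
    rfl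
  have hk : ∀ x, X x = 0 → x = (s : ℂ) • Ring.inverse B (synth w (coeffs w x)) := fun x hx => by
    conv_lhs => rw [← hGB x, hBx, hx, zero_add, map_smul]
  have hmem : ∀ x ∈ LinearMap.ker (X : E →ₗ[ℂ] E), coeffs w x ∈
      Module.End.eigenspace (act (compress B w)) ((s⁻¹ : ℝ) : ℂ) := by
    intro x hx
    rw [Module.End.mem_eigenspace_iff, act_compress]
    conv_rhs => rw [hk x hx, map_smul, smul_smul]
    rw [Complex.ofReal_inv, inv_mul_cancel₀ hs', one_smul]
  refine (LinearEquiv.ofBijective ((coeffs w).restrict hmem) ⟨?_, ?_⟩).finrank_eq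
  · rw [← LinearMap.ker_eq_bot, LinearMap.ker_eq_bot']
    rintro ⟨x, hx⟩ h
    have h1 : coeffs w x = 0 := congrArg Subtype.val h
    ext
    change x = 0
    rw [hk x hx, h1]
    simp [synth]
  · rintro ⟨c, hc⟩
    rw [Module.End.mem_eigenspace_iff, act_compress] at hc
    have h1 : coeffs w ((s : ℂ) • Ring.inverse B (synth w c)) = c := by
      rw [map_smul, hc, smul_smul, Complex.ofReal_inv, mul_inv_cancel₀ hs', one_smul]
    refine ⟨⟨(s : ℂ) • Ring.inverse B (synth w c), ?_⟩, Subtype.ext h1⟩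
    have h2 := hBx ((s : ℂ) • Ring.inverse B (synth w c))
    rw [h1, map_smul, hBG] at h2
    exact LinearMap.mem_ker.2 (by simpa using h2.symm)

/-- The scattering determinant is a product of factors of modulus one, one for each eigenvalue `ν` of
the compression of `(X + sQ)⁻¹`; the kernel of `X` corresponds to the factors with `1 - sν = 0`. -/
theorem det_scat_eq_prod {X : E →L[ℂ] E} {w : Fin d → E} {s q : ℝ}
    (hA : IsUnit (X - Complex.I • finiteRank (fun _ => (q : ℂ)) w))
    (hB : IsUnit (X + (s : ℂ) • finiteRank (fun _ => ((1 : ℝ) : ℂ)) w))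
    (hM : (compress (X + (s : ℂ) • finiteRank (fun _ => ((1 : ℝ) : ℂ)) w) w).IsHermitian) :
    (scat X (fun _ => q) w).det = ∏ i,
      (((1 - s * hM.eigenvalues i : ℝ) + (q * hM.eigenvalues i : ℝ) * Complex.I : ℂ) /
        ((1 - s * hM.eigenvalues i : ℝ) - (q * hM.eigenvalues i : ℝ) * Complex.I)) := by
  set β : ℂ := s + q * Complex.I with hβ
  set β' : ℂ := s - q * Complex.I with hβ'
  set A := X - Complex.I • finiteRank (fun _ => (q : ℂ)) w with hAdef
  set B := X + (s : ℂ) • finiteRank (fun _ => ((1 : ℝ) : ℂ)) w with hBdef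
  set M := compress B w with hMdef
  have hdiag : ∀ z : ℂ, Matrix.diagonal (fun _ : Fin d => z) = z • (1 : Matrix (Fin d) (Fin d) ℂ) :=
    fun z => by rw [Matrix.smul_one_eq_diagonal]
  have hdiff : B - A = finiteRank (fun _ => β) w := by
    have h1 : finiteRank (fun _ => β) w = (s : ℂ) • finiteRank (fun _ => ((1 : ℝ) : ℂ)) w +
        Complex.I • finiteRank (fun _ => (q : ℂ)) w := by
      simp only [finiteRank, Finset.smul_sum, smul_smul, ← Finset.sum_add_distrib, ← add_smul]
      refine Finset.sum_congr rfl fun a _ => ?_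
      rw [hβ, Complex.ofReal_one, mul_one, mul_comm (q : ℂ)]
    rw [h1, hBdef, hAdef]
    abel
  have e1 : compress A w - M = β • (compress A w * M) := by
    rw [compress_sub hA hB hdiff, hdiag, mul_smul_comm, mul_one, smul_mul_assoc]
  have e2 : M - compress A w = -(β • (M * compress A w)) := by
    rw [compress_sub hB hA (β := -fun _ => β) (w := w) (by
      rw [← neg_sub, hdiff, ← neg_one_smul ℂ, finiteRank_smul, neg_one_smul])]
    rw [show Matrix.diagonal (-fun _ : Fin d => β) = -(β • (1 : Matrix (Fin d) (Fin d) ℂ)) by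
      rw [← hdiag]
      exact (Matrix.diagonal_neg _).symm]
    rw [mul_neg, neg_mul, mul_smul_comm, mul_one, smul_mul_assoc]
  have e3 : (1 - β • M) * (1 + β • compress A w) = 1 := by
    have : (1 - β • M) * (1 + β • compress A w) =
        1 + β • (-(M - compress A w) - β • (M * compress A w)) := by
      simp only [sub_mul, mul_add, mul_one, one_mul, smul_mul_assoc, mul_smul_comm, smul_sub,
        smul_neg]
      abel
    rw [this, e2, neg_neg, sub_self, smul_zero, add_zero]
  have e4 : scat X (fun _ => q) w * (1 - β • M) = 1 - β' • M := by
    have h0 : scat X (fun _ => q) w = 1 + (2 * Complex.I * q) • compress A w := by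
      rw [scat, hdiag, smul_mul_assoc, one_mul, smul_smul]
    rw [h0]
    have : (1 + (2 * Complex.I * q) • compress A w) * (1 - β • M) =
        1 - β • M + (2 * Complex.I * q) • (compress A w - β • (compress A w * M)) := by
      simp only [add_mul, mul_sub, mul_one, one_mul, smul_mul_assoc, mul_smul_comm, smul_sub,
        smul_add, smul_comm β (2 * Complex.I * (q : ℂ))]
      abel
    rw [this, ← e1, sub_sub_cancel, hβ, hβ', sub_smul, add_smul,
      show (2 * Complex.I * (q : ℂ)) = q * Complex.I + q * Complex.I by ring, add_smul]
    abel
  have e5 : (1 - β • M).det ≠ 0 := fun h => by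
    have := congrArg Matrix.det e3
    rw [Matrix.det_mul, h, zero_mul, Matrix.det_one] at this
    exact zero_ne_one this
  have hdet : ∀ z : ℂ, (1 - z • M).det = ∏ i, (1 - z * hM.eigenvalues i) := by
    intro z
    rcases eq_or_ne z 0 with rfl | hz
    · simp
    · have := det_smul_one_add_smul hM 1 (neg_ne_zero.2 hz)
      rw [one_smul, neg_smul, ← sub_eq_add_neg] at this
      rw [this]
      exact Finset.prod_congr rfl fun i _ => by ring
  have e6 := congrArg Matrix.det e4
  rw [Matrix.det_mul, ← eq_div_iff e5, hdet, hdet, ← Finset.prod_div_distrib] at e6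
  rw [e6]
  refine Finset.prod_congr rfl fun i _ => ?_
  rw [hβ, hβ']
  push_cast
  congr 1 <;> ring

end Reduction

theorem orthonormal_siteVec : Orthonormal ℂ (siteVec (N := N)) := by
  rw [orthonormal_iff_ite]
  intro a b
  rw [inner_siteVec, siteVec, lp.single_apply_self, PiLp.single_apply]

theorem eigenspace_eq_ker {H : BulkHamiltonian N} (Hs : EdgeHamiltonian H) (k x : ℝ) :
    Hs.eigenspace k x = LinearMap.ker ((Hs.op k - (x : ℂ) • (1 : EdgeSpace N →L[ℂ] EdgeSpace N) :
      EdgeSpace N →L[ℂ] EdgeSpace N) : EdgeSpace N →ₗ[ℂ] EdgeSpace N) := by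
  ext ψ
  rw [EdgeHamiltonian.eigenspace, Module.End.mem_eigenspace_iff, LinearMap.mem_ker]
  change Hs.op k ψ = _ ↔ Hs.op k ψ - (x : ℂ) • ψ = 0
  exact sub_eq_zero.symm

section Abstract

variable {E : Type*} [NormedAddCommGroup E] [InnerProductSpace ℂ E] [CompleteSpace E] {d : ℕ}

/-- For a Lipschitz family of self-adjoint operators `T k` and a self-adjoint `P`, the ordered
eigenvalues of the compression of `(T k - y + P)⁻¹` are, where the inverse exists, strictly increasing
in `y` and Lipschitz. -/
theorem exists_window_compress {T : ℝ → E →L[ℂ] E} {P : E →L[ℂ] E} {L : ℝ} (hL0 : 0 ≤ L)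
    (hL : ∀ k k', ‖T k - T k'‖ ≤ L * |k - k'|) (hTc : Continuous T)
    {w : Fin d → E} (hw : Orthonormal ℂ w) {B : ℝ × ℝ → E →L[ℂ] E}
    (hB : ∀ p, B p = T p.1 - (p.2 : ℂ) • (1 : E →L[ℂ] E) + P)
    (hBs : ∀ p x y, inner ℂ (B p x) y = inner ℂ x (B p y))
    (hM : ∀ p, (compress (B p) w).IsHermitian)
    {k₀ y₀ : ℝ} (hu : IsUnit (B (k₀, y₀))) :
    ∃ δ > 0, ∃ c > 0, ∃ C ≥ 0,
      (∀ k y, |k - k₀| < δ → |y - y₀| < δ → IsUnit (B (k, y))) ∧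
      (∀ i k y y', |k - k₀| < δ → |y - y₀| < δ → |y' - y₀| < δ → y ≤ y' →
        (hM (k, y)).eigenvalues i ≤ (hM (k, y')).eigenvalues i + -(c * (y' - y))) ∧
      (∀ i k k' y y', |k - k₀| < δ → |k' - k₀| < δ → |y - y₀| < δ → |y' - y₀| < δ →
        (hM (k, y)).eigenvalues i ≤ (hM (k', y')).eigenvalues i + C * (|k - k'| + |y - y'|)) := by
  have hBc : Continuous B := by
    rw [funext hB]
    refine Continuous.add (Continuous.sub (hTc.comp continuous_fst) ?_) continuous_const
    exact (Complex.continuous_ofReal.comp continuous_snd).smul continuous_const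
  set G : ℝ × ℝ → E →L[ℂ] E := fun p => Ring.inverse (B p) with hG
  -- `κ` is a lower bound for the inverse of `B` at the centre of the window: `κ‖u‖ ≤ ‖B⁻¹u‖`.
  set κ : ℝ := (‖B (k₀, y₀)‖ + 1)⁻¹ with hκ
  have hκ0 : 0 < κ := by positivity
  have hBG : ∀ p, IsUnit (B p) → ∀ x, B p (G p x) = x := fun p hp x =>
    congrArg (fun T : E →L[ℂ] E => T x) (Ring.mul_inverse_cancel (B p) hp)
  -- A window on which `B` is invertible and its inverse is almost constant.
  obtain ⟨δ, hδ, hwin⟩ : ∃ δ > 0, ∀ k y, |k - k₀| < δ → |y - y₀| < δ →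
      IsUnit (B (k, y)) ∧ ‖G (k, y) - G (k₀, y₀)‖ < κ / 4 := by
    have h1 : ∀ᶠ p in 𝓝 (k₀, y₀), IsUnit (B p) :=
      hBc.continuousAt.eventually_mem (Units.isOpen.mem_nhds hu)
    have h2 : ContinuousAt G (k₀, y₀) := by
      obtain ⟨u, hu'⟩ := id hu
      have h3 := NormedRing.inverse_continuousAt u
      rw [hu'] at h3
      exact ContinuousAt.comp (f := B) h3 hBc.continuousAt
    have h3 : ∀ᶠ p in 𝓝 (k₀, y₀), ‖G p - G (k₀, y₀)‖ < κ / 4 := by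
      have := Metric.continuousAt_iff'.1 h2 (κ / 4) (by positivity)
      simpa only [dist_eq_norm] using this
    obtain ⟨δ, hδ, h4⟩ := Metric.eventually_nhds_iff.1 (h1.and h3)
    refine ⟨δ, hδ, fun k y hk hy' => h4 ?_⟩
    rw [Prod.dist_eq, Real.dist_eq, Real.dist_eq]
    exact max_lt hk hy'
  set g : ℝ := ‖G (k₀, y₀)‖ + κ / 4 with hg
  have hg0 : 0 ≤ g := by positivity
  have hGg : ∀ k y, |k - k₀| < δ → |y - y₀| < δ → ‖G (k, y)‖ ≤ g := by
    intro k y hk hy'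
    have h1 := norm_le_norm_add_norm_sub (G (k₀, y₀)) (G (k, y))
    rw [norm_sub_rev] at h1
    linarith [(hwin k y hk hy').2]
  have hres : ∀ k y k' y', |k - k₀| < δ → |y - y₀| < δ → |k' - k₀| < δ → |y' - y₀| < δ →
      G (k, y) - G (k', y') = G (k, y) * (B (k', y') - B (k, y)) * G (k', y') := by
    intro k y k' y' hk hy1 hk' hy2
    rw [mul_sub, sub_mul, Ring.inverse_mul_cancel _ (hwin k y hk hy1).1, mul_assoc,
      Ring.mul_inverse_cancel _ (hwin k' y' hk' hy2).1, mul_one, one_mul]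
  have hlow : ∀ k y, |k - k₀| < δ → |y - y₀| < δ → ∀ u, 3 / 4 * κ * ‖u‖ ≤ ‖G (k, y) u‖ := by
    intro k y hk hy1 u
    have h1 : κ * ‖u‖ ≤ ‖G (k₀, y₀) u‖ := by
      have h2 := (B (k₀, y₀)).le_opNorm (G (k₀, y₀) u)
      rw [hBG _ hu] at h2
      rw [hκ, inv_mul_le_iff₀ (by positivity)]
      nlinarith [norm_nonneg (G (k₀, y₀) u)]
    have h2 := ((G (k, y) - G (k₀, y₀)).le_opNorm u).trans
      (mul_le_mul_of_nonneg_right (hwin k y hk hy1).2.le (norm_nonneg u))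
    rw [_root_.sub_apply] at h2
    have h3 := norm_le_norm_add_norm_sub (G (k, y) u) (G (k₀, y₀) u)
    linarith
  -- By the resolvent identity `⟨u, (G(y') - G(y)) u⟩ = (y' - y) ⟨G(y') u, G(y) u⟩`, and the scalar
  -- product is positive since both vectors are close to `G(k₀, y₀) u`.
  have hmono : ∀ i k y y', |k - k₀| < δ → |y - y₀| < δ → |y' - y₀| < δ → y ≤ y' →
      (hM (k, y)).eigenvalues i ≤ (hM (k, y')).eigenvalues i + -(3 / 16 * κ ^ 2 * (y' - y)) := by
    intro i k y y' hk hy1 hy2 hle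
    refine hermitian_eigenvalues_le_add _ _ (fun v => ?_) i
    rw [inner_act_compress, inner_act_compress, ← norm_synth hw v]
    set u := synth w v
    have h1 : G (k, y') u = G (k, y) u + ((y' - y : ℝ) : ℂ) • G (k, y') (G (k, y) u) := by
      have h2 : B (k, y) - B (k, y') = ((y' - y : ℝ) : ℂ) • 1 := by
        rw [hB, hB, Complex.ofReal_sub, sub_smul]
        abel
      have h3 := hres k y' k y hk hy2 hk hy1
      rw [h2, mul_smul_comm, mul_one, smul_mul_assoc, sub_eq_iff_eq_add'] at h3
      exact congrArg (fun T : E →L[ℂ] E => T u) h3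
    have hGs : ∀ x z, inner ℂ x (G (k, y') z) = inner ℂ (G (k, y') x) z := by
      intro x z
      conv_lhs => rw [← hBG (k, y') (hwin k y' hk hy2).1 x, hBs, hBG _ (hwin k y' hk hy2).1]
    change (inner ℂ u (G (k, y) u)).re ≤ (inner ℂ u (G (k, y') u)).re + _
    rw [h1, inner_add_right, inner_smul_right, Complex.add_re, Complex.re_ofReal_mul, hGs]
    have h4 : 3 / 16 * κ ^ 2 * ‖u‖ ^ 2 ≤ (inner ℂ (G (k, y') u) (G (k, y) u)).re := by
      set a := G (k, y) u
      set b := G (k, y') u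
      have h5 : ‖b - a‖ ≤ κ / 2 * ‖u‖ := by
        have h6 : ‖G (k, y') - G (k, y)‖ ≤ κ / 2 := by
          have h7 := norm_sub_le_norm_sub_add_norm_sub (G (k, y')) (G (k₀, y₀)) (G (k, y))
          rw [norm_sub_rev (G (k₀, y₀))] at h7
          linarith [(hwin k y hk hy1).2, (hwin k y' hk hy2).2]
        exact ((G (k, y') - G (k, y)).le_opNorm u).trans
          (mul_le_mul_of_nonneg_right h6 (norm_nonneg u))
      have h6 : (inner ℂ b a).re = ‖a‖ ^ 2 + (inner ℂ (b - a) a).re := by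
        have h7 := inner_self_eq_norm_sq (𝕜 := ℂ) a
        change (inner ℂ a a : ℂ).re = _ at h7
        rw [inner_sub_left, Complex.sub_re, h7]
        ring
      have h7 : -(‖b - a‖ * ‖a‖) ≤ (inner ℂ (b - a) a).re := by
        have := (Complex.abs_re_le_norm (inner ℂ (b - a) a)).trans (norm_inner_le_norm _ _)
        linarith [neg_abs_le (inner ℂ (b - a) a : ℂ).re]
      have h8 := hlow k y hk hy1 u
      rw [h6]
      have h9 : 0 ≤ κ * ‖u‖ := by positivity
      change 3 / 4 * κ * ‖u‖ ≤ ‖a‖ at h8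
      nlinarith [mul_le_mul_of_nonneg_right h5 (norm_nonneg a), norm_nonneg a]
    nlinarith [mul_le_mul_of_nonneg_left h4 (sub_nonneg.2 hle)]
  have hlip : ∀ i k k' y y', |k - k₀| < δ → |k' - k₀| < δ → |y - y₀| < δ → |y' - y₀| < δ →
      (hM (k, y)).eigenvalues i ≤
        (hM (k', y')).eigenvalues i + g ^ 2 * (L + 1) * (|k - k'| + |y - y'|) := by
    intro i k k' y y' hk hk' hy1 hy2
    refine hermitian_eigenvalues_le_add _ _ (fun v => ?_) i
    rw [inner_act_compress, inner_act_compress, ← norm_synth hw v]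
    set u := synth w v
    have h1 : ‖B (k', y') - B (k, y)‖ ≤ (L + 1) * (|k - k'| + |y - y'|) := by
      have h2 : B (k', y') - B (k, y) = (T k' - T k) + ((y - y' : ℝ) : ℂ) • 1 := by
        rw [hB, hB, Complex.ofReal_sub, sub_smul]
        abel
      have h3 : ‖((y - y' : ℝ) : ℂ) • (1 : E →L[ℂ] E)‖ ≤ |y - y'| := by
        rw [norm_smul, Complex.norm_real, Real.norm_eq_abs]
        exact mul_le_of_le_one_right (abs_nonneg _) ContinuousLinearMap.norm_id_le
      have h4 := hL k' k
      rw [abs_sub_comm k'] at h4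
      rw [h2]
      refine (norm_add_le _ _).trans ?_
      nlinarith [abs_nonneg (k - k'), abs_nonneg (y - y')]
    have h2 : ‖G (k, y) - G (k', y')‖ ≤ g ^ 2 * (L + 1) * (|k - k'| + |y - y'|) := by
      rw [hres k y k' y' hk hy1 hk' hy2]
      calc _ ≤ ‖G (k, y)‖ * ‖B (k', y') - B (k, y)‖ * ‖G (k', y')‖ :=
            (norm_mul_le _ _).trans (mul_le_mul_of_nonneg_right (norm_mul_le _ _) (norm_nonneg _))
        _ ≤ g * ((L + 1) * (|k - k'| + |y - y'|)) * g := by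
            gcongr
            · exact hGg k y hk hy1
            · exact hGg k' y' hk' hy2
        _ = _ := by ring
    have h3 : (inner ℂ u (G (k, y) u)).re - (inner ℂ u (G (k', y') u)).re ≤
        ‖G (k, y) - G (k', y')‖ * ‖u‖ ^ 2 := by
      rw [← Complex.sub_re, ← inner_sub_right]
      refine (Complex.re_le_norm _).trans ((norm_inner_le_norm _ _).trans ?_)
      have := (G (k, y) - G (k', y')).le_opNorm u
      rw [_root_.sub_apply] at this
      nlinarith [norm_nonneg u]
    have h4 := mul_le_mul_of_nonneg_right h2 (sq_nonneg ‖u‖)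
    change (inner ℂ u (G (k, y) u)).re ≤ (inner ℂ u (G (k', y') u)).re + _
    linarith
  exact ⟨δ, hδ, 3 / 16 * κ ^ 2, by positivity, g ^ 2 * (L + 1), by positivity,
    fun k y hk hy1 => (hwin k y hk hy1).1, hmono, hlip⟩

end Abstract

/-- Near a point outside the bulk spectrum, the eigenvalue equation for `H♯(k)` at energy `y` is
equivalent to the vanishing of one of `N` real functions `φ k y i`, which are Lipschitz and strictly
decreasing in the energy. They also determine the scattering matrix of `q` times the projection onto
the first site. -/
theorem exists_local_reduction {H : BulkHamiltonian N} (Hs : EdgeHamiltonian H) {k₀ y₀ : ℝ}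
    (hy : (y₀ : ℂ) ∉ spectrum ℂ (H.op k₀)) :
    ∃ s > 0, ∃ δ > 0, ∃ c > 0, ∃ C ≥ 0, ∃ φ : ℝ → ℝ → Fin N → ℝ,
      (∀ i k y y', |k - k₀| < δ → |y - y₀| < δ → |y' - y₀| < δ → y ≤ y' →
        φ k y' i ≤ φ k y i - c * (y' - y)) ∧
      (∀ i k k' y y', |k - k₀| < δ → |k' - k₀| < δ → |y - y₀| < δ → |y' - y₀| < δ →
        φ k y i ≤ φ k' y' i + C * (|k - k'| + |y - y'|)) ∧
      (∀ k y, |k - k₀| < δ → |y - y₀| < δ →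
        Module.finrank ℂ (Hs.eigenspace k y) = Nat.card {i // φ k y i = 0}) ∧
      (∀ k y, |k - k₀| < δ → |y - y₀| < δ → ∀ q : ℝ,
        IsUnit (Hs.op k - (y : ℂ) • (1 : EdgeSpace N →L[ℂ] EdgeSpace N) -
          Complex.I • finiteRank (fun _ => (q : ℂ)) siteVec) →
        (scat (Hs.op k - (y : ℂ) • (1 : EdgeSpace N →L[ℂ] EdgeSpace N)) (fun _ => q) siteVec).det =
          ∏ i, ((φ k y i : ℂ) + (q * ((1 - φ k y i) / s) : ℝ) * Complex.I) /
            ((φ k y i : ℂ) - (q * ((1 - φ k y i) / s) : ℝ) * Complex.I)) := by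
  obtain ⟨s, hs, hu⟩ := exists_isUnit_add (inner_edge_op_sub Hs k₀ y₀) (isProperOp_edge Hs hy)
    (w := siteVec) (fun x hx h => eq_zero_of_siteVec Hs hx h)
  obtain ⟨L, hL0, hL⟩ := exists_lipschitz_edge_op Hs
  obtain ⟨B, hB⟩ : ∃ B : ℝ × ℝ → EdgeSpace N →L[ℂ] EdgeSpace N, ∀ p, B p =
      Hs.op p.1 - (p.2 : ℂ) • (1 : EdgeSpace N →L[ℂ] EdgeSpace N) +
        (s : ℂ) • finiteRank (fun _ => ((1 : ℝ) : ℂ)) siteVec := ⟨_, fun _ => rfl⟩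
  have hBs : ∀ p x y, inner ℂ (B p x) y = inner ℂ x (B p y) := by
    intro p x y
    rw [hB, _root_.add_apply, _root_.add_apply, inner_add_left, inner_add_right, inner_edge_op_sub,
      _root_.smul_apply, _root_.smul_apply, inner_smul_left, inner_smul_right,
      inner_finiteRank_left]
    simp only [Complex.conj_ofReal]
  have hM : ∀ p, (compress (B p) siteVec).IsHermitian := fun p => isHermitian_compress (hBs p) _
  rw [← hB (k₀, y₀)] at hu
  obtain ⟨δ, hδ, c, hc, C, hC, hwin, hmono, hlip⟩ := exists_window_compress hL0 hL
    (continuous_edge_op Hs) orthonormal_siteVec hB hBs hM hu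
  -- The energy `y` is an eigenvalue exactly when the compressed inverse has the eigenvalue `1 / s`.
  refine ⟨s, hs, δ, hδ, s * c, by positivity, s * C, by positivity,
    fun k y i => 1 - s * (hM (k, y)).eigenvalues i, ?_, ?_, ?_, ?_⟩
  · intro i k y y' hk hy1 hy2 hle
    have := mul_le_mul_of_nonneg_left (hmono i k y y' hk hy1 hy2 hle) hs.le
    linarith
  · intro i k k' y y' hk hk' hy1 hy2
    have := mul_le_mul_of_nonneg_left (hlip i k' k y' y hk' hk hy2 hy1) hs.le
    rw [abs_sub_comm k', abs_sub_comm y'] at this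
    linarith
  · intro k y hk hy1
    have h1 := hwin k y hk hy1
    have h2 := card_eigenvalues_eq (hM (k, y)) s⁻¹
    rw [hB] at h1
    rw [eigenspace_eq_ker, finrank_ker_eq hs.ne' h1, ← hB (k, y), ← h2]
    refine Nat.card_congr (Equiv.subtypeEquivRight fun i => ?_)
    beta_reduce
    refine ⟨fun h => by rw [h, mul_inv_cancel₀ hs.ne', sub_self], fun h => ?_⟩
    field_simp
    linarith
  · intro k y hk hy1 q hq
    have h1 := hwin k y hk hy1
    have h2 := hM (k, y)
    have h3 := hB (k, y)
    simp only at h3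
    rw [h3] at h1
    have h4 := det_scat_eq_prod hq h1 (h3 ▸ hM (k, y))
    rw [h4]
    refine Finset.prod_congr rfl fun i _ => ?_
    simp only [← h3]
    rw [sub_sub_cancel, mul_div_cancel_left₀ _ hs.ne']

/-! ### Eigenvalue branches of the edge Hamiltonian -/

/-- The implicit function theorem for Lipschitz functions `φ k y` strictly decreasing in `y`: near
`(k₀, y₀)` the zero set is the graph of a Lipschitz function `e`, and `φ` is negative above it. -/
theorem exists_branch_of_strictAnti {φ : ℝ → ℝ → ℝ} {k₀ y₀ δ c C : ℝ} (hδ : 0 < δ) (hc : 0 < c)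
    (hC : 0 ≤ C)
    (hmono : ∀ k y y', |k - k₀| < δ → |y - y₀| < δ → |y' - y₀| < δ → y ≤ y' →
      φ k y' ≤ φ k y - c * (y' - y))
    (hlip : ∀ k k' y y', |k - k₀| < δ → |k' - k₀| < δ → |y - y₀| < δ → |y' - y₀| < δ →
      φ k y ≤ φ k' y' + C * (|k - k'| + |y - y'|))
    (h0 : φ k₀ y₀ = 0) :
    ∃ δ' > 0, ∃ e : ℝ → ℝ, e k₀ = y₀ ∧ (∃ K, LipschitzOnWith K e {k | |k - k₀| < δ'}) ∧
      ∀ k y, |k - k₀| < δ' → |y - y₀| < δ → (φ k y = 0 ↔ e k = y) ∧ (φ k y < 0 ↔ e k < y) := by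
  obtain ⟨δ', hδ', hle, h⟩ := exists_root_of_strictAnti hδ hc hC hmono hlip h0
  choose! e he using h
  have hiff : ∀ k y, |k - k₀| < δ' → |y - y₀| < δ →
      (φ k y = 0 ↔ e k = y) ∧ (φ k y < 0 ↔ e k < y) := by
    intro k y hk hy
    obtain ⟨h1, h2⟩ := he k hk
    rcases lt_trichotomy (e k) y with h3 | h3 | h3
    · have := hmono k _ _ (hk.trans_le hle) h1 hy h3.le
      have h4 : φ k y < 0 := by nlinarith
      exact ⟨⟨fun h => absurd h h4.ne, fun h => absurd h h3.ne⟩, fun _ => h3, fun _ => h4⟩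
    · subst h3
      exact ⟨⟨fun _ => rfl, fun _ => h2⟩, fun h => absurd h2 h.ne, fun h => absurd h (lt_irrefl _)⟩
    · have := hmono k _ _ (hk.trans_le hle) hy h1 h3.le
      have h4 : 0 < φ k y := by nlinarith
      exact ⟨⟨fun h => absurd h h4.ne', fun h => absurd h h3.ne'⟩, fun h => absurd h h4.not_gt,
        fun h => absurd h h3.not_gt⟩
  refine ⟨δ', hδ', e, ?_, ⟨(C / c).toNNReal, ?_⟩, hiff⟩
  · exact (hiff k₀ y₀ (by simpa using hδ') (by simpa using hδ)).1.1 h0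
  · have key : ∀ k k', |k - k₀| < δ' → |k' - k₀| < δ' → e k' - e k ≤ C / c * |k - k'| := by
      intro k k' hk hk'
      rcases le_total (e k') (e k) with h | h
      · have : 0 ≤ C / c * |k - k'| := by positivity
        linarith
      · obtain ⟨h1, h2⟩ := he k hk
        obtain ⟨h3, h4⟩ := he k' hk'
        have h5 := hmono k _ _ (hk.trans_le hle) h1 h3 h
        have h6 := hlip k' k (e k') (e k') (hk'.trans_le hle) (hk.trans_le hle) h3 h3
        rw [sub_self, abs_zero, add_zero, abs_sub_comm] at h6
        rw [div_mul_eq_mul_div, le_div_iff₀ hc]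
        linarith
    refine LipschitzOnWith.of_dist_le_mul fun k hk k' hk' => ?_
    rw [Real.dist_eq, Real.dist_eq, Real.coe_toNNReal _ (by positivity), abs_sub_le_iff]
    refine ⟨?_, key k k' hk hk'⟩
    rw [abs_sub_comm]
    exact key k' k hk' hk

/-- Near a point `(k₀, y₀)` outside the bulk spectrum the eigenvalues of the edge Hamiltonian are
given by finitely many Lipschitz branches `e j` through `(k₀, y₀)`. At the energy `y₀`, the scattering
matrix of `q` times the projection onto the first site is expressed through functions `φ k i`, and
the number of negative ones differs from the number of branches below `y₀` by a constant. -/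
theorem exists_local_branches {H : BulkHamiltonian N} (Hs : EdgeHamiltonian H) {k₀ y₀ : ℝ}
    (hy : (y₀ : ℂ) ∉ spectrum ℂ (H.op k₀)) :
    ∃ ρ > 0, ∃ (m : ℕ) (e : Fin m → ℝ → ℝ),
      (∀ j, e j k₀ = y₀ ∧ ∃ K, LipschitzOnWith K (e j) {k | |k - k₀| < ρ}) ∧
      (∀ k y, |k - k₀| < ρ → |y - y₀| < ρ →
        Module.finrank ℂ (Hs.eigenspace k y) = Nat.card {j // e j k = y}) ∧
      ∃ s > 0, ∃ φ : ℝ → Fin N → ℝ,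
        (∀ i, ContinuousOn (fun k => φ k i) {k | |k - k₀| < ρ}) ∧
        (∀ k, |k - k₀| < ρ →
          Module.finrank ℂ (Hs.eigenspace k y₀) = Nat.card {i // φ k i = 0}) ∧
        (∃ n₀ : ℤ, ∀ k, |k - k₀| < ρ → (∑ i, if φ k i < 0 then (1 : ℤ) else 0) =
          n₀ + ∑ j, if e j k < y₀ then (1 : ℤ) else 0) ∧
        ∀ k, |k - k₀| < ρ → ∀ q : ℝ,
          IsUnit (Hs.op k - (y₀ : ℂ) • (1 : EdgeSpace N →L[ℂ] EdgeSpace N) -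
            Complex.I • finiteRank (fun _ => (q : ℂ)) siteVec) →
          (scat (Hs.op k - (y₀ : ℂ) • (1 : EdgeSpace N →L[ℂ] EdgeSpace N)) (fun _ => q)
            siteVec).det =
            ∏ i, ((φ k i : ℂ) + (q * ((1 - φ k i) / s) : ℝ) * Complex.I) /
              ((φ k i : ℂ) - (q * ((1 - φ k i) / s) : ℝ) * Complex.I) := by
  obtain ⟨s, hs, δ, hδ, c, hc, C, hC, φ, hmono, hlip, hcard, hdet⟩ := exists_local_reduction Hs hy
  have hy0 : |y₀ - y₀| < δ := by simpa using hδ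
  have hk0 : |k₀ - k₀| < δ := by simpa using hδ
  have hroot := fun j : {i // φ k₀ y₀ i = 0} =>
    exists_branch_of_strictAnti (φ := fun k y => φ k y j) hδ hc hC (hmono j) (hlip j) j.2
  choose δ' hδ' e he0 heL he using hroot
  -- On a smaller window the functions not vanishing at the centre keep their sign.
  obtain ⟨ρ, hρ, hρδ, hρδ', hρφ⟩ : ∃ ρ > 0, ρ < δ ∧ (∀ j, ρ < δ' j) ∧
      ∀ i, φ k₀ y₀ i ≠ 0 → C * (2 * ρ) < |φ k₀ y₀ i| := by
    have h1 : ∀ i, ∀ᶠ ρ in 𝓝[>] (0 : ℝ), φ k₀ y₀ i ≠ 0 → C * (2 * ρ) < |φ k₀ y₀ i| := by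
      intro i
      by_cases h : φ k₀ y₀ i = 0
      · exact Eventually.of_forall fun _ h' => absurd h h'
      · have : Tendsto (fun ρ : ℝ => C * (2 * ρ)) (𝓝[>] 0) (𝓝 (C * (2 * 0))) :=
          ((continuous_const.mul (continuous_const.mul continuous_id)).tendsto _).mono_left
            nhdsWithin_le_nhds
        rw [mul_zero, mul_zero] at this
        filter_upwards [this.eventually_lt_const (abs_pos.2 h)] with ρ hρ _ using hρ
    have h2 : ∀ η : ℝ, 0 < η → ∀ᶠ ρ in 𝓝[>] (0 : ℝ), ρ < η := fun η hη =>
      nhdsWithin_le_nhds (Iio_mem_nhds hη)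
    have h0 : ∀ᶠ ρ in 𝓝[>] (0 : ℝ), 0 < ρ := self_mem_nhdsWithin
    obtain ⟨ρ, h3, h4, h5, h6⟩ := (h0.and ((h2 δ hδ).and
      ((eventually_all.2 fun j => h2 (δ' j) (hδ' j)).and (eventually_all.2 h1)))).exists
    exact ⟨ρ, h3, h4, h5, h6⟩
  have hsign : ∀ i, φ k₀ y₀ i ≠ 0 → ∀ k y, |k - k₀| < ρ → |y - y₀| < ρ →
      φ k y i ≠ 0 ∧ (φ k y i < 0 ↔ φ k₀ y₀ i < 0) := by
    intro i hi k y hk hy'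
    have h1 := hlip i k k₀ y y₀ (hk.trans hρδ) hk0 (hy'.trans hρδ) hy0
    have h2 := hlip i k₀ k y₀ y hk0 (hk.trans hρδ) hy0 (hy'.trans hρδ)
    rw [abs_sub_comm k₀, abs_sub_comm y₀] at h2
    have h3 : C * (|k - k₀| + |y - y₀|) ≤ C * (2 * ρ) :=
      mul_le_mul_of_nonneg_left (by linarith) hC
    have h4 := hρφ i hi
    rcases hi.lt_or_gt with h | h
    · rw [abs_of_neg h] at h4
      have : φ k y i < 0 := by linarith
      exact ⟨this.ne, iff_of_true this h⟩
    · rw [abs_of_pos h] at h4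
      have : 0 < φ k y i := by linarith
      exact ⟨this.ne', iff_of_false this.not_gt h.not_gt⟩
  set σ := (Fintype.equivFin {i // φ k₀ y₀ i = 0}).symm with hσ
  refine ⟨ρ, hρ, _, fun j => e (σ j), fun j => ⟨he0 _, ?_⟩, fun k y hk hy' => ?_, s, hs,
    fun k i => φ k y₀ i, fun i => ?_, fun k hk => hcard k y₀ (hk.trans hρδ) hy0,
    ⟨∑ i : {i // ¬ φ k₀ y₀ i = 0}, if φ k₀ y₀ i < 0 then (1 : ℤ) else 0, fun k hk => ?_⟩,
    fun k hk q hq => hdet k y₀ (hk.trans hρδ) hy0 q hq⟩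
  · obtain ⟨K, hK⟩ := heL (σ j)
    exact ⟨K, hK.mono fun k hk => lt_trans hk (hρδ' _)⟩
  · rw [hcard k y (hk.trans hρδ) (hy'.trans hρδ)]
    have h1 : ∀ {i}, φ k y i = 0 → φ k₀ y₀ i = 0 := fun {i} h => by
      by_contra h'
      exact (hsign i h' k y hk hy').1 h
    refine Nat.card_congr ((Equiv.subtypeSubtypeEquivSubtype h1).symm.trans
      (σ.subtypeEquiv fun j => ?_).symm)
    exact (he (σ j) k y (hk.trans (hρδ' _)) (hy'.trans hρδ)).1.symm
  · refine (LipschitzOnWith.of_dist_le_mul (K := C.toNNReal) fun k hk k' hk' => ?_).continuousOn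
    have h1 := hlip i k k' y₀ y₀ (lt_trans hk hρδ) (lt_trans hk' hρδ) hy0 hy0
    have h2 := hlip i k' k y₀ y₀ (lt_trans hk' hρδ) (lt_trans hk hρδ) hy0 hy0
    rw [sub_self, abs_zero, add_zero] at h1 h2
    rw [abs_sub_comm] at h2
    rw [Real.dist_eq, Real.dist_eq, Real.coe_toNNReal _ hC, abs_sub_le_iff]
    constructor <;> linarith
  · rw [← Fintype.sum_subtype_add_sum_subtype (fun i => φ k₀ y₀ i = 0), add_comm]
    have hy1 : |y₀ - y₀| < ρ := by simpa using hρ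
    congr 1
    · refine Finset.sum_congr rfl fun i _ => ?_
      simp only [(hsign i i.2 k y₀ hk hy1).2]
    · rw [← σ.sum_comp]
      refine Finset.sum_congr rfl fun j _ => ?_
      simp only [(he (σ j) k y₀ (hk.trans (hρδ' _)) hy0).2]

/-! ### Generic energies -/

/-- The critical values of a Lipschitz function, including its values at the points where it is not
differentiable, form a null set, by the theorems of Rademacher and Sard. -/
theorem volume_critical_values {e : ℝ → ℝ} {W : Set ℝ} (hW : IsOpen W) {K : NNReal}
    (he : LipschitzOnWith K e W) :
    MeasureTheory.volume (e '' {k ∈ W | ¬ (DifferentiableAt ℝ e k ∧ deriv e k ≠ 0)}) = 0 := by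
  have h1 : {k ∈ W | ¬ (DifferentiableAt ℝ e k ∧ deriv e k ≠ 0)} ⊆
      {k ∈ W | ¬ DifferentiableAt ℝ e k} ∪ {k ∈ W | DifferentiableAt ℝ e k ∧ deriv e k = 0} := by
    rintro k ⟨hk, h⟩
    by_cases hd : DifferentiableAt ℝ e k
    · refine Or.inr ⟨hk, hd, ?_⟩
      by_contra h'
      exact h ⟨hd, h'⟩
    · exact Or.inl ⟨hk, hd⟩
  refine MeasureTheory.measure_mono_null (image_mono h1) ?_
  rw [image_union, MeasureTheory.measure_union_null_iff]
  constructor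
  · have h2 : MeasureTheory.volume {k ∈ W | ¬ DifferentiableAt ℝ e k} = 0 := by
      have := he.ae_differentiableWithinAt_of_mem_real
      rw [MeasureTheory.ae_iff] at this
      refine MeasureTheory.measure_mono_null ?_ this
      rintro k ⟨hk, hd⟩ h
      exact hd ((h hk).differentiableAt (hW.mem_nhds hk))
    have h3 := (he.mono (sep_subset _ _)).hausdorffMeasure_image_le
      (s := {k ∈ W | ¬ DifferentiableAt ℝ e k}) zero_le_one
    rw [MeasureTheory.hausdorffMeasure_real, h2, mul_zero] at h3
    exact le_antisymm h3 zero_le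
  · refine MeasureTheory.addHaar_image_eq_zero_of_det_fderivWithin_eq_zero _
      (f' := fun _ => ContinuousLinearMap.toSpanSingleton ℝ (0 : ℝ)) ?_ ?_
    · rintro k ⟨hk, hd, h0⟩
      have := hd.hasDerivAt
      rw [h0] at this
      exact this.hasFDerivAt.hasFDerivWithinAt
    · intro k _
      simp [ContinuousLinearMap.det]

theorem eigenspace_ne_bot_iff {H : BulkHamiltonian N} (Hs : EdgeHamiltonian H) {k x : ℝ}
    (hx : (x : ℂ) ∉ spectrum ℂ (H.op k)) :
    Hs.eigenspace k x ≠ ⊥ ↔ Module.finrank ℂ (Hs.eigenspace k x) ≠ 0 := by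
  have := (isProperOp_edge Hs hx).finiteDimensional_ker
  rw [← eigenspace_eq_ker] at this
  rw [not_iff_not, Submodule.finrank_eq_zero]

/-- If `x` is not a critical value of the local branches `e` at `k`, those which pass through `(k, x)`
are the eigenvalue branches there, and `x` is not an eigenvalue for nearby momenta other than `k`. -/
theorem isEdgeBranches_of_noncritical {H : BulkHamiltonian N} {Hs : EdgeHamiltonian H}
    {k₀ y₀ ρ : ℝ} {m : ℕ} {e : Fin m → ℝ → ℝ}
    (he : ∀ j, ∃ K, LipschitzOnWith K (e j) {k | |k - k₀| < ρ})
    (hcard : ∀ k y, |k - k₀| < ρ → |y - y₀| < ρ →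
      Module.finrank ℂ (Hs.eigenspace k y) = Nat.card {j // e j k = y})
    {k x : ℝ} (hk : |k - k₀| < ρ) (hxy : |x - y₀| < ρ)
    (hnc : ∀ j, e j k = x → DifferentiableAt ℝ (e j) k ∧ deriv (e j) k ≠ 0) :
    (∃ (m' : ℕ) (ε : Fin m' → ℝ → ℝ), IsEdgeBranches Hs x k ε ∧ ∀ i, deriv (ε i) k ≠ 0) ∧
      ∀ᶠ κ in 𝓝[≠] k, Module.finrank ℂ (Hs.eigenspace κ x) = 0 := by
  have hW : IsOpen {k | |k - k₀| < ρ} :=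
    isOpen_lt (continuous_abs.comp (continuous_id.sub continuous_const)) continuous_const
  have hcont : ∀ j, ∀ κ, |κ - k₀| < ρ → ContinuousAt (e j) κ := fun j κ hκ => by
    obtain ⟨K, hK⟩ := he j
    exact hK.continuousOn.continuousAt (hW.mem_nhds hκ)
  have hWev : ∀ᶠ κ in 𝓝 k, |κ - k₀| < ρ := hW.mem_nhds hk
  constructor
  · set σ := (Fintype.equivFin {j // e j k = x}).symm with hσ
    refine ⟨_, fun i => e (σ i), ⟨fun i => ⟨(σ i).2, (hnc _ (σ i).2).1, ?_⟩, ?_⟩,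
      fun i => (hnc _ (σ i).2).2⟩
    · filter_upwards [hWev] with κ hκ using hcont _ κ hκ
    -- Near `(k, x)` only the branches through this point matter.
    have h1 : ∀ᶠ p in 𝓝 (k, x), (|p.1 - k₀| < ρ ∧ |p.2 - y₀| < ρ) ∧
        ∀ j, e j k ≠ x → e j p.1 ≠ p.2 := by
      refine ((hWev.prod_inl_nhds x).and ?_).and (eventually_all.2 fun j => ?_)
      · refine Eventually.prod_inr_nhds (p := fun y => |y - y₀| < ρ) ?_ k
        exact (isOpen_lt (continuous_abs.comp (continuous_id.sub continuous_const))
          continuous_const).mem_nhds hxy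
      · by_cases hj : e j k = x
        · exact Eventually.of_forall fun _ h => absurd hj h
        · have h2 : ContinuousAt (fun p : ℝ × ℝ => e j p.1) (k, x) :=
            ContinuousAt.comp (f := Prod.fst) (hcont j k hk) continuousAt_fst
          filter_upwards [(h2.sub continuousAt_snd).eventually_ne (sub_ne_zero.2 hj)] with p hp _
            using sub_ne_zero.1 hp
    obtain ⟨δ, hδ, h2⟩ := Metric.eventually_nhds_iff.1 h1
    refine ⟨δ, hδ, fun κ hκ y hy => ?_⟩
    obtain ⟨⟨h3, h4⟩, h5⟩ := @h2 (κ, y) (by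
      rw [Prod.dist_eq, Real.dist_eq, Real.dist_eq]
      exact max_lt hκ hy)
    rw [hcard κ y h3 h4]
    have h6 : ∀ {j}, e j κ = y → e j k = x := fun {j} h => by
      by_contra h'
      exact h5 j h' h
    exact Nat.card_congr ((Equiv.subtypeSubtypeEquivSubtype h6).symm.trans
      (σ.subtypeEquiv fun j => Iff.rfl).symm)
  · have h1 : ∀ᶠ κ in 𝓝[≠] k, ∀ j, e j κ ≠ x := by
      refine eventually_all.2 fun j => ?_
      by_cases hj : e j k = x
      · have h2 := (hnc j hj).1.hasDerivAt.eventually_ne (c := x) (hnc j hj).2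
        exact h2
      · exact nhdsWithin_le_nhds ((hcont j k hk).eventually_ne hj)
    filter_upwards [h1, nhdsWithin_le_nhds hWev] with κ h2 h3
    rw [hcard κ x h3 hxy, Nat.card_eq_zero]
    exact Or.inl ⟨fun ⟨j, hj⟩ => h2 j hj⟩

/-- For almost every energy in a gap, the edge eigenvalues cross this energy at finitely many points
and with non-zero slopes. -/
theorem exists_isSignedCrossingNumber {H : BulkHamiltonian N} (Hs : EdgeHamiltonian H) {a b : ℝ}
    (hab : a < b) (hgap : ∀ k : ℝ, ∀ x ∈ Icc a b, (x : ℂ) ∉ spectrum ℂ (H.op k)) :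
    ∃ x ∈ Icc a b, ∃ m, IsSignedCrossingNumber Hs x m := by
  have hloc : ∀ p : ℝ × ℝ, ∃ ρ > 0, ∃ (m : ℕ) (e : Fin m → ℝ → ℝ), p.2 ∈ Icc a b →
      (∀ j, ∃ K, LipschitzOnWith K (e j) {k | |k - p.1| < ρ}) ∧
      (∀ k y, |k - p.1| < ρ → |y - p.2| < ρ →
        Module.finrank ℂ (Hs.eigenspace k y) = Nat.card {j // e j k = y}) := by
    intro p
    by_cases hp : p.2 ∈ Icc a b
    · obtain ⟨ρ, hρ, m, e, h1, h2, -⟩ := exists_local_branches Hs (hgap p.1 p.2 hp)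
      exact ⟨ρ, hρ, m, e, fun _ => ⟨fun j => (h1 j).2, h2⟩⟩
    · exact ⟨1, one_pos, 0, fun j => j.elim0, fun h => absurd h hp⟩
  choose ρ hρ m e hloc using hloc
  have hopen : ∀ (c r : ℝ), IsOpen {k | |k - c| < r} := fun c r =>
    isOpen_lt (continuous_abs.comp (continuous_id.sub continuous_const)) continuous_const
  obtain ⟨t, ht, hcov⟩ := (isCompact_Icc.prod isCompact_Icc :
    IsCompact (Icc (0 : ℝ) (2 * π) ×ˢ Icc a b)).elim_nhds_subcover
      (fun p => {k | |k - p.1| < ρ p} ×ˢ {y | |y - p.2| < ρ p}) fun p _ =>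
        prod_mem_nhds ((hopen _ _).mem_nhds (by simpa using hρ p))
          ((hopen _ _).mem_nhds (by simpa using hρ p))
  -- The critical values of the finitely many branches which cover the gap.
  set bad : Set ℝ := ⋃ p ∈ t, ⋃ j, e p j '' {k ∈ {k | |k - p.1| < ρ p} |
    ¬ (DifferentiableAt ℝ (e p j) k ∧ deriv (e p j) k ≠ 0)} with hbad
  have hnull : MeasureTheory.volume bad = 0 := by
    refine (MeasureTheory.measure_biUnion_null_iff t.countable_toSet).2 fun p hp => ?_
    rw [MeasureTheory.measure_iUnion_null_iff]
    intro j
    obtain ⟨K, hK⟩ := (hloc p (ht p hp).2).1 j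
    exact volume_critical_values (hopen _ _) hK
  obtain ⟨x, hx, hxb⟩ : (Icc a b \ bad).Nonempty := by
    refine MeasureTheory.nonempty_of_measure_ne_zero (μ := MeasureTheory.volume) ?_
    rw [MeasureTheory.measure_sdiff_null hnull, Real.volume_Icc]
    simpa using hab
  have hkey : ∀ k ∈ Icc 0 (2 * π),
      (∃ (m' : ℕ) (ε : Fin m' → ℝ → ℝ), IsEdgeBranches Hs x k ε ∧ ∀ i, deriv (ε i) k ≠ 0) ∧
      ∀ᶠ κ in 𝓝[≠] k, Module.finrank ℂ (Hs.eigenspace κ x) = 0 := by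
    intro k hk
    obtain ⟨p, hp, hkx⟩ := mem_iUnion₂.1 (hcov (mk_mem_prod hk hx))
    refine isEdgeBranches_of_noncritical (hloc p (ht p hp).2).1 (hloc p (ht p hp).2).2 hkx.1 hkx.2
      fun j hj => ?_
    by_contra h
    exact hxb (mem_iUnion₂.2 ⟨p, hp, mem_iUnion.2 ⟨j, k, ⟨hkx.1, h⟩, hj⟩⟩)
  have hfin : {k | k ∈ Ico 0 (2 * π) ∧ Hs.eigenspace k x ≠ ⊥}.Finite := by
    obtain ⟨t', -, hcov'⟩ := (isCompact_Icc : IsCompact (Icc (0 : ℝ) (2 * π))).elim_nhds_subcover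
      (fun k => {κ | κ ≠ k → Module.finrank ℂ (Hs.eigenspace κ x) = 0})
      fun k hk => by
        filter_upwards [eventually_nhdsWithin_iff.1 (hkey k hk).2] with κ h1 h2 using h1 h2
    refine t'.finite_toSet.subset fun κ ⟨hκ, hne⟩ => ?_
    obtain ⟨k, hk, hκk⟩ := mem_iUnion₂.1 (hcov' (Ico_subset_Icc_self hκ))
    have : κ = k := by
      by_contra h
      exact (eigenspace_ne_bot_iff Hs (hgap κ x hx)).1 hne (hκk h)
    exact this ▸ hk
  have hbr : ∀ k, ∃ (m' : ℕ) (ε : Fin m' → ℝ → ℝ), k ∈ hfin.toFinset →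
      IsEdgeBranches Hs x k ε ∧ ∀ i, deriv (ε i) k ≠ 0 := by
    intro k
    by_cases hk : k ∈ hfin.toFinset
    · obtain ⟨m', ε, h⟩ := (hkey k (Ico_subset_Icc_self ((hfin.mem_toFinset.1 hk).1))).1
      exact ⟨m', ε, fun _ => h⟩
    · exact ⟨0, fun j => j.elim0, fun h => absurd h hk⟩
  choose d ε hε using hbr
  exact ⟨x, hx, _, hfin.toFinset, d, ε, fun k => hfin.mem_toFinset, hε, rfl⟩

/-! ### The phase of a single crossing -/

/-- A continuous logarithm of `(φ + ia) / (φ - ia)` on the plane of the points `(a, φ)` cut along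
`φ = 0, a ≤ 0`. -/
noncomputable def phase (a φ : ℝ) : ℂ :=
  2 * (Complex.arg (a - φ * Complex.I) : ℂ) * Complex.I + π * Complex.I

theorem exp_phase {a φ : ℝ} (h : 0 < a ∨ φ ≠ 0) :
    Complex.exp (phase a φ) = (φ + a * Complex.I) / (φ - a * Complex.I) := by
  set z : ℂ := a - φ * Complex.I with hz
  have hz0 : z ≠ 0 := by
    intro h0
    have h1 : a = 0 := by simpa [hz] using congrArg Complex.re h0
    have h2 : φ = 0 := by simpa [hz] using congrArg Complex.im h0
    rcases h with h | h
    · exact h.ne' h1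
    · exact h h2
  have h1 : (‖z‖ : ℂ) * Complex.exp (Complex.arg z * Complex.I) = z := Complex.norm_mul_exp_arg_mul_I z
  have hn : (‖z‖ : ℂ) ≠ 0 := by
    exact_mod_cast norm_ne_zero_iff.2 hz0
  have h2 : z * (a + φ * Complex.I) = (‖z‖ : ℂ) ^ 2 := by
    rw [← Complex.mul_conj']
    congr 1
    simp [hz]
  have h3 : (a + φ * Complex.I : ℂ) ≠ 0 := fun h => by
    rw [h, mul_zero] at h2
    exact hn (pow_eq_zero_iff two_ne_zero |>.1 h2.symm)
  have h4 : (φ - a * Complex.I : ℂ) = -Complex.I * (a + φ * Complex.I) := by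
    linear_combination (φ : ℂ) * Complex.I_sq
  have h5 : (φ + a * Complex.I : ℂ) = Complex.I * z := by
    rw [hz]
    linear_combination (φ : ℂ) * Complex.I_sq
  have h6 : Complex.exp (Complex.arg z * Complex.I) = z / ‖z‖ := by
    rw [eq_div_iff hn, mul_comm, h1]
  rw [phase, ← hz, Complex.exp_add, Complex.exp_pi_mul_I, mul_assoc, two_mul, Complex.exp_add, h6,
    h4, h5, div_mul_div_comm, ← sq, ← sq (‖z‖ : ℂ), ← h2]
  have hI := Complex.I_ne_zero
  field_simp

/-- On the line `a = 0` the phase distinguishes the two sides of the cut. -/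
theorem phase_zero {φ : ℝ} (h : φ ≠ 0) :
    phase 0 φ = (if φ < 0 then (1 : ℤ) else 0 : ℤ) * (2 * π * Complex.I) := by
  rcases h.lt_or_gt with h | h
  · have : ((0 : ℝ) - φ * Complex.I : ℂ) = ((-φ : ℝ) : ℂ) * Complex.I := by
      push_cast
      ring
    rw [phase, this, Complex.arg_real_mul _ (by linarith), Complex.arg_I, if_pos h]
    push_cast
    ring
  · have : ((0 : ℝ) - φ * Complex.I : ℂ) = (φ : ℂ) * -Complex.I := by
      push_cast
      ring
    rw [phase, this, Complex.arg_real_mul _ h, Complex.arg_neg_I, if_neg h.not_gt]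
    push_cast
    ring

theorem continuousOn_phase {P : Type*} [TopologicalSpace P] {a φ : P → ℝ} {S : Set P}
    (ha : ContinuousOn a S) (hφ : ContinuousOn φ S) (h : ∀ p ∈ S, 0 < a p ∨ φ p ≠ 0) :
    ContinuousOn (fun p => phase (a p) (φ p)) S := by
  have h1 : ContinuousOn (fun p => (a p : ℂ) - φ p * Complex.I) S :=
    (Complex.continuous_ofReal.comp_continuousOn ha).sub
      ((Complex.continuous_ofReal.comp_continuousOn hφ).mul continuousOn_const)
  have h2 : ContinuousOn (fun p => Complex.arg ((a p : ℂ) - φ p * Complex.I)) S := by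
    intro p hp
    refine ContinuousAt.comp_continuousWithinAt (g := Complex.arg) (Complex.continuousAt_arg ?_)
      (h1 p hp)
    rw [Complex.mem_slitPlane_iff]
    simpa using h p hp
  unfold phase
  exact ((continuousOn_const.mul (Complex.continuous_ofReal.comp_continuousOn h2)).mul
    continuousOn_const).add continuousOn_const

/-! ### Counting branches -/

/-- Families with the same values and multiplicities have the same sums. -/
theorem sum_eq_of_card_fiber_eq {m m' : ℕ} {f : Fin m → ℝ} {g : Fin m' → ℝ}
    (h : ∀ y, Nat.card {i // f i = y} = Nat.card {j // g j = y}) (F : ℝ → ℤ) :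
    ∑ i, F (f i) = ∑ j, F (g j) := by
  have e : ∀ y, {i // f i = y} ≃ {j // g j = y} := fun y =>
    (Finite.card_eq.1 (h y)).some
  rw [← (Equiv.ofFiberEquiv e).sum_comp]
  exact Finset.sum_congr rfl fun i _ => congrArg F (Equiv.ofFiberEquiv_map e i).symm

/-- A branch with non-zero slope is on opposite sides of the level before and after the crossing. -/
theorem eventually_lt_iff_deriv {ε : ℝ → ℝ} {k₀ x : ℝ} (h0 : ε k₀ = x)
    (hd : DifferentiableAt ℝ ε k₀) (hne : deriv ε k₀ ≠ 0) :
    (∀ᶠ κ in 𝓝[>] k₀, ε κ ≠ x ∧ (ε κ < x ↔ deriv ε k₀ < 0)) ∧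
      ∀ᶠ κ in 𝓝[<] k₀, ε κ ≠ x ∧ (ε κ < x ↔ 0 < deriv ε k₀) := by
  have h1 : ∀ᶠ κ in 𝓝[≠] k₀, 0 < slope ε k₀ κ * deriv ε k₀ := by
    have h2 := (hasDerivAt_iff_tendsto_slope.1 hd.hasDerivAt).mul_const (deriv ε k₀)
    exact h2.eventually_const_lt (mul_self_pos.2 hne)
  have h2 : ∀ κ, κ ≠ k₀ → 0 < slope ε k₀ κ * deriv ε k₀ →
      0 < (κ - k₀) * (ε κ - x) * deriv ε k₀ := by
    intro κ hκ h
    have h3 : (κ - k₀) * (ε κ - x) * deriv ε k₀ = (κ - k₀) ^ 2 * (slope ε k₀ κ * deriv ε k₀) := by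
      rw [slope_def_field, h0]
      field_simp [sub_ne_zero.2 hκ]
    rw [h3]
    have := sub_ne_zero.2 hκ
    positivity
  constructor
  · have h3 : ∀ᶠ κ in 𝓝[>] k₀, k₀ < κ := self_mem_nhdsWithin
    filter_upwards [h3, nhdsGT_le_nhdsNE k₀ h1] with κ h4 h5
    have h6 := h2 κ h4.ne' h5
    have h7 : 0 < κ - k₀ := sub_pos.2 h4
    rw [mul_assoc, mul_pos_iff_of_pos_left h7] at h6
    rcases mul_pos_iff.1 h6 with ⟨h8, h9⟩ | ⟨h8, h9⟩
    · exact ⟨(sub_pos.1 h8).ne', iff_of_false (sub_pos.1 h8).not_gt h9.not_gt⟩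
    · exact ⟨(sub_neg.1 h8).ne, iff_of_true (sub_neg.1 h8) h9⟩
  · have h3 : ∀ᶠ κ in 𝓝[<] k₀, κ < k₀ := self_mem_nhdsWithin
    filter_upwards [h3, nhdsLT_le_nhdsNE k₀ h1] with κ h4 h5
    have h6 := h2 κ h4.ne h5
    have h7 : κ - k₀ < 0 := sub_neg.2 h4
    rw [mul_assoc, mul_pos_iff] at h6
    rcases h6 with ⟨h8, _⟩ | ⟨_, h6⟩
    · exact absurd h8 h7.not_gt
    rcases mul_neg_iff.1 h6 with ⟨h8, h9⟩ | ⟨h8, h9⟩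
    · exact ⟨(sub_pos.1 h8).ne', iff_of_false (sub_pos.1 h8).not_gt h9.not_gt⟩
    · exact ⟨(sub_neg.1 h8).ne, iff_of_true (sub_neg.1 h8) h9⟩

/-- Two descriptions of the eigenvalues near `(k₀, x)` have the same number of branches below
`x`. -/
theorem eventually_count_eq {n : ℝ → ℝ → ℕ} {k₀ x δ : ℝ} (hδ : 0 < δ) {m m' : ℕ}
    {ε : Fin m → ℝ → ℝ} {e : Fin m' → ℝ → ℝ}
    (hε : ∀ i, ε i k₀ = x ∧ ContinuousAt (ε i) k₀) (he : ∀ j, e j k₀ = x ∧ ContinuousAt (e j) k₀)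
    (h1 : ∀ k y, |k - k₀| < δ → |y - x| < δ → n k y = Nat.card {i // ε i k = y})
    (h2 : ∀ k y, |k - k₀| < δ → |y - x| < δ → n k y = Nat.card {j // e j k = y}) :
    ∀ᶠ κ in 𝓝 k₀, (∑ i, if ε i κ < x then (1 : ℤ) else 0) = ∑ j, if e j κ < x then (1 : ℤ) else 0 := by
  have hc : ∀ f : ℝ → ℝ, f k₀ = x → ContinuousAt f k₀ → ∀ᶠ κ in 𝓝 k₀, |f κ - x| < δ := by
    intro f hf hfc
    have := Metric.continuousAt_iff'.1 hfc δ hδ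
    rwa [hf] at this
  have h0 : ∀ᶠ κ in 𝓝 k₀, |κ - k₀| < δ := by
    filter_upwards [Metric.ball_mem_nhds k₀ hδ] with κ h
    rwa [Metric.mem_ball, Real.dist_eq] at h
  filter_upwards [h0, eventually_all.2 fun i => hc (ε i) (hε i).1 (hε i).2,
    eventually_all.2 fun j => hc (e j) (he j).1 (he j).2] with κ h3 h4 h5
  refine sum_eq_of_card_fiber_eq (f := fun i => ε i κ) (g := fun j => e j κ) (fun y => ?_)
    fun y => if y < x then 1 else 0
  by_cases hy : |y - x| < δ
  · rw [← h1 κ y h3 hy, ← h2 κ y h3 hy]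
  · rw [Nat.card_eq_zero.2 (Or.inl ⟨fun ⟨i, hi⟩ => hy (hi ▸ h4 i)⟩),
      Nat.card_eq_zero.2 (Or.inl ⟨fun ⟨j, hj⟩ => hy (hj ▸ h5 j)⟩)]

/-! ### Winding number and signed crossings -/

/-- The weight `q` of the projection onto the first site may vanish where `x` is not an edge
eigenvalue. -/
theorem isUnit_edge_weight {H : BulkHamiltonian N} (Hs : EdgeHamiltonian H) {k x q : ℝ}
    (hx : (x : ℂ) ∉ spectrum ℂ (H.op k)) (hq : 0 ≤ q)
    (h0 : q = 0 → Module.finrank ℂ (Hs.eigenspace k x) = 0) :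
    IsUnit (Hs.op k - (x : ℂ) • (1 : EdgeSpace N →L[ℂ] EdgeSpace N) -
      Complex.I • finiteRank (fun _ => (q : ℂ)) siteVec) ∧
    IsUnit (Hs.op k - (x : ℂ) • (1 : EdgeSpace N →L[ℂ] EdgeSpace N) +
      Complex.I • finiteRank (fun _ => (q : ℂ)) siteVec) := by
  have key : ∀ s : ℝ, s ≠ 0 → _ := fun s hs =>
    isUnit_sub_I_finiteRank (q := fun _ => q) (w := siteVec) (inner_edge_op_sub Hs k x)
      (isProperOp_edge Hs hx) (fun _ => hq) hs fun ψ h1 h2 => by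
        by_cases hq0 : q = 0
        · have h3 : Hs.eigenspace k x = ⊥ := by
            by_contra h
            exact (eigenspace_ne_bot_iff Hs hx).1 h (h0 hq0)
          rw [eigenspace_eq_ker] at h3
          exact (Submodule.eq_bot_iff _).1 h3 ψ h1
        · exact eq_zero_of_siteVec Hs h1 fun a => h2 a hq0
  have h1 := key 1 one_ne_zero
  have h2 := key (-1) (by norm_num)
  rw [Complex.ofReal_one, one_mul] at h1
  rw [Complex.ofReal_neg, Complex.ofReal_one, neg_one_mul, neg_smul, sub_neg_eq_add] at h2
  exact ⟨h1, h2⟩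

theorem scat_zero {E ι : Type*} [NormedAddCommGroup E] [InnerProductSpace ℂ E] [Fintype ι]
    [DecidableEq ι] (X : E →L[ℂ] E) (w : ι → E) : scat X (fun _ => 0) w = 1 := by
  simp [scat]

/-- The determinant of the scattering matrix of `χ` times the projection onto the first site,
where the weight `χ` is supported near `k₀`. -/
noncomputable def tentDet {H : BulkHamiltonian N} (Hs : EdgeHamiltonian H) (x k₀ r κ : ℝ) : ℂ :=
  (scat (Hs.op κ - (x : ℂ) • (1 : EdgeSpace N →L[ℂ] EdgeSpace N))
    (fun _ => max 0 (r - |κ - k₀|)) siteVec).det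

theorem tentDet_of_le {H : BulkHamiltonian N} (Hs : EdgeHamiltonian H) {x k₀ r κ : ℝ}
    (h : r ≤ |κ - k₀|) : tentDet Hs x k₀ r κ = 1 := by
  rw [tentDet, max_eq_left (by linarith), scat_zero, Matrix.det_one]

/-- The phase of the scattering determinant localized at a crossing changes by `2πi` times the
number of signed crossings. -/
theorem eventually_hasIncrement_tentDet {H : BulkHamiltonian N} (Hs : EdgeHamiltonian H) {x k₀ : ℝ}
    (hx : ∀ k : ℝ, (x : ℂ) ∉ spectrum ℂ (H.op k)) {m : ℕ} {ε : Fin m → ℝ → ℝ}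
    (hε : IsEdgeBranches Hs x k₀ ε) (hd : ∀ i, deriv (ε i) k₀ ≠ 0) :
    ∀ᶠ r in 𝓝[>] (0 : ℝ), ∀ c d, c ≤ k₀ - r → k₀ + r ≤ d →
      HasIncrement (tentDet Hs x k₀ r) c d
        ((∑ i, -((SignType.sign (deriv (ε i) k₀) : SignType) : ℤ) : ℤ) *
          (2 * π * Complex.I)) := by
  obtain ⟨ρ, hρ, m', e, he, hcard, s, hs, φ, hφc, hφcard, ⟨n₀, hn₀⟩, hdet⟩ :=
    exists_local_branches Hs (hx k₀)
  obtain ⟨h1, δ, hδ, h2⟩ := hε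
  have hopen : IsOpen {k | |k - k₀| < ρ} :=
    isOpen_lt (continuous_abs.comp (continuous_id.sub continuous_const)) continuous_const
  have hk₀ : {k | |k - k₀| < ρ} ∈ 𝓝 k₀ := hopen.mem_nhds (by simpa using hρ)
  have hcnt := eventually_count_eq (n := fun k y => Module.finrank ℂ (Hs.eigenspace k y))
    (lt_min hδ hρ) (fun i => ⟨(h1 i).1, (h1 i).2.1.continuousAt⟩)
    (fun j => ⟨(he j).1, by
      obtain ⟨K, hK⟩ := (he j).2
      exact hK.continuousOn.continuousAt hk₀⟩)
    (fun k y hk hy => h2 k (hk.trans_le (min_le_left _ _)) y (hy.trans_le (min_le_left _ _)))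
    (fun k y hk hy => hcard k y (hk.trans_le (min_le_right _ _)) (hy.trans_le (min_le_right _ _)))
  have hzero : ∀ κ, |κ - k₀| < δ → (∀ i, ε i κ ≠ x) →
      Module.finrank ℂ (Hs.eigenspace κ x) = 0 := fun κ hκ h => by
    rw [h2 κ hκ x (by simpa using hδ), Nat.card_eq_zero]
    exact Or.inl ⟨fun ⟨i, hi⟩ => h i hi⟩
  have hδ' : ∀ᶠ κ in 𝓝 k₀, |κ - k₀| < δ := by
    filter_upwards [Metric.ball_mem_nhds k₀ hδ] with κ h
    rwa [Metric.mem_ball, Real.dist_eq] at h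
  -- To the right of the crossing the decreasing branches are below the level, to the left the
  -- increasing ones.
  have hright : ∀ᶠ κ in 𝓝[>] k₀, Module.finrank ℂ (Hs.eigenspace κ x) = 0 ∧
      (∑ i, if φ κ i < 0 then (1 : ℤ) else 0) =
        n₀ + ∑ i, if deriv (ε i) k₀ < 0 then (1 : ℤ) else 0 := by
    filter_upwards [nhdsWithin_le_nhds hcnt, nhdsWithin_le_nhds hk₀, nhdsWithin_le_nhds hδ',
      eventually_all.2 fun i => (eventually_lt_iff_deriv (h1 i).1 (h1 i).2.1 (hd i)).1]
      with κ h3 h4 h5 h6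
    refine ⟨hzero κ h5 fun i => (h6 i).1, ?_⟩
    rw [hn₀ κ h4, ← h3]
    simp only [(h6 _).2]
  have hleft : ∀ᶠ κ in 𝓝[<] k₀, Module.finrank ℂ (Hs.eigenspace κ x) = 0 ∧
      (∑ i, if φ κ i < 0 then (1 : ℤ) else 0) =
        n₀ + ∑ i, if 0 < deriv (ε i) k₀ then (1 : ℤ) else 0 := by
    filter_upwards [nhdsWithin_le_nhds hcnt, nhdsWithin_le_nhds hk₀, nhdsWithin_le_nhds hδ',
      eventually_all.2 fun i => (eventually_lt_iff_deriv (h1 i).1 (h1 i).2.1 (hd i)).2]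
      with κ h3 h4 h5 h6
    refine ⟨hzero κ h5 fun i => (h6 i).1, ?_⟩
    rw [hn₀ κ h4, ← h3]
    simp only [(h6 _).2]
  have tr : Tendsto (fun r : ℝ => k₀ + r) (𝓝[>] 0) (𝓝[>] k₀) := by
    refine tendsto_nhdsWithin_iff.2 ⟨?_, ?_⟩
    · have : Tendsto (fun r : ℝ => k₀ + r) (𝓝 0) (𝓝 (k₀ + 0)) :=
        (continuous_const.add continuous_id).tendsto _
      rw [add_zero] at this
      exact this.mono_left nhdsWithin_le_nhds
    · filter_upwards [self_mem_nhdsWithin] with r hr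
      exact lt_add_of_pos_right _ (mem_Ioi.1 hr)
  have tl : Tendsto (fun r : ℝ => k₀ - r) (𝓝[>] 0) (𝓝[<] k₀) := by
    refine tendsto_nhdsWithin_iff.2 ⟨?_, ?_⟩
    · have : Tendsto (fun r : ℝ => k₀ - r) (𝓝 0) (𝓝 (k₀ - 0)) :=
        (continuous_const.sub continuous_id).tendsto _
      rw [sub_zero] at this
      exact this.mono_left nhdsWithin_le_nhds
    · filter_upwards [self_mem_nhdsWithin] with r hr
      exact sub_lt_self _ (mem_Ioi.1 hr)
  have hr0 : ∀ᶠ r in 𝓝[>] (0 : ℝ), 0 < r := self_mem_nhdsWithin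
  have hrρ : ∀ᶠ r in 𝓝[>] (0 : ℝ), r < ρ := nhdsWithin_le_nhds (Iio_mem_nhds hρ)
  filter_upwards [hr0, hrρ, tr.eventually hright, tl.eventually hleft]
    with r hr hrρ ⟨hr1, hr2⟩ ⟨hl1, hl2⟩ c d hc hd'
  have hle : k₀ - r ≤ k₀ + r := by linarith
  have hwin : ∀ κ ∈ Icc (k₀ - r) (k₀ + r), |κ - k₀| ≤ r := fun κ hκ => by
    rw [abs_le]
    constructor <;> linarith [hκ.1, hκ.2]
  have hend : ∀ κ, |κ - k₀| = r → Module.finrank ℂ (Hs.eigenspace κ x) = 0 := by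
    intro κ hκ
    rcases abs_eq hr.le |>.1 hκ with h | h
    · rwa [show κ = k₀ + r by linarith]
    · rwa [show κ = k₀ - r by linarith]
  set χ : ℝ → ℝ := fun κ => max 0 (r - |κ - k₀|) with hχ
  have hχc : Continuous χ := by fun_prop
  have hχ0 : ∀ κ, χ κ = 0 → κ ∈ Icc (k₀ - r) (k₀ + r) → |κ - k₀| = r := by
    intro κ h hκ
    refine le_antisymm (hwin κ hκ) ?_
    have := le_max_right 0 (r - |κ - k₀|)
    change _ ≤ χ κ at this
    linarith
  have hsub : Icc (k₀ - r) (k₀ + r) ⊆ {k | |k - k₀| < ρ} := fun κ hκ => (hwin κ hκ).trans_lt hrρ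
  set g : ℝ → ℂ := fun κ => ∑ i, phase (χ κ * ((1 - φ κ i) / s)) (φ κ i) with hg
  -- The weight vanishes only at the ends of the window, where the level is not an eigenvalue, so that
  -- the phases avoid the cut.
  have hcond : ∀ κ ∈ Icc (k₀ - r) (k₀ + r), ∀ i, 0 < χ κ * ((1 - φ κ i) / s) ∨ φ κ i ≠ 0 := by
    intro κ hκ i
    by_cases h0 : φ κ i = 0
    · left
      have h3 : χ κ ≠ 0 := fun h => by
        have h4 := hend κ (hχ0 κ h hκ)
        rw [hφcard κ (hsub hκ), Nat.card_eq_zero] at h4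
        rcases h4 with h4 | h4
        · exact h4.false ⟨i, h0⟩
        · exact h4.not_finite inferInstance
      have h4 : 0 < χ κ := lt_of_le_of_ne (le_max_left _ _) h3.symm
      rw [h0]
      positivity
    · exact Or.inr h0
  have hgc : ContinuousOn g (Icc (k₀ - r) (k₀ + r)) := by
    refine continuousOn_finsetSum _ fun i _ => continuousOn_phase ?_ ((hφc i).mono hsub)
      fun κ hκ => hcond κ hκ i
    exact hχc.continuousOn.mul ((continuousOn_const.sub ((hφc i).mono hsub)).div_const s)
  have hexp : ∀ κ ∈ Icc (k₀ - r) (k₀ + r), tentDet Hs x k₀ r κ = Complex.exp (g κ) := by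
    intro κ hκ
    have h3 := hdet κ (hsub hκ) (χ κ) (isUnit_edge_weight Hs (hx κ) (le_max_left _ _)
      fun h => hend κ (hχ0 κ h hκ)).1
    rw [hg, Complex.exp_sum]
    refine h3.trans (Finset.prod_congr rfl fun i _ => ?_)
    rw [exp_phase (hcond κ hκ i)]
  -- At the ends of the window the phases count the negative `φ κ i`.
  have hval : ∀ κ, |κ - k₀| = r → κ ∈ Icc (k₀ - r) (k₀ + r) →
      g κ = ((∑ i, if φ κ i < 0 then (1 : ℤ) else 0 : ℤ) : ℂ) * (2 * π * Complex.I) := by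
    intro κ hκ hmem
    have h3 : χ κ = 0 := by
      rw [hχ]
      simp [hκ]
    rw [Int.cast_sum, Finset.sum_mul]
    refine Finset.sum_congr rfl fun i _ => ?_
    have h4 := hcond κ hmem i
    rw [h3, zero_mul] at h4 ⊢
    exact phase_zero (h4.resolve_left (lt_irrefl _))
  set p : ℝ → ℝ := fun κ => projIcc (k₀ - r) (k₀ + r) hle κ with hp
  have hpc : Continuous p := continuous_subtype_val.comp continuous_projIcc
  have hpm : ∀ κ, p κ ∈ Icc (k₀ - r) (k₀ + r) := fun κ => (projIcc _ _ hle κ).2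
  have hpr : ∀ κ, k₀ + r ≤ κ → p κ = k₀ + r := fun κ h => by
    rw [hp]
    simp only [projIcc_of_right_le hle h]
  have hpl : ∀ κ, κ ≤ k₀ - r → p κ = k₀ - r := fun κ h => by
    rw [hp]
    simp only [projIcc_of_le_left hle h]
  have habs_r : |k₀ + r - k₀| = r := by rw [add_sub_cancel_left, abs_of_pos hr]
  have habs_l : |k₀ - r - k₀| = r := by rw [sub_sub_cancel_left, abs_neg, abs_of_pos hr]
  -- Outside the window the determinant is `1` and the logarithm is continued by constants.
  refine ⟨fun κ => g (p κ), hgc.comp_continuous hpc hpm |>.continuousOn, fun κ _ => ?_, ?_⟩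
  · rw [← hexp (p κ) (hpm κ)]
    rcases le_total κ (k₀ - r) with h | h
    · rw [hpl κ h, tentDet_of_le Hs habs_l.ge, tentDet_of_le]
      rw [abs_of_nonpos (by linarith)]
      linarith
    rcases le_total (k₀ + r) κ with h' | h'
    · rw [hpr κ h', tentDet_of_le Hs habs_r.ge, tentDet_of_le]
      rw [abs_of_nonneg (by linarith)]
      linarith
    · rw [hp]
      simp only [projIcc_of_mem hle ⟨h, h'⟩]
  · simp only [hpr d hd', hpl c hc]
    rw [hval _ habs_r (right_mem_Icc.2 hle), hval _ habs_l (left_mem_Icc.2 hle), hr2, hl2,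
      ← sub_mul, ← Int.cast_sub, add_sub_add_left_eq_sub, ← Finset.sum_sub_distrib]
    congr 3
    funext i
    rcases (hd i).lt_or_gt with h | h
    · rw [if_pos h, if_neg h.not_gt, sign_neg h]
      rfl
    · rw [if_pos h, if_neg h.not_gt, sign_pos h]
      rfl

theorem hasIncrement_prod {ι : Type*} (s : Finset ι) {f : ι → ℝ → ℂ} {c d : ℝ} {w : ι → ℂ}
    (h : ∀ i ∈ s, HasIncrement (f i) c d (w i)) :
    HasIncrement (fun k => ∏ i ∈ s, f i k) c d (∑ i ∈ s, w i) := by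
  classical
  induction s using Finset.induction_on with
  | empty => exact ⟨fun _ => 0, continuousOn_const, fun _ _ => by simp, by simp⟩
  | insert i s hi ih =>
    simp only [Finset.prod_insert hi, Finset.sum_insert hi]
    exact (h i (Finset.mem_insert_self _ _)).mul
      (ih fun j hj => h j (Finset.mem_insert_of_mem hj))

/-- The number of signed crossings of an energy in the gap is the winding number of the boundary
scattering matrix at this energy: deforming the projection onto the first site to one which is
switched off away from the crossings leaves only the phases gained at the crossings. -/
theorem hasWinding_of_isSignedCrossingNumber {H : BulkHamiltonian N} (Hs : EdgeHamiltonian H)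
    {x : ℝ} (hx : ∀ k : ℝ, (x : ℂ) ∉ spectrum ℂ (H.op k)) {m : ℤ}
    (h : IsSignedCrossingNumber Hs x m) :
    HasWinding (fun k => (boundaryScat Hs x k).det) m := by
  obtain ⟨K, d, ε, hK, hbr, rfl⟩ := h
  -- A window size for which the windows about the crossings are disjoint and fit into a period.
  obtain ⟨r, hr, hrπ, hrK, hrdisj, hinc⟩ : ∃ r > 0, r < π ∧ (∀ k ∈ K, k + r ≤ 2 * π - r) ∧
      (∀ k ∈ K, ∀ k' ∈ K, k ≠ k' → 2 * r ≤ |k - k'|) ∧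
      ∀ k ∈ K, ∀ c d', c ≤ k - r → k + r ≤ d' → HasIncrement (tentDet Hs x k r) c d'
        ((∑ i, -((SignType.sign (deriv (ε k i) k) : SignType) : ℤ) : ℤ) * (2 * π * Complex.I)) := by
    have hsmall : ∀ η : ℝ, 0 < η → ∀ᶠ r in 𝓝[>] (0 : ℝ), r < η := fun η hη =>
      nhdsWithin_le_nhds (Iio_mem_nhds hη)
    have e0 : ∀ᶠ r in 𝓝[>] (0 : ℝ), 0 < r := self_mem_nhdsWithin
    have e1 : ∀ᶠ r in 𝓝[>] (0 : ℝ), ∀ k ∈ K, k + r ≤ 2 * π - r := by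
      refine (Finset.eventually_all K).2 fun k hk => ?_
      have := ((hK k).1 hk).1.2
      filter_upwards [hsmall ((2 * π - k) / 2) (by linarith)] with r hr
      linarith
    have e2 : ∀ᶠ r in 𝓝[>] (0 : ℝ), ∀ k ∈ K, ∀ k' ∈ K, k ≠ k' → 2 * r ≤ |k - k'| := by
      refine (Finset.eventually_all K).2 fun k _ => (Finset.eventually_all K).2 fun k' _ => ?_
      by_cases hkk : k = k'
      · exact Eventually.of_forall fun _ h => absurd hkk h
      · have : 0 < |k - k'| := abs_pos.2 (sub_ne_zero.2 hkk)
        filter_upwards [hsmall (|k - k'| / 2) (by linarith)] with r hr _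
        linarith
    have e3 := (Finset.eventually_all K).2 fun k hk =>
      eventually_hasIncrement_tentDet Hs hx (hbr k hk).1 (hbr k hk).2
    obtain ⟨r, h0, hπ, h1, h2, h3⟩ :=
      (e0.and ((hsmall π Real.pi_pos).and (e1.and (e2.and e3)))).exists
    exact ⟨r, h0, hπ, h1, h2, h3⟩
  have hπ := Real.pi_pos
  -- The period interval starts at `-r`, so that a window about `0` is not cut.
  have hle : -r ≤ -r + 2 * π := by linarith
  have hbot : ∀ κ ∈ Icc (-r) (-r + 2 * π), κ ∉ K → Module.finrank ℂ (Hs.eigenspace κ x) = 0 := by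
    intro κ hκ hκK
    by_contra hne
    have hne' := (eigenspace_ne_bot_iff Hs (hx κ)).2 hne
    rcases lt_or_ge κ 0 with h0 | h0
    · have hmem : κ + 2 * π ∈ K := by
        refine (hK _).2 ⟨⟨by linarith [hκ.1], by linarith⟩, ?_⟩
        rwa [EdgeHamiltonian.eigenspace, edge_op_periodic]
      linarith [hrK _ hmem, hκ.1]
    · exact hκK ((hK κ).2 ⟨⟨h0, by linarith [hκ.2]⟩, hne'⟩)
  set q : ℝ → ℝ := fun κ => ∑ k ∈ K, max 0 (r - |κ - k|) with hq
  have hqc : Continuous q := by fun_prop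
  have hq0 : ∀ κ, 0 ≤ q κ := fun κ => Finset.sum_nonneg fun k _ => le_max_left _ _
  have hqK : ∀ κ, q κ = 0 → κ ∉ K := by
    intro κ h hκ
    have h1 := (Finset.sum_eq_zero_iff_of_nonneg fun k _ => le_max_left _ _).1 h κ hκ
    rw [sub_self, abs_zero, sub_zero, max_eq_right hr.le] at h1
    exact hr.ne' h1
  -- The deformation from the constant weight `1` to the weight `q` supported near the crossings.
  set Q : ℝ → ℝ → ℝ := fun t κ => (1 - t) + t * q κ with hQ
  have hQ0 : ∀ t ∈ Icc (0 : ℝ) 1, ∀ κ, 0 ≤ Q t κ := fun t ht κ =>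
    add_nonneg (sub_nonneg.2 ht.2) (mul_nonneg ht.1 (hq0 κ))
  have hQK : ∀ t ∈ Icc (0 : ℝ) 1, ∀ κ, Q t κ = 0 → κ ∉ K := by
    intro t ht κ h
    have h1 := (add_eq_zero_iff_of_nonneg (sub_nonneg.2 ht.2) (mul_nonneg ht.1 (hq0 κ))).1 h
    have h2 : t = 1 := by linarith [h1.1]
    rw [h2, one_mul] at h1
    exact hqK κ h1.2
  have hunit := fun t ht κ hκ => isUnit_edge_weight Hs (hx κ) (hQ0 t ht κ) fun h =>
    hbot κ hκ (hQK t ht κ h)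
  set F : ℝ → ℝ → ℂ := fun t κ => (scat (Hs.op κ - (x : ℂ) • (1 : EdgeSpace N →L[ℂ] EdgeSpace N))
    (fun _ => Q t κ) siteVec).det with hF
  have hqend : q (-r) = 0 ∧ q (-r + 2 * π) = 0 := by
    constructor
    · refine Finset.sum_eq_zero fun k hk => max_eq_left ?_
      have := ((hK k).1 hk).1.1
      rw [abs_of_nonpos (by linarith)]
      linarith
    · refine Finset.sum_eq_zero fun k hk => max_eq_left ?_
      have := hrK k hk
      rw [abs_of_nonneg (by linarith)]
      linarith
  obtain ⟨w, hw0, hw1⟩ := hasIncrement_homotopy (F := F) (zero_le_one (α := ℝ)) hle (by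
      refine continuousOn_scat (X := fun p : ℝ × ℝ => Hs.op p.2 -
        (x : ℂ) • (1 : EdgeSpace N →L[ℂ] EdgeSpace N)) (q := fun p _ => Q p.1 p.2) ?_ ?_
        fun p hp => (hunit p.1 hp.1 p.2 hp.2).1
      · exact (((continuous_edge_op Hs).comp continuous_snd).sub continuous_const).continuousOn
      · refine Continuous.continuousOn (continuous_pi fun _ => ?_)
        exact (continuous_const.sub continuous_fst).add
          (continuous_fst.mul (hqc.comp continuous_snd)))
    (fun t ht κ hκ => scat_det_ne_zero (hunit t ht κ hκ).1 (hunit t ht κ hκ).2)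
    (fun t ht => by
      simp only [hF, hQ, hqend, edge_op_periodic])
  have hF0 : F 0 = fun κ => (boundaryScat Hs x κ).det := by
    funext κ
    simp only [hF, hQ, sub_zero, zero_mul, add_zero, boundaryScat]
  have hF1 : F 1 = fun κ => ∏ k ∈ K, tentDet Hs x k r κ := by
    funext κ
    by_cases hκ : ∃ k ∈ K, |κ - k| < r
    · obtain ⟨k, hk, hkκ⟩ := hκ
      have hoff : ∀ k' ∈ K, k' ≠ k → r ≤ |κ - k'| := by
        intro k' hk' hne
        have h1 := hrdisj k hk k' hk' hne.symm
        have h2 := abs_sub_le k κ k'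
        rw [abs_sub_comm k κ] at h2
        linarith
      rw [Finset.prod_eq_single_of_mem k hk fun k' hk' hne => tentDet_of_le Hs (hoff k' hk' hne)]
      have : q κ = max 0 (r - |κ - k|) := Finset.sum_eq_single_of_mem k hk fun k' hk' hne =>
        max_eq_left (by linarith [hoff k' hk' hne])
      simp only [hF, hQ, sub_self, one_mul, zero_add, this, tentDet]
    · push Not at hκ
      rw [Finset.prod_eq_one fun k hk => tentDet_of_le Hs (hκ k hk)]
      have : q κ = 0 := Finset.sum_eq_zero fun k hk => max_eq_left (by linarith [hκ k hk])
      simp only [hF, hQ, sub_self, one_mul, zero_add, this, scat_zero, Matrix.det_one]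
  have hprod := hasIncrement_prod K fun k hk => hinc k hk (-r) (-r + 2 * π)
    (by linarith [((hK k).1 hk).1.1]) (by linarith [hrK k hk])
  rw [hF1] at hw1
  rw [hF0] at hw0
  obtain ⟨m, hm⟩ := exists_hasWinding_boundaryScat Hs hx
  have h1 := hm.hasIncrement_period (fun k => by rw [boundaryScat_periodic]) (-r)
  have h2 := (h1.unique hle hw0).trans (hw1.unique hle hprod)
  rw [← Finset.sum_mul, ← Int.cast_sum] at h2
  have h3 := mul_right_cancel₀ Complex.two_pi_I_ne_zero h2
  rwa [← Int.cast_injective (α := ℂ) h3]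

/-! ### Energies below the bulk spectrum -/

theorem exists_norm_edge_op_le {H : BulkHamiltonian N} (Hs : EdgeHamiltonian H) :
    ∃ C, 0 ≤ C ∧ ∀ k, ‖Hs.op k‖ ≤ C := by
  obtain ⟨C, hC⟩ := isCompact_Icc.exists_bound_of_continuousOn (s := Icc (0 : ℝ) (2 * π))
    (continuous_edge_op Hs).continuousOn
  refine ⟨C, (norm_nonneg _).trans (hC 0 ⟨le_rfl, by positivity⟩), fun k => ?_⟩
  have hp : Function.Periodic Hs.op (2 * π) := edge_op_periodic Hs
  obtain ⟨k', hk', he⟩ := hp.exists_mem_Ico₀ (by positivity) k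
  rw [he]
  exact hC k' (Ico_subset_Icc_self hk')

/-- Below the bulk spectrum the winding number vanishes, since far below there are no edge
eigenvalues. -/
theorem hasWinding_boundaryScat_zero {H : BulkHamiltonian N} (Hs : EdgeHamiltonian H) {x : ℝ}
    (hx : ∀ k : ℝ, ∀ y ≤ x, (y : ℂ) ∉ spectrum ℂ (H.op k)) :
    HasWinding (fun k => (boundaryScat Hs x k).det) 0 := by
  obtain ⟨C, hC0, hC⟩ := exists_norm_edge_op_le Hs
  set y := min x (-(C + 1)) with hy
  have hyx : y ≤ x := min_le_left _ _
  have hyC : y ≤ -(C + 1) := min_le_right _ _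
  have hbot : ∀ k, Hs.eigenspace k y = ⊥ := by
    intro k
    rw [Submodule.eq_bot_iff]
    intro ψ hψ
    rw [EdgeHamiltonian.eigenspace, Module.End.mem_eigenspace_iff] at hψ
    change Hs.op k ψ = (y : ℂ) • ψ at hψ
    have h1 := ((Hs.op k).le_opNorm ψ).trans (mul_le_mul_of_nonneg_right (hC k) (norm_nonneg ψ))
    rw [hψ, norm_smul, Complex.norm_real, Real.norm_eq_abs, abs_of_nonpos (by linarith)] at h1
    have h2 : ‖ψ‖ ≤ 0 := by nlinarith [norm_nonneg ψ]
    exact norm_le_zero_iff.1 h2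
  refine hasWinding_boundaryScat_energy Hs (a := y) (fun k z hz => hx k z ?_)
    (hasWinding_of_isSignedCrossingNumber Hs (fun k => hx k y hyx) ?_)
  · rw [uIcc_of_le hyx] at hz
    exact hz.2
  · exact ⟨∅, fun _ => 0, fun _ i => i.elim0, fun k => by simp [hbot], by simp, by simp⟩

end BulkEdge

theorem theorem3 {N : ℕ} (H : BulkEdge.BulkHamiltonian N) (Hs : BulkEdge.EdgeHamiltonian H)
    (μ : ℝ) (hgap : ∀ k : ℝ, (μ : ℂ) ∉ spectrum ℂ (H.op k))
    (γ : ℝ → ℂ) (hγ : BulkEdge.IsFermiLoop H μ γ) :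
    ∃ n : ℤ, (∀ m : ℤ, BulkEdge.IsBulkIndex H γ m ↔ m = n) ∧
      (∃ a b : ℝ, BulkEdge.IsGapInterval H μ a b) ∧
      (∀ a b : ℝ, BulkEdge.IsGapInterval H μ a b →
        ∀ m : ℤ, BulkEdge.IsEdgeIndex Hs a b m ↔ m = n) := by
  obtain ⟨n, hn⟩ := BulkEdge.exists_hasWinding_boundaryScat (BulkEdge.halfLine H) hgap
  refine ⟨n, fun m => ?_, BulkEdge.exists_isGapInterval H μ hgap, fun a b hab m => ?_⟩
  · rw [BulkEdge.isBulkIndex_iff hgap hγ hn (BulkEdge.hasWinding_boundaryScat_zero _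
      fun k y hy => hγ.notMem_spectrum_of_le hy k) m, sub_zero]
  · obtain ⟨ha, hb, hfree⟩ := hab
    -- Every admissible level of the gap interval yields the winding number at `μ`.
    have key : ∀ m', BulkEdge.IsEdgeIndex Hs a b m' → m' = n := by
      rintro m' ⟨x, hx, hm'⟩
      have h1 := BulkEdge.hasWinding_of_isSignedCrossingNumber Hs (fun k => hfree k x hx) hm'
      have h2 := BulkEdge.hasWinding_boundaryScat_energy Hs (b := μ) (fun k y hy =>
        hfree k y (uIcc_subset_Icc hx ⟨ha.le, hb.le⟩ hy)) h1
      exact (BulkEdge.hasWinding_boundaryScat_potential Hs (BulkEdge.halfLine H) hgap h2).unique hn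
    refine ⟨key m, ?_⟩
    rintro rfl
    obtain ⟨x, hx, m', hm'⟩ := BulkEdge.exists_isSignedCrossingNumber Hs (ha.trans hb) hfree
    have h := key m' ⟨x, hx, hm'⟩
    exact ⟨x, hx, h ▸ hm'⟩
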